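/- **Local convergence of the Euler discretizations of CSD and MCSD.** Let $f:\mathbb R^d\to\mathbb R$ and $c=(c_1,\dots,c_m):\mathbb R^d\to\mathbb R^m$ be smooth, let $\mathcal M=\{x: c(x)=0\}$, and assume that $A(x)=(\nabla c_1(x),\dots,\nabla c_m(x))$ has full column rank for every $x\in\mathcal M$. Let $T_x\mathcal M=\{v:A(x)^\top v=0\}$, $P(x)=I-A(x)(A(x)^\top A(x))^{-1}A(x)^\top$, $\operatorname{grad}f(x)=P(x)\nabla f(x)$ and $\operatorname{Hess}f(x)[v]=P(x)\,\partial_v(\operatorname{grad}f)(x)$ for $v\in T_x\mathcal M$. Let $\mathrm{Ret}$ be a retraction on $\mathcal M$ (a smooth map $(x,v)\mapsto \mathrm{Ret}_x(v)\in\mathcal M$ on the tangent bundle with $\mathrm{Ret}_x(0)=x$ and $\frac{d}{dt}\big|_{t=0}\mathrm{Ret}_x(t\eta)=\eta$), and for $x,y\in\mathcal M$ let $P_{x\to y}:T_x\mathcal M\to T_y\mathcal M$ be the parallel translation along the shortest geodesic from $x$ to $y$ (which exists and is unique for $x,y$ close to a given point). Let $0\le k\le d-m-1$ and let $x^*\in\mathcal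 M$ satisfy $\operatorname{grad}f(x^*)=0$. Assume (strict saddle) that there are $\delta>0$ and $L>\mu>0$ such that at every $x\in\mathcal M$ with geodesic distance $d(x,x^*)<\delta$ the eigenvalues of $\operatorname{Hess}f(x)$ on $T_x\mathcal M$, counted with multiplicity, satisfy $$-L\le\lambda_1\le\cdots\le\lambda_k\le-\mu<0<\mu\le\lambda_{k+1}\le\cdots\le\lambda_{d-m}\le L .$$ Let $v_1^*,\dots,v_k^*\in T_{x^*}\mathcal M$ be orthonormal eigenvectors of $\operatorname{Hess}f(x^*)$ with negative eigenvalues, and let $R^*=I-2\sum_{i=1}^k v_i^*{v_i^*}^{\top}$ on $T_{x^*}\mathcal M$. For a self-adjoint operator $B=V\Sigma V^\top$ on $T_x\mathcal M$, with $V$ orthogonal and the eigenvalues in $\Sigma$ in increasing order, put $\mathrm{Orth}_x(B)=V\operatorname{diag}(-1,\dots,-1,1,\dots,1)V^\top$ with $k$ entries $-1$. For a step size $\Delta t$, the Euler discretization of CSD acts on pairs $(x,R)$, where $x\in\mathcal M$ and $R$ is a self-adjoint operator on $T_x\mathcal M$: $$\begin{aligned}x_{n+1}&=\mathrm{Ret}_{x_n}(-\Delta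 t\,R_n\operatorname{grad}f(x_n)),\\ \bar R_{n+1}&=R_n+\Delta t\,(\operatorname{Hess}f(x_n)-R_n\operatorname{Hess}f(x_n)R_n),\\ \hat R_{n+1}&=\mathrm{Orth}_{x_n}(\bar R_{n+1}),\\ R_{n+1}&=P_{x_n\to x_{n+1}}\circ\hat R_{n+1}\circ P_{x_{n+1}\to x_n}.\end{aligned}$$ The Euler discretization of MCSD acts on triples $(x,r,R)$ with moreover $r\in T_x\mathcal M$: $$\bar r_n=-\Delta t\,R_n\operatorname{grad}f(x_n)+\gamma r_n,\qquad x_{n+1}=\mathrm{Ret}_{x_n}(\bar r_n),\qquad r_{n+1}=P_{x_n\to x_{n+1}}\bar r_n,$$ with the same three lines for $\bar R_{n+1},\hat R_{n+1},R_{n+1}$. Call a map $\Phi$ of a state space into itself *locally contractive* at $p$ if $\Phi(p)=p$, all eigenvalues of the Jacobian of $\Phi$ at $p$ lie in the open unit disk, and there are a neighbourhood $U$ of $p$ in the state space with $\Phi(U)\subseteq U$, a norm $N$ on the ambient vector space and $\rho<1$ such that $N(\Phi(q)-\Phi(q'))\le\rho\,N(q-q')$ for all $q,q'\in U$. (States are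 regarded as elements of $\mathbb R^d\times\mathbb R^{d\times d}$, resp. $\mathbb R^d\times\mathbb R^d\times\mathbb R^{d\times d}$, operators on $T_x\mathcal M$ being extended by $0$ to the normal space.) Call $p$ *asymptotically linearly stable* if there are $C$ and $\rho\in[0,1)$ with $\|\Phi^n(q)-p\|\le C\rho^n\|q-p\|$ for all states $q$ close to $p$ and all $n\ge0$. If $0<\Delta t<\frac1{2L}$, then: 1. the Euler discretization of CSD is locally contractive, and asymptotically linearly stable, at $(x^*,R^*)$; 2. for every $0<\gamma<1$, the Euler discretization of MCSD is locally contractive, and asymptotically linearly stable, at $(x^*,0,R^*)$. -/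

import Mathlib

open scoped ContDiff Topology

namespace SaddleDynamics

/-! ### The constraint manifold `M = {x ∈ ℝᵈ | c x = 0}` -/

/-- The feasible set `M = {x | c(x) = 0}`, where `c = (c₁, …, c_m)`. -/
def feasibleSet {d m : ℕ} (c : EuclideanSpace ℝ (Fin d) → EuclideanSpace ℝ (Fin m)) :
    Set (EuclideanSpace ℝ (Fin d)) :=
  {x | c x = 0}

/-- `A(x) = (∇c₁(x), …, ∇c_m(x))`, as the operator `a ↦ ∑ aᵢ ∇cᵢ(x)`: the transpose of the
Jacobian of `c`. -/
noncomputable def constraintGrad {d m : ℕ}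
    (c : EuclideanSpace ℝ (Fin d) → EuclideanSpace ℝ (Fin m)) (x : EuclideanSpace ℝ (Fin d)) :
    EuclideanSpace ℝ (Fin m) →L[ℝ] EuclideanSpace ℝ (Fin d) :=
  ContinuousLinearMap.adjoint (fderiv ℝ c x)

/-- Linear independence constraint qualification: `A(x)` has full column rank on `M`. -/
def SatisfiesLICQ {d m : ℕ} (c : EuclideanSpace ℝ (Fin d) → EuclideanSpace ℝ (Fin m)) : Prop :=
  ∀ x ∈ feasibleSet c, Function.Injective (constraintGrad c x)

/-- The tangent space `T_x M = {v | A(x)ᵀ v = 0}`. -/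
noncomputable def tangentSpace {d m : ℕ}
    (c : EuclideanSpace ℝ (Fin d) → EuclideanSpace ℝ (Fin m)) (x : EuclideanSpace ℝ (Fin d)) :
    Submodule ℝ (EuclideanSpace ℝ (Fin d)) :=
  LinearMap.ker (ContinuousLinearMap.adjoint (constraintGrad c x)).toLinearMap

/-- The orthogonal projector `P(x) = I - A(x) (A(x)ᵀ A(x))⁻¹ A(x)ᵀ` onto the tangent space. -/
noncomputable def tangentProj {d m : ℕ}
    (c : EuclideanSpace ℝ (Fin d) → EuclideanSpace ℝ (Fin m)) (x : EuclideanSpace ℝ (Fin d)) :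
    EuclideanSpace ℝ (Fin d) →L[ℝ] EuclideanSpace ℝ (Fin d) :=
  ContinuousLinearMap.id ℝ _ -
    constraintGrad c x ∘L
      (ContinuousLinearMap.adjoint (constraintGrad c x) ∘L constraintGrad c x).inverse ∘L
        ContinuousLinearMap.adjoint (constraintGrad c x)

/-- The Riemannian gradient `grad f(x) = P(x) ∇f(x)`. -/
noncomputable def riemGrad {d m : ℕ} (f : EuclideanSpace ℝ (Fin d) → ℝ)
    (c : EuclideanSpace ℝ (Fin d) → EuclideanSpace ℝ (Fin m)) (x : EuclideanSpace ℝ (Fin d)) :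
    EuclideanSpace ℝ (Fin d) :=
  tangentProj c x (gradient f x)

/-- The Riemannian Hessian `Hess f(x)[v] = P(x) (∂_v grad f(x))` for `v ∈ T_x M`, extended to all
of `ℝᵈ` by composing with `P(x)`.  Throughout, a linear operator on `T_x M` is represented by its
extension to `ℝᵈ` that vanishes on the normal space. -/
noncomputable def riemHess {d m : ℕ} (f : EuclideanSpace ℝ (Fin d) → ℝ)
    (c : EuclideanSpace ℝ (Fin d) → EuclideanSpace ℝ (Fin m)) (x : EuclideanSpace ℝ (Fin d)) :
    EuclideanSpace ℝ (Fin d) →L[ℝ] EuclideanSpace ℝ (Fin d) :=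
  tangentProj c x ∘L fderiv ℝ (riemGrad f c) x ∘L tangentProj c x

/-! ### Geodesic distance and the strict saddle assumption -/

/-- The length of the curve `σ` on `[0, 1]`. -/
noncomputable def curveLength {d : ℕ} (σ : ℝ → EuclideanSpace ℝ (Fin d)) : ENNReal :=
  ∫⁻ t in Set.Icc (0 : ℝ) 1, ‖deriv σ t‖ₑ

/-- The geodesic distance on `M`: the infimum of the lengths of the `C¹` curves in `M` joining
`x` to `y` (it is `∞` when there are none). -/
noncomputable def geodesicDist {d m : ℕ}
    (c : EuclideanSpace ℝ (Fin d) → EuclideanSpace ℝ (Fin m))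
    (x y : EuclideanSpace ℝ (Fin d)) : ENNReal :=
  sInf {ℓ | ∃ σ : ℝ → EuclideanSpace ℝ (Fin d), ContDiff ℝ 1 σ ∧ σ 0 = x ∧ σ 1 = y ∧
    (∀ t ∈ Set.Icc (0 : ℝ) 1, σ t ∈ feasibleSet c) ∧ ℓ = curveLength σ}

/-- The eigenvalues `lam 0 ≤ lam 1 ≤ ⋯` (with multiplicity) of an operator `B` on the
`(d - m)`-dimensional space `T_x M`, with an orthonormal basis `b` of eigenvectors. -/
def IsOrderedEigenbasis {d m : ℕ} (c : EuclideanSpace ℝ (Fin d) → EuclideanSpace ℝ (Fin m))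
    (x : EuclideanSpace ℝ (Fin d)) (B : EuclideanSpace ℝ (Fin d) →L[ℝ] EuclideanSpace ℝ (Fin d))
    (lam : Fin (d - m) → ℝ) (b : OrthonormalBasis (Fin (d - m)) ℝ (tangentSpace c x)) : Prop :=
  Monotone lam ∧
    ∀ i, B (b i : EuclideanSpace ℝ (Fin d)) = lam i • (b i : EuclideanSpace ℝ (Fin d))

/-- The strict saddle assumption with constants `δ`, `μ`, `L`: at every point of `M` at geodesic
distance less than `δ` from `xs`, the eigenvalues of the Riemannian Hessian satisfy
`-L ≤ λ₁ ≤ ⋯ ≤ λ_k ≤ -μ < 0 < μ ≤ λ_{k+1} ≤ ⋯ ≤ λ_{d-m} ≤ L`. -/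
def StrictSaddle {d m : ℕ} (f : EuclideanSpace ℝ (Fin d) → ℝ)
    (c : EuclideanSpace ℝ (Fin d) → EuclideanSpace ℝ (Fin m)) (k : ℕ)
    (xs : EuclideanSpace ℝ (Fin d)) (δ μ L : ℝ) : Prop :=
  0 < δ ∧ 0 < μ ∧ μ < L ∧
    ∀ x ∈ feasibleSet c, geodesicDist c x xs < ENNReal.ofReal δ →
      ∃ (lam : Fin (d - m) → ℝ) (b : OrthonormalBasis (Fin (d - m)) ℝ (tangentSpace c x)),
        IsOrderedEigenbasis c x (riemHess f c x) lam b ∧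
        (∀ i : Fin (d - m), (i : ℕ) < k → -L ≤ lam i ∧ lam i ≤ -μ) ∧
        (∀ i : Fin (d - m), k ≤ (i : ℕ) → μ ≤ lam i ∧ lam i ≤ L)

/-! ### Retractions and parallel translation -/

/-- A retraction on `M`: a smooth map `(x, v) ↦ Ret_x(v)` from the tangent bundle to `M` with
`Ret_x(0) = x` and `d/dt|_{t=0} Ret_x(tη) = η`. -/
structure IsRetraction {d m : ℕ} (c : EuclideanSpace ℝ (Fin d) → EuclideanSpace ℝ (Fin m))
    (Ret : EuclideanSpace ℝ (Fin d) → EuclideanSpace ℝ (Fin d) → EuclideanSpace ℝ (Fin d)) :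
    Prop where
  mem : ∀ x ∈ feasibleSet c, ∀ v ∈ tangentSpace c x, Ret x v ∈ feasibleSet c
  smooth : ContDiffOn ℝ ∞
    (fun p : EuclideanSpace ℝ (Fin d) × EuclideanSpace ℝ (Fin d) => Ret p.1 p.2)
    {p | p.1 ∈ feasibleSet c ∧ p.2 ∈ tangentSpace c p.1}
  zero : ∀ x ∈ feasibleSet c, Ret x 0 = x
  hasDeriv : ∀ x ∈ feasibleSet c, ∀ η ∈ tangentSpace c x,
    HasDerivAt (fun t : ℝ => Ret x (t • η)) η 0

/-- `σ`, restricted to `[0, 1]`, is a geodesic of `M` from `x` to `y`: a curve in `M` whose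
covariant acceleration `P(σ) σ''` vanishes. -/
structure IsGeodesic {d m : ℕ} (c : EuclideanSpace ℝ (Fin d) → EuclideanSpace ℝ (Fin m))
    (σ : ℝ → EuclideanSpace ℝ (Fin d)) (x y : EuclideanSpace ℝ (Fin d)) : Prop where
  contDiff : ContDiff ℝ 2 σ
  source : σ 0 = x
  target : σ 1 = y
  mem : ∀ t ∈ Set.Icc (0 : ℝ) 1, σ t ∈ feasibleSet c
  acceleration : ∀ t ∈ Set.Icc (0 : ℝ) 1, tangentProj c (σ t) (deriv (deriv σ) t) = 0

/-- A shortest geodesic from `x` to `y`. -/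
def IsShortestGeodesic {d m : ℕ} (c : EuclideanSpace ℝ (Fin d) → EuclideanSpace ℝ (Fin m))
    (σ : ℝ → EuclideanSpace ℝ (Fin d)) (x y : EuclideanSpace ℝ (Fin d)) : Prop :=
  IsGeodesic c σ x y ∧ ∀ τ, IsGeodesic c τ x y → curveLength σ ≤ curveLength τ

/-- `ζ` is a parallel tangent vector field along `σ` on `[0, 1]`: its covariant derivative
`D ζ / dt = P(σ) ζ'` vanishes. -/
structure IsParallelAlong {d m : ℕ} (c : EuclideanSpace ℝ (Fin d) → EuclideanSpace ℝ (Fin m))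
    (σ ζ : ℝ → EuclideanSpace ℝ (Fin d)) : Prop where
  contDiff : ContDiff ℝ 1 ζ
  mem : ∀ t ∈ Set.Icc (0 : ℝ) 1, ζ t ∈ tangentSpace c (σ t)
  parallel : ∀ t ∈ Set.Icc (0 : ℝ) 1, tangentProj c (σ t) (deriv ζ t) = 0

/-- `T` is the parallel translation `T_x M → T_y M` along some shortest geodesic from `x` to `y`
(extended by `0` to the normal space at `x`). -/
def IsParallelTranslation {d m : ℕ} (c : EuclideanSpace ℝ (Fin d) → EuclideanSpace ℝ (Fin m))
    (x y : EuclideanSpace ℝ (Fin d))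
    (T : EuclideanSpace ℝ (Fin d) →L[ℝ] EuclideanSpace ℝ (Fin d)) : Prop :=
  (∃ σ, IsShortestGeodesic c σ x y ∧
    ∀ v ∈ tangentSpace c x, ∃ ζ, IsParallelAlong c σ ζ ∧ ζ 0 = v ∧ ζ 1 = T v) ∧
  T ∘L tangentProj c x = T

/-- The parallel translation `P_{x → y}` along the shortest geodesic.  For nearby points of `M`
this geodesic is unique; otherwise one of the shortest geodesics is selected. -/
noncomputable def parallelTranslation {d m : ℕ}
    (c : EuclideanSpace ℝ (Fin d) → EuclideanSpace ℝ (Fin m))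
    (x y : EuclideanSpace ℝ (Fin d)) :
    EuclideanSpace ℝ (Fin d) →L[ℝ] EuclideanSpace ℝ (Fin d) :=
  Classical.epsilon (IsParallelTranslation c x y)

/-! ### The schemes -/

/-- `S` arises from the operator `B` on `T_x M` by an eigendecomposition `B = V Σ Vᵀ` with
increasingly ordered eigenvalues, as `S = V diag(-1, …, -1, 1, …, 1) Vᵀ` with `k` entries `-1`. -/
def IsOrth {d m : ℕ} (c : EuclideanSpace ℝ (Fin d) → EuclideanSpace ℝ (Fin m)) (k : ℕ)
    (x : EuclideanSpace ℝ (Fin d))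
    (B S : EuclideanSpace ℝ (Fin d) →L[ℝ] EuclideanSpace ℝ (Fin d)) : Prop :=
  (∃ (lam : Fin (d - m) → ℝ) (b : OrthonormalBasis (Fin (d - m)) ℝ (tangentSpace c x)),
    IsOrderedEigenbasis c x B lam b ∧
    ∀ i, S (b i : EuclideanSpace ℝ (Fin d)) =
      if (i : ℕ) < k then -(b i : EuclideanSpace ℝ (Fin d)) else (b i : EuclideanSpace ℝ (Fin d))) ∧
  S ∘L tangentProj c x = S

/-- The orthogonalization step `Orth_x(B)`.  It does not depend on the eigenbasis when the `k`-th
and `(k+1)`-st eigenvalues of `B` differ; otherwise one of the possible outputs is selected. -/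
noncomputable def orth {d m : ℕ} (c : EuclideanSpace ℝ (Fin d) → EuclideanSpace ℝ (Fin m)) (k : ℕ)
    (x : EuclideanSpace ℝ (Fin d))
    (B : EuclideanSpace ℝ (Fin d) →L[ℝ] EuclideanSpace ℝ (Fin d)) :
    EuclideanSpace ℝ (Fin d) →L[ℝ] EuclideanSpace ℝ (Fin d) :=
  Classical.epsilon (IsOrth c k x B)

/-- The update of `R` while the point moves from `x` to `y`: one Euler step
`R + Δt (Hess f(x) - R Hess f(x) R)`, orthogonalization, and transport of the operator. -/
noncomputable def reflectionUpdate {d m : ℕ} (f : EuclideanSpace ℝ (Fin d) → ℝ)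
    (c : EuclideanSpace ℝ (Fin d) → EuclideanSpace ℝ (Fin m)) (k : ℕ) (Δt : ℝ)
    (x y : EuclideanSpace ℝ (Fin d))
    (R : EuclideanSpace ℝ (Fin d) →L[ℝ] EuclideanSpace ℝ (Fin d)) :
    EuclideanSpace ℝ (Fin d) →L[ℝ] EuclideanSpace ℝ (Fin d) :=
  parallelTranslation c x y ∘L
    orth c k x (R + Δt • (riemHess f c x - R ∘L riemHess f c x ∘L R)) ∘L
      parallelTranslation c y x

/-- One step `(x, R) ↦ (x⁺, R⁺)` of the Euler discretization of CSD. -/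
noncomputable def csdStep {d m : ℕ} (f : EuclideanSpace ℝ (Fin d) → ℝ)
    (c : EuclideanSpace ℝ (Fin d) → EuclideanSpace ℝ (Fin m))
    (Ret : EuclideanSpace ℝ (Fin d) → EuclideanSpace ℝ (Fin d) → EuclideanSpace ℝ (Fin d))
    (k : ℕ) (Δt : ℝ) :
    EuclideanSpace ℝ (Fin d) × (EuclideanSpace ℝ (Fin d) →L[ℝ] EuclideanSpace ℝ (Fin d)) →
    EuclideanSpace ℝ (Fin d) × (EuclideanSpace ℝ (Fin d) →L[ℝ] EuclideanSpace ℝ (Fin d)) :=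
  fun (x, R) =>
    let y := Ret x (-(Δt • R (riemGrad f c x)))
    (y, reflectionUpdate f c k Δt x y R)

/-- One step `(x, r, R) ↦ (x⁺, r⁺, R⁺)` of the Euler discretization of MCSD. -/
noncomputable def mcsdStep {d m : ℕ} (f : EuclideanSpace ℝ (Fin d) → ℝ)
    (c : EuclideanSpace ℝ (Fin d) → EuclideanSpace ℝ (Fin m))
    (Ret : EuclideanSpace ℝ (Fin d) → EuclideanSpace ℝ (Fin d) → EuclideanSpace ℝ (Fin d))
    (k : ℕ) (Δt γ : ℝ) :
    EuclideanSpace ℝ (Fin d) × EuclideanSpace ℝ (Fin d) ×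
      (EuclideanSpace ℝ (Fin d) →L[ℝ] EuclideanSpace ℝ (Fin d)) →
    EuclideanSpace ℝ (Fin d) × EuclideanSpace ℝ (Fin d) ×
      (EuclideanSpace ℝ (Fin d) →L[ℝ] EuclideanSpace ℝ (Fin d)) :=
  fun (x, r, R) =>
    let rbar := -(Δt • R (riemGrad f c x)) + γ • r
    let y := Ret x rbar
    (y, parallelTranslation c x y rbar, reflectionUpdate f c k Δt x y R)

/-- `R` represents a self-adjoint operator on `T_x M` (extended by `0` to the normal space). -/
def IsTangentSymmetric {d m : ℕ} (c : EuclideanSpace ℝ (Fin d) → EuclideanSpace ℝ (Fin m))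
    (x : EuclideanSpace ℝ (Fin d))
    (R : EuclideanSpace ℝ (Fin d) →L[ℝ] EuclideanSpace ℝ (Fin d)) : Prop :=
  IsSelfAdjoint R ∧ (∀ u, R u ∈ tangentSpace c x) ∧ R ∘L tangentProj c x = R

/-- The states of the CSD scheme: `x ∈ M` and `R` a self-adjoint operator on `T_x M`. -/
def csdStates {d m : ℕ} (c : EuclideanSpace ℝ (Fin d) → EuclideanSpace ℝ (Fin m)) :
    Set (EuclideanSpace ℝ (Fin d) × (EuclideanSpace ℝ (Fin d) →L[ℝ] EuclideanSpace ℝ (Fin d))) :=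
  {p | p.1 ∈ feasibleSet c ∧ IsTangentSymmetric c p.1 p.2}

/-- The states of the MCSD scheme: `x ∈ M`, `r ∈ T_x M` and `R` self-adjoint on `T_x M`. -/
def mcsdStates {d m : ℕ} (c : EuclideanSpace ℝ (Fin d) → EuclideanSpace ℝ (Fin m)) :
    Set (EuclideanSpace ℝ (Fin d) × EuclideanSpace ℝ (Fin d) ×
      (EuclideanSpace ℝ (Fin d) →L[ℝ] EuclideanSpace ℝ (Fin d))) :=
  {p | p.1 ∈ feasibleSet c ∧ p.2.1 ∈ tangentSpace c p.1 ∧ IsTangentSymmetric c p.1 p.2.2}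

/-- The reflection `I - 2 ∑ vᵢ vᵢᵀ` of `T_x M` (extended by `0` to the normal space). -/
noncomputable def householder {d m k : ℕ}
    (c : EuclideanSpace ℝ (Fin d) → EuclideanSpace ℝ (Fin m))
    (x : EuclideanSpace ℝ (Fin d)) (v : Fin k → EuclideanSpace ℝ (Fin d)) :
    EuclideanSpace ℝ (Fin d) →L[ℝ] EuclideanSpace ℝ (Fin d) :=
  tangentProj c x - (2 : ℝ) • ∑ i, (innerSL ℝ (v i)).smulRight (v i)

/-! ### Local contractivity and asymptotic linear stability -/

/-- The map `Φ`, considered on the state set `S`, is locally contractive at `p`: `p` is a fixed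
point, all eigenvalues of the Jacobian of `Φ` at `p` lie in the open unit disk, and for some norm
`N` equivalent to the given one, `Φ` maps a neighbourhood `U` of `p` in `S` to itself and is a
strict contraction there.

The Jacobian is a linear map `J` of the ambient space that is a derivative of `Φ` at `p` within `S`.
If `S` is a submanifold, then `J` restricts to the differential of `Φ` on the tangent space of `S`,
whose eigenvalues are among those of `J`. -/
def IsLocallyContractiveAt {X : Type*} [NormedAddCommGroup X] [NormedSpace ℝ X]
    [FiniteDimensional ℝ X] (S : Set X) (Φ : X → X) (p : X) : Prop :=
  p ∈ S ∧ Φ p = p ∧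
    (∃ J : X →L[ℝ] X, HasFDerivWithinAt Φ J S p ∧
      ∀ z ∈ J.toLinearMap.charpoly.aroots ℂ, ‖z‖ < 1) ∧
    ∃ (N : Seminorm ℝ X) (a b ρ : ℝ) (U : Set X),
      0 < a ∧ (∀ v, a * ‖v‖ ≤ N v ∧ N v ≤ b * ‖v‖) ∧ 0 ≤ ρ ∧ ρ < 1 ∧
      U ∈ 𝓝[S] p ∧ U ⊆ S ∧ Set.MapsTo Φ U U ∧
      ∀ q ∈ U, ∀ q' ∈ U, N (Φ q - Φ q') ≤ ρ * N (q - q')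

/-- Asymptotic linear stability of `p`: the iterates of `Φ` from all states close to `p` remain
states and converge to `p` at a uniform geometric rate. -/
def IsLinearlyStableAt {X : Type*} [NormedAddCommGroup X] [NormedSpace ℝ X]
    (S : Set X) (Φ : X → X) (p : X) : Prop :=
  ∃ C ρ : ℝ, 0 ≤ ρ ∧ ρ < 1 ∧
    ∀ᶠ q in 𝓝[S] p, ∀ n : ℕ, Φ^[n] q ∈ S ∧ ‖Φ^[n] q - p‖ ≤ C * ρ ^ n * ‖q - p‖

end SaddleDynamics

/-! Both stability notions follow from one principle. Suppose that near the fixed point `p` the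
scheme agrees, on the state set, with an ambient map that is strictly differentiable at `p`, with
derivative `J`, and that `J` contracts some norm `N`. Strict differentiability bounds the error of
the linearization by a small multiple of `‖q - q'‖`, so the scheme contracts `N` on a small `N`-ball
of states and maps that ball to itself. The powers of `J` tend to zero, so its complex eigenvalues
lie in the open unit disk (`contractive_and_stable_of_strict`). It remains to find the ambient map
and the norm.

The ambient map. A local projection `π` onto the manifold (`exists_nearby_projection`) extends the
retraction and the reflected gradient. For `Orth`, an involution commuting with `B` solves an
equation to which the implicit function theorem applies (`exists_local_sign`), and a trace argument
shows that the ordered eigenvectors select the solution near the reflection (`exists_orth_eq`).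
Parallel translation is the time-one map of the ODE `σ'' = DP(σ)[σ']σ'`, `Z' = DP(σ)[σ']Z`, where
`P` is the tangent projector. The linearization of this field at an equilibrium squares to zero, so
the time-one map has derivative `I + A` there. Inverting the exponential map expresses the
translation through the two end points, and uniqueness of short geodesics identifies the result with
`parallelTranslation` (`exists_parallelTranslation_eq`).

The norm. As `grad f` vanishes at the saddle, the linearized position and momentum do not depend on
`R`, so `J` is block triangular and a weighted sum of norms for the two diagonal blocks suffices
(`contractive_and_stable_of_blockTriangular`). In an eigenbasis of the Hessian `H`, the reflection
turns `H` into `|H|`. The position block of CSD is then `P (I - Δt |H|)`, of norm at most `1 - Δt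
μ`; that of MCSD is a heavy ball iteration with an explicit quadratic Lyapunov function
(`heavyBall_lyapunov_le`). The reflection block has operator norm at most `1 - 2 Δt μ`
(`norm_reflection_deriv_le`); this is where `Δt < 1 / (2L)` is needed. -/

namespace SaddleDynamics

/-! ### Flows near an equilibrium -/

section Flow

open Set Metric NNReal

variable {X : Type*} [NormedAddCommGroup X] [NormedSpace ℝ X] [CompleteSpace X]

/-- The Picard–Lindelöf theorem with control on the range of the solution. -/
theorem exists_solution_mem_closedBall {V : X → X} {p₀ p : X} {a r L K : ℝ≥0} {tmin tmax : ℝ}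
    {t₀ : Icc tmin tmax} (h : IsPicardLindelof (fun _ => V) t₀ p₀ a r L K)
    (hp : p ∈ closedBall p₀ r) :
    ∃ α : ℝ → X, α t₀ = p ∧ ∀ t ∈ Icc tmin tmax, α t ∈ closedBall p₀ a ∧
      HasDerivWithinAt α (V (α t)) (Icc tmin tmax) t := by
  obtain ⟨α, hα⟩ := ODE.FunSpace.exists_isFixedPt_next h hp
  refine ⟨α.compProj, by rw [ODE.FunSpace.compProj_val, ← hα, ODE.FunSpace.next_apply₀],
    fun t ht => ⟨α.compProj_mem_closedBall h.mul_max_le, ?_⟩⟩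
  apply ODE.hasDerivWithinAt_picard_Icc t₀.2 h.continuousOn_uncurry
    α.continuous_compProj.continuousOn (fun _ ht' => α.compProj_mem_closedBall h.mul_max_le)
    p ht |>.congr_of_mem _ ht
  intro t' ht'
  nth_rw 1 [← hα]
  rw [ODE.FunSpace.compProj_of_mem ht', ODE.FunSpace.next_apply]

theorem norm_le_of_hasDerivAt_of_norm_le {Y : Type*} [NormedAddCommGroup Y] [NormedSpace ℝ Y]
    {h h' : ℝ → Y} {C : ℝ}
    (hh : ∀ t ∈ Icc (0 : ℝ) 1, HasDerivAt h (h' t) t) (hC : ∀ t ∈ Icc (0 : ℝ) 1, ‖h' t‖ ≤ C)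
    (h0 : h 0 = 0) : ∀ t ∈ Icc (0 : ℝ) 1, ‖h t‖ ≤ C := by
  intro t ht
  have hC0 : 0 ≤ C := (norm_nonneg _).trans (hC 0 (by simp))
  have := norm_image_sub_le_of_norm_deriv_le_segment' (f := h) (f' := h') (C := C) (a := 0) (b := 1)
    (fun x hx => (hh x hx).hasDerivWithinAt) (fun x hx => hC x (Ico_subset_Icc_self hx)) t ht
  rw [h0, sub_zero] at this
  refine this.trans ?_
  have := ht.2
  nlinarith

/-- The flow, up to time one, of a vector field near a zero where its derivative is small and
squares to zero. -/
theorem exists_flow_of_zero {V : X → X} {p₀ : X} {A : X →L[ℝ] X} (hV : HasStrictFDerivAt V A p₀)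
    (h0 : V p₀ = 0) (hA : ‖A‖ < 1 / 4) (hA2 : A ∘L A = 0) {W : Set X} (hW : W ∈ 𝓝 p₀) :
    ∃ α : X → ℝ → X,
      (∀ᶠ p in 𝓝 p₀, α p 0 = p ∧
        ∀ t ∈ Ioo (-1 : ℝ) 2, α p t ∈ W ∧ HasDerivAt (α p) (V (α p t)) t) ∧
      (∀ W' ∈ 𝓝 p₀, ∀ᶠ p in 𝓝 p₀, ∀ t ∈ Icc (0 : ℝ) 1, α p t ∈ W') ∧
      α p₀ 1 = p₀ ∧
      HasStrictFDerivAt (fun p => α p 1) (ContinuousLinearMap.id ℝ X + A) p₀ := by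
  obtain ⟨s, hs, hlip⟩ := hV.exists_lipschitzOnWith_of_nnnorm_lt (1 / 4 : ℝ≥0)
    (by rw [← NNReal.coe_lt_coe]; simpa using hA)
  obtain ⟨a', ha', hball⟩ := nhds_basis_closedBall.mem_iff.mp (Filter.inter_mem hs hW)
  lift a' to ℝ≥0 using ha'.le with a
  have ha : 0 < a := by exact_mod_cast ha'
  have hlip' : LipschitzOnWith (1 / 4) V (closedBall p₀ a) :=
    hlip.mono fun x hx => (hball hx).1
  have hbd : ∀ x ∈ closedBall p₀ a, ‖V x‖ ≤ (1 / 4 * a : ℝ≥0) := by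
    intro x hx
    have := hlip'.dist_le_mul x hx p₀ (mem_closedBall_self a.2)
    rw [h0, dist_zero_right] at this
    refine this.trans ?_
    push_cast
    gcongr
    exact hx
  -- At speed at most `a / 4`, a solution moves at most `a / 2` in time 2, which is the gap between
  -- the radii `a / 2` and `a`. The interval `[-1, 2]` contains `[0, 1]` in its interior, so
  -- derivatives on `[0, 1]` are two-sided.
  have hpl : IsPicardLindelof (fun _ => V) (tmin := -1) (tmax := 2) ⟨0, by simp⟩ p₀ a (a / 2)
      (1 / 4 * a) (1 / 4) := by
    refine IsPicardLindelof.of_time_independent hbd hlip' ?_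
    simp only [sub_zero, zero_sub, neg_neg]
    push_cast
    rw [max_eq_left (by norm_num)]
    linarith
  have hex : ∀ p : X, ∃ α : ℝ → X, p ∈ closedBall p₀ (a / 2 : ℝ≥0) → α 0 = p ∧
      ∀ t ∈ Icc (-1 : ℝ) 2, α t ∈ closedBall p₀ a ∧
        HasDerivWithinAt α (V (α t)) (Icc (-1 : ℝ) 2) t := by
    intro p
    by_cases hp : p ∈ closedBall p₀ (a / 2 : ℝ≥0)
    · obtain ⟨α, h1, h2⟩ := exists_solution_mem_closedBall hpl hp
      exact ⟨α, fun _ => ⟨h1, h2⟩⟩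
    · exact ⟨fun _ => 0, fun h => absurd h hp⟩
  choose α hα using hex
  have hnear : closedBall p₀ (a / 2 : ℝ≥0) ∈ 𝓝 p₀ :=
    closedBall_mem_nhds _ (by exact_mod_cast half_pos ha)
  have hder : ∀ p ∈ closedBall p₀ (a / 2 : ℝ≥0), ∀ t ∈ Ioo (-1 : ℝ) 2,
      HasDerivAt (α p) (V (α p t)) t := fun p hp t ht =>
    (((hα p hp).2 t (Ioo_subset_Icc_self ht)).2).hasDerivAt (Icc_mem_nhds ht.1 ht.2)
  have h01 : ∀ t ∈ Icc (0 : ℝ) 1, t ∈ Ioo (-1 : ℝ) 2 := fun t ht =>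
    ⟨by linarith [ht.1], by linarith [ht.2]⟩
  have hcont : ∀ p ∈ closedBall p₀ (a / 2 : ℝ≥0), ContinuousOn (α p) (Icc 0 1) := fun p hp t ht =>
    (hder p hp t (h01 t ht)).continuousAt.continuousWithinAt
  have hK : Real.exp (1 / 4) ≤ 3 :=
    (Real.exp_le_exp.2 (by norm_num : (1 / 4 : ℝ) ≤ 1)).trans Real.exp_one_lt_d9.le |>.trans
      (by norm_num)
  have hgr : ∀ p ∈ closedBall p₀ (a / 2 : ℝ≥0), ∀ q ∈ closedBall p₀ (a / 2 : ℝ≥0),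
      ∀ t ∈ Icc (0 : ℝ) 1, ‖α p t - α q t‖ ≤ 3 * ‖p - q‖ := by
    intro p hp q hq t ht
    have := dist_le_of_trajectories_ODE_of_mem (v := fun _ => V) (s := fun _ => closedBall p₀ a)
      (K := 1 / 4) (f := α p) (g := α q) (a := 0) (b := 1) (δ := dist p q)
      (fun _ _ => hlip') (hcont p hp)
      (fun t ht => (hder p hp t (h01 t (Ico_subset_Icc_self ht))).hasDerivWithinAt)
      (fun t ht => ((hα p hp).2 t (Ioo_subset_Icc_self (h01 t (Ico_subset_Icc_self ht)))).1)
      (hcont q hq)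
      (fun t ht => (hder q hq t (h01 t (Ico_subset_Icc_self ht))).hasDerivWithinAt)
      (fun t ht => ((hα q hq).2 t (Ioo_subset_Icc_self (h01 t (Ico_subset_Icc_self ht)))).1)
      (by rw [(hα p hp).1, (hα q hq).1]) t ht
    rw [dist_eq_norm, dist_eq_norm] at this
    refine this.trans ?_
    rw [mul_comm]
    gcongr
    refine le_trans (Real.exp_le_exp.2 ?_) hK
    have := ht.2
    push_cast
    linarith
  have hp₀ : p₀ ∈ closedBall p₀ (a / 2 : ℝ≥0) := mem_closedBall_self (a / 2).2
  have hfix : ∀ t ∈ Icc (0 : ℝ) 1, α p₀ t = p₀ := by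
    intro t ht
    have := dist_le_of_trajectories_ODE_of_mem (v := fun _ => V) (s := fun _ => closedBall p₀ a)
      (K := 1 / 4) (f := α p₀) (g := fun _ => p₀) (a := 0) (b := 1) (δ := 0)
      (fun _ _ => hlip') (hcont p₀ hp₀)
      (fun t ht => (hder p₀ hp₀ t (h01 t (Ico_subset_Icc_self ht))).hasDerivWithinAt)
      (fun t ht => ((hα p₀ hp₀).2 t (Ioo_subset_Icc_self (h01 t (Ico_subset_Icc_self ht)))).1)
      continuousOn_const
      (fun t ht => by simpa [h0] using hasDerivWithinAt_const t (Ici t) p₀)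
      (fun t ht => mem_closedBall_self a.2)
      (by rw [(hα p₀ hp₀).1, dist_self]) t ht
    simpa using this
  have hsmall : ∀ W' ∈ 𝓝 p₀, ∀ᶠ p in 𝓝 p₀, ∀ t ∈ Icc (0 : ℝ) 1, α p t ∈ W' := by
    intro W' hW'
    obtain ⟨ε, hε, hεW⟩ := nhds_basis_closedBall.mem_iff.mp hW'
    filter_upwards [hnear, closedBall_mem_nhds p₀ (ε := ε / 3) (by positivity)] with p hp hpε t ht
    apply hεW
    have := hgr p hp p₀ hp₀ t ht
    rw [hfix t ht] at this
    rw [mem_closedBall, dist_eq_norm] at hpε ⊢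
    linarith
  refine ⟨α, ?_, hsmall, hfix 1 (by simp), ?_⟩
  · filter_upwards [hnear] with p hp
    refine ⟨(hα p hp).1, fun t ht => ⟨(hball ((hα p hp).2 t (Ioo_subset_Icc_self ht)).1).2,
      hder p hp t ht⟩⟩
  -- For two solutions, the difference `w` satisfies `w' ≈ A w`. Since `A² = 0`, the derivative of
  -- `A w` is almost zero, so `A w` stays near `A (p - q)`, and integration gives `w 1 ≈ (p - q) + A
  -- (p - q)`. The choice of `η` makes the total error `(1 + ‖A‖) * 3η` equal to `ε / 2`.
  · rw [hasStrictFDerivAt_iff_isLittleO, Asymptotics.isLittleO_iff]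
    intro ε hε
    have hη : 0 < ε / (6 + 6 * ‖A‖) := by positivity
    obtain ⟨s', hs', happ⟩ := hV.approximates_deriv_on_nhds
      (c := ⟨ε / (6 + 6 * ‖A‖), hη.le⟩) (Or.inr hη)
    have hev : ∀ᶠ p in 𝓝 p₀, p ∈ closedBall p₀ (a / 2 : ℝ≥0) ∧
        ∀ t ∈ Icc (0 : ℝ) 1, α p t ∈ s' := (Filter.Eventually.and hnear (hsmall s' hs'))
    rw [nhds_prod_eq]
    filter_upwards [hev.prod_mk hev] with ⟨p, q⟩ ⟨⟨hp, hps⟩, ⟨hq, hqs⟩⟩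
    set η := ε / (6 + 6 * ‖A‖)
    simp only at hp hps hq hqs ⊢
    have he : ∀ t ∈ Icc (0 : ℝ) 1,
        ‖V (α p t) - V (α q t) - A (α p t - α q t)‖ ≤ 3 * η * ‖p - q‖ := by
      intro t ht
      refine (happ _ (hps t ht) _ (hqs t ht)).trans ?_
      calc η * ‖α p t - α q t‖ ≤ η * (3 * ‖p - q‖) :=
            mul_le_mul_of_nonneg_left (hgr p hp q hq t ht) hη.le
        _ = _ := by ring
    have hd : ∀ t ∈ Icc (0 : ℝ) 1,
        HasDerivAt (fun t => α p t - α q t) (V (α p t) - V (α q t)) t := fun t ht =>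
      (hder p hp t (h01 t ht)).sub (hder q hq t (h01 t ht))
    have hAd : ∀ t ∈ Icc (0 : ℝ) 1,
        ‖A (α p t - α q t) - A (p - q)‖ ≤ ‖A‖ * (3 * η * ‖p - q‖) := by
      refine norm_le_of_hasDerivAt_of_norm_le
        (h' := fun t => A (V (α p t) - V (α q t) - A (α p t - α q t))) ?_ ?_ ?_
      · intro t ht
        have h1 : A (A (α p t - α q t)) = 0 := DFunLike.congr_fun hA2 _
        rw [map_sub A (V (α p t) - V (α q t)), h1, sub_zero]
        exact (A.hasFDerivAt.comp_hasDerivAt t (hd t ht)).sub_const _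
      · exact fun t ht => (A.le_opNorm _).trans (by gcongr; exact he t ht)
      · rw [(hα p hp).1, (hα q hq).1, sub_self]
    have hfin := norm_le_of_hasDerivAt_of_norm_le
      (h := fun t => α p t - α q t - (p - q) - t • A (p - q))
      (h' := fun t => V (α p t) - V (α q t) - A (p - q))
      (C := (1 + ‖A‖) * (3 * η * ‖p - q‖)) ?_ ?_ ?_ 1 (by simp)
    · simp only [one_smul] at hfin
      simp only [add_apply, ContinuousLinearMap.id_apply]
      rw [← sub_sub]
      refine hfin.trans ?_
      have : (1 + ‖A‖) * (3 * η * ‖p - q‖) = ε / 2 * ‖p - q‖ := by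
        simp only [η]
        field_simp
        ring
      rw [this]
      gcongr
      linarith
    · intro t ht
      exact (((hd t ht).sub_const (p - q)).sub
        ((hasDerivAt_id t).smul_const (A (p - q)))).congr_deriv (by simp)
    · intro t ht
      calc ‖V (α p t) - V (α q t) - A (p - q)‖
          = ‖(V (α p t) - V (α q t) - A (α p t - α q t)) +
              (A (α p t - α q t) - A (p - q))‖ := by congr 1; abel
        _ ≤ 3 * η * ‖p - q‖ + ‖A‖ * (3 * η * ‖p - q‖) :=
          (norm_add_le _ _).trans (add_le_add (he t ht) (hAd t ht))
        _ = _ := by ring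
    · simp [(hα p hp).1, (hα q hq).1]

end Flow

/-! ### From a contracted norm to local contractivity and stability -/

section Contraction

variable {X : Type*} [NormedAddCommGroup X] [NormedSpace ℝ X]

theorem seminorm_pow_apply_le {J : X →L[ℝ] X} {N : Seminorm ℝ X} {ρ : ℝ} (hρ : 0 ≤ ρ)
    (hJ : ∀ v, N (J v) ≤ ρ * N v) (n : ℕ) (v : X) : N ((J ^ n) v) ≤ ρ ^ n * N v := by
  induction n with
  | zero => simp
  | succ n ih =>
    rw [pow_succ', mul_apply_eq_comp, pow_succ', mul_assoc]
    exact (hJ _).trans (mul_le_mul_of_nonneg_left ih hρ)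

/-- The complex eigenvalues of a strict contraction lie in the open unit disk. -/
theorem norm_lt_one_of_mem_aroots_charpoly [FiniteDimensional ℝ X] {J : X →L[ℝ] X}
    {N : Seminorm ℝ X} {a ρ : ℝ} (ha : 0 < a) (haN : ∀ v, a * ‖v‖ ≤ N v) (hρ : 0 ≤ ρ)
    (hρ1 : ρ < 1) (hJ : ∀ v, N (J v) ≤ ρ * N v) :
    ∀ z ∈ J.toLinearMap.charpoly.aroots ℂ, ‖z‖ < 1 := by
  intro z hz
  set bs := Module.finBasis ℝ X
  set M := LinearMap.toMatrix bs bs J.toLinearMap with hM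
  set Mc : Matrix _ _ ℂ := M.map (algebraMap ℝ ℂ) with hMc
  have hroot : Mc.charpoly.eval z = 0 := by
    have h1 := (Polynomial.mem_aroots.1 hz).2
    rw [← LinearMap.charpoly_toMatrix J.toLinearMap bs] at h1
    rw [hMc, Matrix.charpoly_map, Polynomial.eval_map_algebraMap]
    exact h1
  obtain ⟨w, hw0, hw⟩ : ∃ w, w ≠ 0 ∧ Mc.mulVec w = z • w := by
    rw [Matrix.eval_charpoly] at hroot
    obtain ⟨w, hw0, hw⟩ := Matrix.exists_mulVec_eq_zero_iff.2 hroot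
    refine ⟨w, hw0, ?_⟩
    rw [Matrix.sub_mulVec, sub_eq_zero] at hw
    rw [← hw]
    simp [Matrix.scalar_apply, ← Matrix.smul_one_eq_diagonal, Matrix.smul_mulVec]
  -- For an eigenvector `w`, the power `J ^ n` sends the real part of `w` to the real part of `z ^ n
  -- • w`, so the latter tends to zero. The eigenvector `-i w` gives the same for the imaginary
  -- part. If `‖z‖ ≥ 1`, the entries of `z ^ n • w` are at least as large as those of `w`, forcing
  -- `w = 0`.
  let re : (Fin (Module.finrank ℝ X) → ℂ) → X := fun w => ∑ i, (w i).re • bs i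
  have hre : ∀ w, J (re w) = re (Mc.mulVec w) := by
    intro w
    apply bs.repr.injective
    ext i
    have h1 : bs.repr (J (re w)) i = M.mulVec (bs.repr (re w)) i := by
      rw [hM, LinearMap.toMatrix_mulVec_repr]; rfl
    have h2 : ∀ w j, bs.repr (re w) j = (w j).re := by
      intro w j
      simp [re, Finsupp.single_apply]
    rw [h1, h2]
    simp only [Matrix.mulVec, dotProduct, h2, Complex.re_sum]
    simp [hMc]
  have hpow : ∀ w, Mc.mulVec w = z • w → ∀ n : ℕ, (J ^ n) (re w) = re (z ^ n • w) := by
    intro w hw n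
    induction n with
    | zero => simp
    | succ n ih =>
      rw [pow_succ', mul_apply_eq_comp, ih, hre, Matrix.mulVec_smul, hw, smul_smul,
        ← pow_succ]
  have hlim : ∀ w, Mc.mulVec w = z • w → ∀ i,
      Filter.Tendsto (fun n : ℕ => (z ^ n * w i).re) Filter.atTop (𝓝 0) := by
    intro w hw i
    let φ : X →L[ℝ] ℝ := LinearMap.toContinuousLinearMap (bs.coord i)
    have h2 : ∀ n : ℕ, (z ^ n * w i).re = φ ((J ^ n) (re w)) := by
      intro n
      rw [hpow w hw]
      simp [φ, re, Finsupp.single_apply]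
    refine squeeze_zero_norm (a := fun n => ‖φ‖ * (a⁻¹ * (ρ ^ n * N (re w)))) (fun n => ?_) ?_
    · rw [h2]
      refine (φ.le_opNorm _).trans ?_
      gcongr
      rw [le_inv_mul_iff₀ ha]
      exact (haN _).trans (seminorm_pow_apply_le hρ hJ n _)
    · have := (tendsto_pow_atTop_nhds_zero_of_lt_one hρ hρ1).mul_const (N (re w))
      simpa using (this.const_mul a⁻¹).const_mul ‖φ‖
  by_contra! hz1
  apply hw0
  ext i
  have hw' : Mc.mulVec ((-Complex.I) • w) = z • ((-Complex.I) • w) := by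
    rw [Matrix.mulVec_smul, hw, smul_comm]
  have h1 := ((hlim w hw i).abs).add ((hlim _ hw' i).abs)
  have h2 : ∀ n : ℕ, ‖w i‖ ≤ |(z ^ n * w i).re| + |(z ^ n * ((-Complex.I) • w) i).re| := by
    intro n
    have : (z ^ n * ((-Complex.I) • w) i).re = (z ^ n * w i).im := by
      simp [Complex.mul_re, Complex.mul_im]
      ring
    rw [this]
    refine le_trans ?_ (Complex.norm_le_abs_re_add_abs_im _)
    rw [norm_mul, norm_pow]
    exact le_mul_of_one_le_left (norm_nonneg _) (one_le_pow₀ hz1)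
  have := ge_of_tendsto' h1 h2
  simpa using this

/-- A strict derivative that contracts some norm makes a fixed point locally contractive and
linearly stable. -/
theorem contractive_and_stable_of_strict [FiniteDimensional ℝ X] {S : Set X} {Φ Ψ : X → X} {p : X}
    {J : X →L[ℝ] X} {N : Seminorm ℝ X} {a b ρ : ℝ} (hp : p ∈ S) (hΦp : Φ p = p)
    (hΨ : HasStrictFDerivAt Ψ J p) (heq : ∀ᶠ q in 𝓝[S] p, Φ q = Ψ q)
    (hmaps : ∀ᶠ q in 𝓝[S] p, Φ q ∈ S)
    (ha : 0 < a) (hN : ∀ v, a * ‖v‖ ≤ N v ∧ N v ≤ b * ‖v‖) (hρ : 0 ≤ ρ) (hρ1 : ρ < 1)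
    (hJ : ∀ v, N (J v) ≤ ρ * N v) :
    IsLocallyContractiveAt S Φ p ∧ IsLinearlyStableAt S Φ p := by
  have hbpos : 0 < max b 1 := lt_max_of_lt_right one_pos
  have hNb : ∀ v, N v ≤ max b 1 * ‖v‖ := fun v =>
    (hN v).2.trans (mul_le_mul_of_nonneg_right (le_max_left _ _) (norm_nonneg _))
  set b' := max b 1
  obtain ⟨σ, hρσ, hσ1⟩ := exists_between hρ1
  have hσ : 0 ≤ σ := hρ.trans hρσ.le
  -- the contraction estimate near `p`
  have hη : 0 < (σ - ρ) * a / b' := by have := sub_pos.2 hρσ; positivity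
  -- With this constant the linearization error, measured in `N`, is at most `(σ - ρ) * N (q - q')`,
  -- which raises the rate from `ρ` to `σ`.
  obtain ⟨s, hs, happ⟩ := hΨ.approximates_deriv_on_nhds (c := ⟨(σ - ρ) * a / b', hη.le⟩)
    (Or.inr hη)
  have hcontr : ∀ q ∈ s, ∀ q' ∈ s, N (Ψ q - Ψ q') ≤ σ * N (q - q') := by
    intro q hq q' hq'
    have h1 := happ _ hq _ hq'
    calc N (Ψ q - Ψ q') = N ((Ψ q - Ψ q' - J (q - q')) + J (q - q')) := by congr 1; abel
      _ ≤ N (Ψ q - Ψ q' - J (q - q')) + N (J (q - q')) := map_add_le_add _ _ _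
      _ ≤ b' * ((σ - ρ) * a / b' * ‖q - q'‖) + ρ * N (q - q') :=
        add_le_add ((hNb _).trans (mul_le_mul_of_nonneg_left h1 hbpos.le)) (hJ _)
      _ = (σ - ρ) * (a * ‖q - q'‖) + ρ * N (q - q') := by field_simp
      _ ≤ (σ - ρ) * N (q - q') + ρ * N (q - q') := by
        have := (hN (q - q')).1
        have h3 := sub_pos.2 hρσ
        gcongr
      _ = _ := by ring
  obtain ⟨r, hr, hball⟩ := Metric.mem_nhdsWithin_iff.1
    (Filter.inter_mem (Filter.inter_mem (mem_nhdsWithin_of_mem_nhds hs) heq) hmaps)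
  -- A ball for `N` rather than for the given norm, so that the contraction makes it invariant; the
  -- radius `a * r` places it inside the ball of radius `r`.
  set U : Set X := {q | q ∈ S ∧ N (q - p) < a * r}
  have hUball : ∀ q ∈ U, (q ∈ s ∧ Φ q = Ψ q) ∧ Φ q ∈ S := by
    intro q hq
    refine hball ⟨?_, hq.1⟩
    rw [mem_ball_iff_norm]
    have := (hN (q - p)).1.trans_lt hq.2
    exact lt_of_mul_lt_mul_left this ha.le
  have hps : p ∈ s := mem_of_mem_nhds hs
  have hpU : p ∈ U := ⟨hp, by simpa using mul_pos ha hr⟩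
  have hUc : ∀ q ∈ U, ∀ q' ∈ U, N (Φ q - Φ q') ≤ σ * N (q - q') := by
    intro q hq q' hq'
    rw [(hUball q hq).1.2, (hUball q' hq').1.2]
    exact hcontr q (hUball q hq).1.1 q' (hUball q' hq').1.1
  have hUmaps : Set.MapsTo Φ U U := by
    intro q hq
    refine ⟨(hUball q hq).2, lt_of_le_of_lt ?_ hq.2⟩
    have := hUc q hq p hpU
    rw [hΦp] at this
    exact this.trans (mul_le_of_le_one_left (apply_nonneg _ _) hσ1.le)
  have hUn : U ∈ 𝓝[S] p := by
    rw [Metric.mem_nhdsWithin_iff]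
    refine ⟨a * r / b', by positivity, fun q hq => ⟨hq.2, ?_⟩⟩
    have h1 : ‖q - p‖ < a * r / b' := mem_ball_iff_norm.1 hq.1
    rw [lt_div_iff₀' hbpos] at h1
    exact (hNb _).trans_lt h1
  refine ⟨⟨hp, hΦp, ⟨J, ?_, norm_lt_one_of_mem_aroots_charpoly ha (fun v => (hN v).1) hρ hρ1 hJ⟩,
    N, a, b, σ, U, ha, hN, hσ, hσ1, hUn, fun q hq => hq.1, hUmaps, hUc⟩, b' / a, σ, hσ, hσ1, ?_⟩
  · refine hΨ.hasFDerivAt.hasFDerivWithinAt.congr_of_eventuallyEq heq ?_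
    exact (hUball p hpU).1.2
  · filter_upwards [hUn] with q hq n
    have h1 : ∀ n : ℕ, Φ^[n] q ∈ U ∧ N (Φ^[n] q - p) ≤ σ ^ n * N (q - p) := by
      intro n
      induction n with
      | zero => simpa using hq
      | succ n ih =>
        rw [Function.iterate_succ_apply']
        refine ⟨hUmaps ih.1, ?_⟩
        have := hUc _ ih.1 p hpU
        rw [hΦp] at this
        refine this.trans ?_
        rw [pow_succ', mul_assoc]
        exact mul_le_mul_of_nonneg_left ih.2 hσ
    refine ⟨(h1 n).1.1, ?_⟩
    have h2 := (hN (Φ^[n] q - p)).1.trans ((h1 n).2.trans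
      (mul_le_mul_of_nonneg_left (hNb (q - p)) (pow_nonneg hσ n)))
    rw [← le_div_iff₀' ha] at h2
    refine h2.trans (le_of_eq ?_)
    ring

end Contraction

/-! ### Operators diagonal in an orthonormal basis of a subspace -/

section DiagOp

open scoped InnerProductSpace

variable {E ι : Type*} [NormedAddCommGroup E] [InnerProductSpace ℝ E] [Fintype ι]
  {T : Submodule ℝ E}

/-- The operator that is diagonal with entries `φ` in the orthonormal basis `b` of a subspace and
vanishes on the orthogonal complement. -/
noncomputable def diagOp (b : OrthonormalBasis ι ℝ T) (φ : ι → ℝ) : E →L[ℝ] E :=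
  ∑ i, φ i • (innerSL ℝ (b i : E)).smulRight (b i : E)

variable (b : OrthonormalBasis ι ℝ T)

theorem orthonormal_coe_basis : Orthonormal ℝ (fun i => (b i : E)) :=
  b.orthonormal.comp_linearIsometry T.subtypeₗᵢ

theorem diagOp_apply (φ : ι → ℝ) (u : E) :
    diagOp b φ u = ∑ i, (φ i * ⟪(b i : E), u⟫_ℝ) • (b i : E) := by
  simp [diagOp, smul_smul]

theorem inner_diagOp (φ : ι → ℝ) (u : E) (i : ι) :
    ⟪(b i : E), diagOp b φ u⟫_ℝ = φ i * ⟪(b i : E), u⟫_ℝ := by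
  classical
  rw [diagOp_apply, inner_sum]
  simp [inner_smul_right, orthonormal_iff_ite.1 (orthonormal_coe_basis b)]

theorem diagOp_apply_basis (φ : ι → ℝ) (i : ι) : diagOp b φ (b i : E) = φ i • (b i : E) := by
  classical
  rw [diagOp_apply]
  simp [orthonormal_iff_ite.1 (orthonormal_coe_basis b)]

theorem diagOp_comp (φ ψ : ι → ℝ) : diagOp b φ ∘L diagOp b ψ = diagOp b (φ * ψ) := by
  ext u
  simp only [ContinuousLinearMap.comp_apply, diagOp_apply b φ, inner_diagOp, diagOp_apply b (φ * ψ),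
    Pi.mul_apply, mul_assoc]

theorem diagOp_smul (r : ℝ) (φ : ι → ℝ) : diagOp b (r • φ) = r • diagOp b φ := by
  simp [diagOp, Finset.smul_sum, smul_smul]

theorem diagOp_sub (φ ψ : ι → ℝ) : diagOp b (φ - ψ) = diagOp b φ - diagOp b ψ := by
  simp [diagOp, sub_smul, Finset.sum_sub_distrib]

theorem diagOp_mem (φ : ι → ℝ) (u : E) : diagOp b φ u ∈ T := by
  rw [diagOp_apply]
  exact T.sum_mem fun i _ => T.smul_mem _ (b i).2

theorem inner_diagOp_left (φ : ι → ℝ) (u w : E) :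
    ⟪diagOp b φ u, w⟫_ℝ = ⟪u, diagOp b φ w⟫_ℝ := by
  simp only [diagOp_apply, sum_inner, inner_sum, inner_smul_left, inner_smul_right]
  refine Finset.sum_congr rfl fun i _ => ?_
  rw [real_inner_comm u]
  simp
  ring

theorem diagOp_one_of_mem {u : E} (hu : u ∈ T) : diagOp b 1 u = u := by
  rw [diagOp_apply]
  have := congrArg (Subtype.val) (b.sum_repr ⟨u, hu⟩)
  simpa [b.repr_apply_apply] using this

/-- Bessel's inequality: the basis is orthonormal in `E` but need not span it. -/
theorem norm_diagOp_le {φ : ι → ℝ} {C : ℝ} (hC : 0 ≤ C) (hφ : ∀ i, |φ i| ≤ C) :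
    ‖diagOp b φ‖ ≤ C := by
  refine ContinuousLinearMap.opNorm_le_bound _ hC fun u => ?_
  refine le_of_sq_le_sq ?_ (by positivity)
  have hb := (orthonormal_coe_basis b).sum_inner_products_le (x := u) (s := Finset.univ)
  have h1 : ‖diagOp b φ u‖ ^ 2 = ∑ i, (φ i * ⟪(b i : E), u⟫_ℝ) ^ 2 := by
    rw [← real_inner_self_eq_norm_sq, diagOp_apply, (orthonormal_coe_basis b).inner_sum]
    simp [sq]
  rw [h1, mul_pow]
  calc ∑ i, (φ i * ⟪(b i : E), u⟫_ℝ) ^ 2 ≤ ∑ i, C ^ 2 * ‖⟪(b i : E), u⟫_ℝ‖ ^ 2 := by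
        refine Finset.sum_le_sum fun i _ => ?_
        rw [mul_pow, Real.norm_eq_abs, sq_abs]
        gcongr ?_ * _
        exact sq_le_sq' (neg_le_of_abs_le (hφ i)) (le_of_abs_le (hφ i))
    _ ≤ C ^ 2 * ‖u‖ ^ 2 := by
        rw [← Finset.mul_sum]
        gcongr

theorem eq_diagOp {B : E →L[ℝ] E} {φ : ι → ℝ} (hB : B ∘L diagOp b 1 = B)
    (hb : ∀ i, B (b i : E) = φ i • (b i : E)) : B = diagOp b φ := by
  ext u
  rw [← hB, ContinuousLinearMap.comp_apply, diagOp_apply, map_sum, diagOp_apply]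
  refine Finset.sum_congr rfl fun i _ => ?_
  rw [map_smul, hb, smul_smul]
  simp [mul_comm]

theorem trace_diagOp [FiniteDimensional ℝ E] (φ : ι → ℝ) :
    LinearMap.trace ℝ E (diagOp b φ).toLinearMap = ∑ i, φ i := by
  have h : (diagOp b φ).toLinearMap
      = ∑ i, φ i • ((innerSL ℝ (b i : E)).toLinearMap.smulRight (b i : E)) := by
    ext u
    simp [diagOp_apply, smul_smul]
  rw [h, map_sum]
  refine Finset.sum_congr rfl fun i _ => ?_
  rw [map_smul, LinearMap.trace_smulRight]
  have : ‖(b i : E)‖ = 1 := (orthonormal_coe_basis b).1 i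
  simp [this]

end DiagOp

/-! ### The tangent projector and its smoothness -/

section TangentProj

open scoped InnerProductSpace

variable {d m : ℕ} {c : EuclideanSpace ℝ (Fin d) → EuclideanSpace ℝ (Fin m)}
  {x : EuclideanSpace ℝ (Fin d)}

/-- `A(x)ᵀ A(x)` is invertible. -/
def IsRegularAt (c : EuclideanSpace ℝ (Fin d) → EuclideanSpace ℝ (Fin m))
    (x : EuclideanSpace ℝ (Fin d)) : Prop :=
  (ContinuousLinearMap.adjoint (constraintGrad c x) ∘L constraintGrad c x).IsInvertible

theorem SatisfiesLICQ.isRegularAt (h : SatisfiesLICQ c) (hx : x ∈ feasibleSet c) :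
    IsRegularAt c x := by
  set A := constraintGrad c x
  have hinj : Function.Injective (ContinuousLinearMap.adjoint A ∘L A) := by
    rw [injective_iff_map_eq_zero]
    intro u hu
    have h1 : ⟪A u, A u⟫_ℝ = 0 := by
      rw [← ContinuousLinearMap.adjoint_inner_left]
      have : ContinuousLinearMap.adjoint A (A u) = 0 := hu
      rw [this, inner_zero_left]
    rw [inner_self_eq_zero] at h1
    exact (injective_iff_map_eq_zero A).1 (h x hx) u h1
  exact ⟨(LinearEquiv.ofInjectiveEndo _ hinj).toContinuousLinearEquiv, by ext; rfl⟩

theorem mem_tangentSpace_iff {v : EuclideanSpace ℝ (Fin d)} :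
    v ∈ tangentSpace c x ↔ fderiv ℝ c x v = 0 := by
  simp [tangentSpace, constraintGrad]

theorem tangentProj_of_mem {v : EuclideanSpace ℝ (Fin d)} (hv : v ∈ tangentSpace c x) :
    tangentProj c x v = v := by
  have : ContinuousLinearMap.adjoint (constraintGrad c x) v = 0 := hv
  simp [tangentProj, this]

theorem IsRegularAt.tangentProj_mem (h : IsRegularAt c x) (v : EuclideanSpace ℝ (Fin d)) :
    tangentProj c x v ∈ tangentSpace c x := by
  change ContinuousLinearMap.adjoint (constraintGrad c x) (tangentProj c x v) = 0
  set A := constraintGrad c x with hA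
  have h1 := DFunLike.congr_fun (ContinuousLinearMap.IsInvertible.self_comp_inverse h)
    (ContinuousLinearMap.adjoint A v)
  simp only [← hA, ContinuousLinearMap.comp_apply, ContinuousLinearMap.id_apply] at h1
  simp only [tangentProj, ← hA, sub_apply, ContinuousLinearMap.id_apply,
    ContinuousLinearMap.comp_apply, map_sub, h1, sub_self]

theorem IsRegularAt.tangentProj_idem (h : IsRegularAt c x) (v : EuclideanSpace ℝ (Fin d)) :
    tangentProj c x (tangentProj c x v) = tangentProj c x v :=
  tangentProj_of_mem (h.tangentProj_mem v)

theorem inner_sub_tangentProj {v : EuclideanSpace ℝ (Fin d)} (u : EuclideanSpace ℝ (Fin d))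
    (hv : v ∈ tangentSpace c x) : ⟪u - tangentProj c x u, v⟫_ℝ = 0 := by
  have h : ContinuousLinearMap.adjoint (constraintGrad c x) v = 0 := hv
  simp only [tangentProj, sub_apply, ContinuousLinearMap.id_apply,
    ContinuousLinearMap.comp_apply, sub_sub_cancel]
  rw [← ContinuousLinearMap.adjoint_inner_right, h, inner_zero_right]

theorem IsRegularAt.inner_tangentProj_left (h : IsRegularAt c x) (u v : EuclideanSpace ℝ (Fin d)) :
    ⟪tangentProj c x u, v⟫_ℝ = ⟪u, tangentProj c x v⟫_ℝ := by
  have h1 := inner_sub_tangentProj u (h.tangentProj_mem v)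
  have h2 := inner_sub_tangentProj v (h.tangentProj_mem u)
  rw [inner_sub_left] at h1 h2
  rw [real_inner_comm, real_inner_comm (tangentProj c x u) (tangentProj c x v)] at h2
  linarith

theorem IsRegularAt.tangentProj_eq_diagOp {ι : Type*} [Fintype ι] (h : IsRegularAt c x)
    (b : OrthonormalBasis ι ℝ (tangentSpace c x)) : tangentProj c x = diagOp b 1 := by
  refine eq_diagOp b ?_ fun i => by simpa using tangentProj_of_mem (b i).2
  ext1 u
  rw [ContinuousLinearMap.comp_apply, tangentProj_of_mem (diagOp_mem b _ _)]
  refine ext_inner_right ℝ fun w => ?_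
  rw [h.inner_tangentProj_left, inner_diagOp_left]
  conv_rhs => rw [← diagOp_one_of_mem b (h.tangentProj_mem w), ← inner_diagOp_left]
  rw [← inner_diagOp_left, ← h.inner_tangentProj_left, tangentProj_of_mem (diagOp_mem b _ _)]

/-- Rank and nullity of `Aᵀ`, which is onto because `AᵀA` is. This justifies indexing eigenbases by
`Fin (d - m)`. -/
theorem IsRegularAt.finrank_tangentSpace (h : IsRegularAt c x) :
    Module.finrank ℝ (tangentSpace c x) = d - m := by
  have h1 := LinearMap.finrank_range_add_finrank_ker
    (ContinuousLinearMap.adjoint (constraintGrad c x)).toLinearMap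
  have hsurj : LinearMap.range
      (ContinuousLinearMap.adjoint (constraintGrad c x)).toLinearMap = ⊤ := by
    rw [LinearMap.range_eq_top]
    exact Function.Surjective.of_comp (g := constraintGrad c x)
      (ContinuousLinearMap.IsInvertible.surjective h)
  rw [hsurj, finrank_top, finrank_euclideanSpace_fin, finrank_euclideanSpace_fin] at h1
  change m + Module.finrank ℝ (tangentSpace c x) = d at h1
  omega

theorem contDiff_constraintGrad (hc : ContDiff ℝ ∞ c) : ContDiff ℝ ∞ (constraintGrad c) :=
  (ContinuousLinearMap.adjoint (𝕜 := ℝ) (E := EuclideanSpace ℝ (Fin d))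
    (F := EuclideanSpace ℝ (Fin m))).contDiff.comp (hc.fderiv_right (by simp))

theorem contDiff_adjoint_constraintGrad (hc : ContDiff ℝ ∞ c) :
    ContDiff ℝ ∞ fun x => ContinuousLinearMap.adjoint (constraintGrad c x) :=
  (ContinuousLinearMap.adjoint (𝕜 := ℝ) (E := EuclideanSpace ℝ (Fin m))
    (F := EuclideanSpace ℝ (Fin d))).contDiff.comp (contDiff_constraintGrad hc)

theorem IsRegularAt.contDiffAt_tangentProj (h : IsRegularAt c x) (hc : ContDiff ℝ ∞ c) :
    ContDiffAt ℝ ∞ (tangentProj c) x := by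
  have hA := (contDiff_constraintGrad hc).contDiffAt (x := x)
  have hA' := (contDiff_adjoint_constraintGrad hc).contDiffAt (x := x)
  refine contDiffAt_const.sub (hA.clm_comp (ContDiffAt.clm_comp ?_ hA'))
  exact (ContinuousLinearMap.IsInvertible.contDiffAt_map_inverse h).comp x (hA'.clm_comp hA)

theorem IsRegularAt.eventually (h : IsRegularAt c x) (hc : ContDiff ℝ ∞ c) :
    ∀ᶠ y in 𝓝 x, IsRegularAt c y := by
  obtain ⟨e, he⟩ := h
  have hA := (contDiff_constraintGrad hc).continuous
  have hA' := (contDiff_adjoint_constraintGrad hc).continuous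
  have := (hA'.clm_comp hA).continuousAt (x := x)
  refine this.eventually (?_ : _ ∈ 𝓝 _)
  have h1 := ContinuousLinearEquiv.nhds e
  rw [he] at h1
  exact h1

end TangentProj

/-! ### Curves and linear equations on the unit interval -/

section Curves

open Set

variable {F : Type*} [NormedAddCommGroup F] [NormedSpace ℝ F]

theorem deriv_unique_of_eqOn_Icc {f g : ℝ → F} {f' g' : F} {t : ℝ} (h : EqOn f g (Icc 0 1))
    (ht : t ∈ Icc (0 : ℝ) 1) (hf : HasDerivAt f f' t) (hg : HasDerivAt g g' t) : f' = g' :=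
  (uniqueDiffOn_Icc one_pos t ht).eq_deriv _ hf.hasDerivWithinAt
    (hg.hasDerivWithinAt.congr h (h ht))

theorem constant_of_hasDerivAt_zero_Icc {f : ℝ → F}
    (h : ∀ t ∈ Icc (0 : ℝ) 1, HasDerivAt f 0 t) : ∀ t ∈ Icc (0 : ℝ) 1, f t = f 0 :=
  constant_of_has_deriv_right_zero (fun t ht => (h t ht).continuousAt.continuousWithinAt)
    fun t ht => (h t (Ico_subset_Icc_self ht)).hasDerivWithinAt

/-- A solution of a homogeneous linear equation that starts at zero vanishes. -/
theorem eq_zero_of_linear_ode {B : ℝ → F →L[ℝ] F} {w : ℝ → F} (hB : ContinuousOn B (Icc 0 1))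
    (hw : ∀ t ∈ Icc (0 : ℝ) 1, HasDerivAt w (B t (w t)) t) (h0 : w 0 = 0) :
    ∀ t ∈ Icc (0 : ℝ) 1, w t = 0 := by
  obtain ⟨K, hK⟩ := isCompact_Icc.exists_bound_of_continuousOn hB
  refine eq_zero_of_abs_deriv_le_mul_abs_self_of_eq_zero_right (K := K)
    (fun t ht => (hw t ht).continuousAt.continuousWithinAt)
    (fun t ht => (hw t (Ico_subset_Icc_self ht)).hasDerivWithinAt) h0 fun t ht => ?_
  exact ((B t).le_opNorm _).trans (by gcongr; exact hK t (Ico_subset_Icc_self ht))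

theorem eq_of_linear_ode {B : ℝ → F →L[ℝ] F} {w z : ℝ → F} (hB : ContinuousOn B (Icc 0 1))
    (hw : ∀ t ∈ Icc (0 : ℝ) 1, HasDerivAt w (B t (w t)) t)
    (hz : ∀ t ∈ Icc (0 : ℝ) 1, HasDerivAt z (B t (z t)) t) (h0 : w 0 = z 0) :
    ∀ t ∈ Icc (0 : ℝ) 1, w t = z t := fun t ht =>
  sub_eq_zero.1 (eq_zero_of_linear_ode (w := fun t => w t - z t) hB
    (fun t ht => by rw [map_sub]; exact (hw t ht).sub (hz t ht)) (sub_eq_zero.2 h0) t ht)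

/-- Bootstrapping: if `α` is `Cⁿ`, then so is `α' = V ∘ α`, and `α` is one order better. -/
theorem contDiffOn_of_hasDerivAt_field {V : F → F} {α : ℝ → F} {s : Set ℝ} (hs : IsOpen s)
    (hα : ∀ t ∈ s, HasDerivAt α (V (α t)) t) (hV : ∀ t ∈ s, ContDiffAt ℝ ∞ V (α t)) (n : ℕ) :
    ContDiffOn ℝ n α s := by
  induction n with
  | zero =>
    rw [Nat.cast_zero, contDiffOn_zero]
    exact fun t ht => (hα t ht).continuousAt.continuousWithinAt
  | succ n ih =>
    rw [Nat.cast_succ, contDiffOn_succ_iff_deriv_of_isOpen hs]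
    refine ⟨fun t ht => (hα t ht).differentiableAt.differentiableWithinAt, by simp, ?_⟩
    refine ContDiffOn.congr (f := fun t => V (α t)) (fun t ht => ?_) fun t ht => (hα t ht).deriv
    exact ((hV t ht).of_le (by exact_mod_cast le_top)).comp_contDiffWithinAt t (ih t ht)

/-- A curve that is smooth around `[0, 1]` agrees near `[0, 1]` with a smooth curve on `ℝ`. -/
theorem exists_contDiff_extension {n : ℕ} {α : ℝ → F} (hα : ContDiffOn ℝ n α (Ioo (-1) 2)) :
    ∃ β : ℝ → F, ContDiff ℝ n β ∧ ∀ t ∈ Icc (0 : ℝ) 1, β =ᶠ[𝓝 t] α := by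
  -- The cutoff is 1 on the ball of radius 3/4 about 1/2, which contains `[0, 1]`, and its support
  -- `[-1/2, 3/2]` lies inside `(-1, 2)`.
  let χ : ContDiffBump (1 / 2 : ℝ) := ⟨3 / 4, 1, by norm_num, by norm_num⟩
  refine ⟨fun t => χ t • α t, contDiff_iff_contDiffAt.2 fun t => ?_, fun t ht => ?_⟩
  · by_cases ht : t ∈ Ioo (-1 : ℝ) 2
    · exact χ.contDiff.contDiffAt.smul (hα.contDiffAt (isOpen_Ioo.mem_nhds ht))
    · have : (fun t => χ t • α t) =ᶠ[𝓝 t] fun _ => 0 := by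
        have h1 : (tsupport χ)ᶜ ∈ 𝓝 t := by
          refine (isClosed_tsupport _).isOpen_compl.mem_nhds fun h => ht ?_
          rw [χ.tsupport_eq, Metric.mem_closedBall, Real.dist_eq, abs_le] at h
          have h2 := h.1
          have h3 := h.2
          simp only [χ] at h2 h3
          exact ⟨by linarith, by linarith⟩
        filter_upwards [h1] with s hs
        rw [image_eq_zero_of_notMem_tsupport hs, zero_smul]
      exact contDiffAt_const.congr_of_eventuallyEq this
  · have h1 : (χ : ℝ → ℝ) =ᶠ[𝓝 t] 1 := by
      refine χ.eventuallyEq_one_of_mem_ball ?_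
      rw [Metric.mem_ball, Real.dist_eq, abs_lt]
      simp only [χ]
      exact ⟨by linarith [ht.1], by linarith [ht.2]⟩
    filter_upwards [h1] with s hs
    rw [hs, Pi.one_apply, one_smul]

end Curves

/-! ### Geodesics and parallel fields as ambient differential equations -/

section Transport

open Set
open scoped InnerProductSpace

variable {d m : ℕ} {c : EuclideanSpace ℝ (Fin d) → EuclideanSpace ℝ (Fin m)}
  {x : EuclideanSpace ℝ (Fin d)}

theorem IsRegularAt.hasFDerivAt_tangentProj (h : IsRegularAt c x) (hc : ContDiff ℝ ∞ c) :
    HasFDerivAt (tangentProj c) (fderiv ℝ (tangentProj c) x) x :=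
  ((h.contDiffAt_tangentProj hc).differentiableAt (by simp)).hasFDerivAt

theorem IsRegularAt.continuousAt_fderiv_tangentProj (h : IsRegularAt c x) (hc : ContDiff ℝ ∞ c) :
    ContinuousAt (fderiv ℝ (tangentProj c)) x :=
  ((h.contDiffAt_tangentProj hc).fderiv_right (m := 0) (by simp)).continuousAt

/-- The identity `P² = P` holds near `x`, since regularity is an open condition, and may be
differentiated. -/
theorem IsRegularAt.fderiv_tangentProj_mul (h : IsRegularAt c x) (hc : ContDiff ℝ ∞ c)
    (u v : EuclideanSpace ℝ (Fin d)) :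
    fderiv ℝ (tangentProj c) x u v =
      tangentProj c x (fderiv ℝ (tangentProj c) x u v) +
        fderiv ℝ (tangentProj c) x u (tangentProj c x v) := by
  have hP := h.hasFDerivAt_tangentProj hc
  have h1 : HasFDerivAt (fun y => tangentProj c y ∘L tangentProj c y)
      (fderiv ℝ (tangentProj c) x) x := by
    refine hP.congr_of_eventuallyEq ?_
    filter_upwards [h.eventually hc] with y hy
    ext1 v
    exact hy.tangentProj_idem v
  have h2 := h1.unique (hP.clm_comp hP)
  have h3 := congrArg (fun A => A u v) h2
  simpa using h3

/-- The derivative of the projector maps tangent vectors to normal vectors. -/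
theorem IsRegularAt.tangentProj_fderiv_apply_of_mem (h : IsRegularAt c x) (hc : ContDiff ℝ ∞ c)
    (u : EuclideanSpace ℝ (Fin d)) {v : EuclideanSpace ℝ (Fin d)} (hv : v ∈ tangentSpace c x) :
    tangentProj c x (fderiv ℝ (tangentProj c) x u v) = 0 := by
  have := h.fderiv_tangentProj_mul hc u v
  rw [tangentProj_of_mem hv] at this
  simpa using this

theorem continuousOn_fderiv_tangentProj_comp {σ s : ℝ → EuclideanSpace ℝ (Fin d)}
    (hc : ContDiff ℝ ∞ c) {I : Set ℝ} (hreg : ∀ t ∈ I, IsRegularAt c (σ t))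
    (hσ : ContinuousOn σ I) (hs : ContinuousOn s I) :
    ContinuousOn (fun t => fderiv ℝ (tangentProj c) (σ t) (s t)) I := fun t ht =>
  (((hreg t ht).continuousAt_fderiv_tangentProj hc).comp_continuousWithinAt (hσ t ht)).clm_apply
    (hs t ht)

/-- Solutions of the equation of parallel translation that start tangent remain tangent. -/
theorem mem_tangentSpace_of_transport {σ s ζ : ℝ → EuclideanSpace ℝ (Fin d)}
    (hc : ContDiff ℝ ∞ c) (hreg : ∀ t ∈ Icc (0 : ℝ) 1, IsRegularAt c (σ t))
    (hσ : ∀ t ∈ Icc (0 : ℝ) 1, HasDerivAt σ (s t) t) (hs : ContinuousOn s (Icc 0 1))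
    (hζ : ∀ t ∈ Icc (0 : ℝ) 1, HasDerivAt ζ (fderiv ℝ (tangentProj c) (σ t) (s t) (ζ t)) t)
    (h0 : ζ 0 ∈ tangentSpace c (σ 0)) : ∀ t ∈ Icc (0 : ℝ) 1, ζ t ∈ tangentSpace c (σ t) := by
  have hσc : ContinuousOn σ (Icc 0 1) := fun t ht => (hσ t ht).continuousAt.continuousWithinAt
  have hP : ContinuousOn (fun t => tangentProj c (σ t)) (Icc 0 1) := fun t ht =>
    ((hreg t ht).contDiffAt_tangentProj hc).continuousAt.comp_continuousWithinAt (hσc t ht)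
  -- The normal part `w = ζ - P ζ` has `w' = -P DP[s] ζ`. As `P DP[s] P = 0`, this equals `-P DP[s]
  -- w`, a homogeneous linear equation with zero initial value.
  have key := eq_zero_of_linear_ode (w := fun t => ζ t - tangentProj c (σ t) (ζ t))
    (B := fun t => -(tangentProj c (σ t) ∘L fderiv ℝ (tangentProj c) (σ t) (s t)))
    (hP.clm_comp (continuousOn_fderiv_tangentProj_comp hc hreg hσc hs)).neg ?_
    (by simp [tangentProj_of_mem h0])
  · intro t ht
    rw [sub_eq_zero.1 (key t ht)]
    exact (hreg t ht).tangentProj_mem _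
  · intro t ht
    have h1 := ((hreg t ht).hasFDerivAt_tangentProj hc).comp_hasDerivAt t (hσ t ht)
    refine ((hζ t ht).sub (h1.clm_apply (hζ t ht))).congr_deriv ?_
    have h2 := (hreg t ht).tangentProj_fderiv_apply_of_mem hc (s t)
      ((hreg t ht).tangentProj_mem (ζ t))
    simp [h2]

theorem feasible_of_tangent_curve {σ s : ℝ → EuclideanSpace ℝ (Fin d)} (hc : ContDiff ℝ ∞ c)
    (hσ : ∀ t ∈ Icc (0 : ℝ) 1, HasDerivAt σ (s t) t)
    (hs : ∀ t ∈ Icc (0 : ℝ) 1, s t ∈ tangentSpace c (σ t)) (h0 : σ 0 ∈ feasibleSet c) :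
    ∀ t ∈ Icc (0 : ℝ) 1, σ t ∈ feasibleSet c := by
  have := constant_of_hasDerivAt_zero_Icc (f := fun t => c (σ t)) fun t ht => by
    have h1 := ((hc.differentiable (by simp)) (σ t)).hasFDerivAt.comp_hasDerivAt t (hσ t ht)
    rwa [mem_tangentSpace_iff.1 (hs t ht)] at h1
  exact fun t ht => (this t ht).trans h0

variable {σ τ ζ ξ : ℝ → EuclideanSpace ℝ (Fin d)} {y : EuclideanSpace ℝ (Fin d)}

theorem IsGeodesic.hasDerivAt (h : IsGeodesic c σ x y) (t : ℝ) : HasDerivAt σ (deriv σ t) t :=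
  (h.contDiff.differentiable (by simp) t).hasDerivAt

theorem IsGeodesic.contDiff_deriv (h : IsGeodesic c σ x y) : ContDiff ℝ 1 (deriv σ) :=
  ((contDiff_succ_iff_deriv (n := 1)).1 h.contDiff).2.2

theorem IsGeodesic.deriv_mem (h : IsGeodesic c σ x y) (hc : ContDiff ℝ ∞ c) {t : ℝ}
    (ht : t ∈ Icc (0 : ℝ) 1) : deriv σ t ∈ tangentSpace c (σ t) := by
  rw [mem_tangentSpace_iff]
  refine deriv_unique_of_eqOn_Icc (f := fun t => c (σ t)) (g := fun _ => 0) (fun t ht => h.mem t ht)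
    ht ?_ (hasDerivAt_const t 0)
  exact ((hc.differentiable (by simp)) (σ t)).hasFDerivAt.comp_hasDerivAt t (h.hasDerivAt t)

/-- Differentiating `ζ = P(σ) ζ` gives `ζ' = DP(σ)[s] ζ + P(σ) ζ'`, and the last term vanishes.
Applied to velocities and to parallel fields, this turns the intrinsic conditions into ordinary
differential equations in the ambient space. -/
theorem hasDerivAt_of_tangent_of_normal (hc : ContDiff ℝ ∞ c) {s : ℝ → EuclideanSpace ℝ (Fin d)}
    (hreg : ∀ t ∈ Icc (0 : ℝ) 1, IsRegularAt c (σ t))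
    (hσ : ∀ t ∈ Icc (0 : ℝ) 1, HasDerivAt σ (s t) t) {ζ' : ℝ → EuclideanSpace ℝ (Fin d)}
    (hζ : ∀ t ∈ Icc (0 : ℝ) 1, HasDerivAt ζ (ζ' t) t)
    (hmem : ∀ t ∈ Icc (0 : ℝ) 1, ζ t ∈ tangentSpace c (σ t))
    (hnor : ∀ t ∈ Icc (0 : ℝ) 1, tangentProj c (σ t) (ζ' t) = 0) :
    ∀ t ∈ Icc (0 : ℝ) 1, HasDerivAt ζ (fderiv ℝ (tangentProj c) (σ t) (s t) (ζ t)) t := by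
  intro t ht
  have h1 := (((hreg t ht).hasFDerivAt_tangentProj hc).comp_hasDerivAt t (hσ t ht)).clm_apply
    (hζ t ht)
  have h2 := deriv_unique_of_eqOn_Icc (fun t ht => (tangentProj_of_mem (hmem t ht)).symm) ht
    (hζ t ht) h1
  have h3 := hζ t ht
  rw [h2] at h3
  simpa [hnor t ht] using h3

theorem IsGeodesic.hasDerivAt_deriv (h : IsGeodesic c σ x y) (hc : ContDiff ℝ ∞ c)
    (hL : SatisfiesLICQ c) : ∀ t ∈ Icc (0 : ℝ) 1,
      HasDerivAt (deriv σ) (fderiv ℝ (tangentProj c) (σ t) (deriv σ t) (deriv σ t)) t :=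
  hasDerivAt_of_tangent_of_normal hc (fun t ht => hL.isRegularAt (h.mem t ht))
    (fun t _ => h.hasDerivAt t)
    (fun t _ => (h.contDiff_deriv.differentiable (by simp) t).hasDerivAt)
    (fun _ ht => h.deriv_mem hc ht) h.acceleration

theorem IsParallelAlong.hasDerivAt (h : IsParallelAlong c σ ζ) (hσ : IsGeodesic c σ x y)
    (hc : ContDiff ℝ ∞ c) (hL : SatisfiesLICQ c) : ∀ t ∈ Icc (0 : ℝ) 1,
      HasDerivAt ζ (fderiv ℝ (tangentProj c) (σ t) (deriv σ t) (ζ t)) t :=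
  hasDerivAt_of_tangent_of_normal hc (fun t ht => hL.isRegularAt (hσ.mem t ht))
    (fun t _ => hσ.hasDerivAt t) (fun t _ => (h.contDiff.differentiable (by simp) t).hasDerivAt)
    h.mem h.parallel

theorem inner_eq_zero_of_normal {u v : EuclideanSpace ℝ (Fin d)} (hu : tangentProj c x u = 0)
    (hv : v ∈ tangentSpace c x) : ⟪u, v⟫_ℝ = 0 := by
  simpa [hu] using inner_sub_tangentProj u hv

/-- The acceleration is normal and the velocity tangent, so the squared speed has zero derivative.
-/
theorem IsGeodesic.norm_deriv (h : IsGeodesic c σ x y) (hc : ContDiff ℝ ∞ c) {t : ℝ}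
    (ht : t ∈ Icc (0 : ℝ) 1) : ‖deriv σ t‖ = ‖deriv σ 0‖ := by
  have := constant_of_hasDerivAt_zero_Icc (f := fun t => ⟪deriv σ t, deriv σ t⟫_ℝ) (fun t ht => by
    have h1 := (h.contDiff_deriv.differentiable (by simp) t).hasDerivAt
    refine (h1.inner ℝ h1).congr_deriv ?_
    have h2 := inner_eq_zero_of_normal (h.acceleration t ht) (h.deriv_mem hc ht)
    rw [real_inner_comm, h2, add_zero]) t ht
  simp only [real_inner_self_eq_norm_sq] at this
  exact (sq_eq_sq₀ (norm_nonneg _) (norm_nonneg _)).1 this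

/-- The speed is constant, so comparing lengths of geodesics amounts to comparing initial speeds. -/
theorem IsGeodesic.curveLength_eq (h : IsGeodesic c σ x y) (hc : ContDiff ℝ ∞ c) :
    curveLength σ = ‖deriv σ 0‖ₑ := by
  rw [curveLength, MeasureTheory.setLIntegral_congr_fun (g := fun _ => ‖deriv σ 0‖ₑ)
    measurableSet_Icc]
  · simp
  · intro t ht
    simp only
    rw [← ofReal_norm, h.norm_deriv hc ht, ofReal_norm]

theorem IsGeodesic.norm_sub_le (h : IsGeodesic c σ x y) (hc : ContDiff ℝ ∞ c) {t : ℝ}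
    (ht : t ∈ Icc (0 : ℝ) 1) : ‖σ t - x‖ ≤ ‖deriv σ 0‖ := by
  have := norm_le_of_hasDerivAt_of_norm_le (h := fun t => σ t - x) (h' := deriv σ)
    (C := ‖deriv σ 0‖) (fun t _ => (h.hasDerivAt t).sub_const x)
    (fun t ht => (h.norm_deriv hc ht).le) (by simp [h.source]) t ht
  exact this

theorem IsGeodesic.reverse (h : IsGeodesic c σ x y) : IsGeodesic c (fun t => σ (1 - t)) y x where
  contDiff := h.contDiff.comp (contDiff_const.sub contDiff_id)
  source := by simp [h.target]
  target := by simp [h.source]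
  mem t ht := h.mem _ ⟨by linarith [ht.2], by linarith [ht.1]⟩
  acceleration t ht := by
    have h1 : deriv (fun t => σ (1 - t)) = fun t => -deriv σ (1 - t) := by
      ext1 t
      exact deriv_comp_const_sub σ 1 t
    have h2 : deriv (fun t => -deriv σ (1 - t)) t = deriv (deriv σ) (1 - t) := by
      rw [deriv.fun_neg, deriv_comp_const_sub, neg_neg]
    rw [h1, h2]
    exact h.acceleration _ ⟨by linarith [ht.2], by linarith [ht.1]⟩

/-- Parallel fields along a geodesic and along its reverse have constant inner product. -/
theorem inner_parallel_reverse (hτ : EqOn τ (fun t => σ (1 - t)) (Icc 0 1))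
    (hζ : IsParallelAlong c σ ζ) (hξ : IsParallelAlong c τ ξ) :
    ⟪ζ 1, ξ 0⟫_ℝ = ⟪ζ 0, ξ 1⟫_ℝ := by
  have := constant_of_hasDerivAt_zero_Icc (f := fun t => ⟪ζ t, ξ (1 - t)⟫_ℝ) (fun t ht => by
    have ht' : 1 - t ∈ Icc (0 : ℝ) 1 := ⟨by linarith [ht.2], by linarith [ht.1]⟩
    have h1 := (hζ.contDiff.differentiable (by simp) t).hasDerivAt
    have h2 := (hξ.contDiff.differentiable (by simp) (1 - t)).hasDerivAt.comp_const_sub 1 t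
    refine (h1.inner ℝ h2).congr_deriv ?_
    have hστ : τ (1 - t) = σ t := by rw [hτ ht']; simp
    have h3 := hξ.mem _ ht'
    have h4 := hξ.parallel _ ht'
    rw [hστ] at h3 h4
    rw [inner_eq_zero_of_normal (hζ.parallel t ht) h3, inner_neg_right, real_inner_comm,
      inner_eq_zero_of_normal h4 (hζ.mem t ht), neg_zero, add_zero]) 1 (by simp)
  simpa using this

end Transport

/-! ### From solutions of the equations to geodesics -/

section GeodesicFlow

open Set

variable {d m : ℕ} {c : EuclideanSpace ℝ (Fin d) → EuclideanSpace ℝ (Fin m)}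
  {x : EuclideanSpace ℝ (Fin d)}

/-- Solutions of the geodesic and transport equations with tangent initial data give a geodesic and
the parallel fields along it. -/
theorem exists_geodesic_of_solution (hc : ContDiff ℝ ∞ c)
    {σ₀ s : ℝ → EuclideanSpace ℝ (Fin d)}
    {Z : ℝ → EuclideanSpace ℝ (Fin d) →L[ℝ] EuclideanSpace ℝ (Fin d)}
    (hreg : ∀ t ∈ Icc (0 : ℝ) 1, IsRegularAt c (σ₀ t))
    (hσ : ∀ t ∈ Ioo (-1 : ℝ) 2, HasDerivAt σ₀ (s t) t)
    (hs : ∀ t ∈ Ioo (-1 : ℝ) 2,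
      HasDerivAt s (fderiv ℝ (tangentProj c) (σ₀ t) (s t) (s t)) t)
    (hZ : ∀ t ∈ Ioo (-1 : ℝ) 2,
      HasDerivAt Z (fderiv ℝ (tangentProj c) (σ₀ t) (s t) ∘L Z t) t)
    (hσ2 : ContDiffOn ℝ 2 σ₀ (Ioo (-1) 2)) (hZ1 : ContDiffOn ℝ 1 Z (Ioo (-1) 2))
    (hx : σ₀ 0 = x) (hxM : x ∈ feasibleSet c) (hs0 : s 0 ∈ tangentSpace c x) :
    ∃ σ, IsGeodesic c σ x (σ₀ 1) ∧ deriv σ 0 = s 0 ∧ ∀ v ∈ tangentSpace c x, Z 0 v = v →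
      ∃ ζ, IsParallelAlong c σ ζ ∧ ζ 0 = v ∧ ζ 1 = Z 1 v := by
  have h01 : ∀ t ∈ Icc (0 : ℝ) 1, t ∈ Ioo (-1 : ℝ) 2 := fun t ht =>
    ⟨by linarith [ht.1], by linarith [ht.2]⟩
  have hsc : ContinuousOn s (Icc 0 1) := fun t ht =>
    (hs t (h01 t ht)).continuousAt.continuousWithinAt
  have hsT := mem_tangentSpace_of_transport hc hreg (fun t ht => hσ t (h01 t ht)) hsc
    (fun t ht => hs t (h01 t ht)) (hx ▸ hs0)
  have hM := feasible_of_tangent_curve hc (fun t ht => hσ t (h01 t ht)) hsT (hx ▸ hxM)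
  -- Geodesics are required to be `C²` on all of `ℝ`, while the solution is controlled only on `(-1,
  -- 2)`; a cutoff changes it away from `[0, 1]`.
  obtain ⟨σ, hσC, hσe⟩ := exists_contDiff_extension (n := 2) hσ2
  have hd : ∀ t ∈ Icc (0 : ℝ) 1, deriv σ =ᶠ[𝓝 t] s := fun t ht => by
    refine (hσe t ht).deriv.trans ?_
    filter_upwards [isOpen_Ioo.mem_nhds (h01 t ht)] with r hr
    exact (hσ r hr).deriv
  have hdd : ∀ t ∈ Icc (0 : ℝ) 1,
      deriv (deriv σ) t = fderiv ℝ (tangentProj c) (σ₀ t) (s t) (s t) := fun t ht => by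
    rw [(hd t ht).deriv_eq, (hs t (h01 t ht)).deriv]
  have h0 : (0 : ℝ) ∈ Icc (0 : ℝ) 1 := by simp
  have h1 : (1 : ℝ) ∈ Icc (0 : ℝ) 1 := by simp
  refine ⟨σ, ⟨hσC, (hσe 0 h0).eq_of_nhds.trans hx, (hσe 1 h1).eq_of_nhds, fun t ht => ?_,
    fun t ht => ?_⟩, (hd 0 h0).eq_of_nhds, fun v hv hZv => ?_⟩
  · rw [(hσe t ht).eq_of_nhds]
    exact hM t ht
  · rw [hdd t ht, (hσe t ht).eq_of_nhds]
    exact (hreg t ht).tangentProj_fderiv_apply_of_mem hc _ (hsT t ht)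
  · have hζ : ∀ t ∈ Ioo (-1 : ℝ) 2, HasDerivAt (fun t => Z t v)
        (fderiv ℝ (tangentProj c) (σ₀ t) (s t) (Z t v)) t := fun t ht =>
      ((hZ t ht).clm_apply (hasDerivAt_const t v)).congr_deriv (by simp)
    have hζT := mem_tangentSpace_of_transport hc hreg (fun t ht => hσ t (h01 t ht)) hsc
      (fun t ht => hζ t (h01 t ht)) (by rw [hx, hZv]; exact hv)
    obtain ⟨ζ, hζC, hζe⟩ := exists_contDiff_extension (n := 1) (α := fun t => Z t v)
      (hZ1.clm_apply contDiffOn_const)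
    refine ⟨ζ, ⟨hζC, fun t ht => ?_, fun t ht => ?_⟩, (hζe 0 h0).eq_of_nhds.trans hZv,
      (hζe 1 h1).eq_of_nhds⟩
    · rw [(hζe t ht).eq_of_nhds, (hσe t ht).eq_of_nhds]
      exact hζT t ht
    · rw [(hζe t ht).deriv_eq, (hζ t (h01 t ht)).deriv, (hσe t ht).eq_of_nhds]
      exact (hreg t ht).tangentProj_fderiv_apply_of_mem hc _ (hζT t ht)

end GeodesicFlow

/-! ### The joint vector field of geodesics and parallel translation -/

section TransportField

variable {E : Type*} [NormedAddCommGroup E] [NormedSpace ℝ E] {Γ : E → E →L[ℝ] E →L[ℝ] E}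

/-- The vector field of the geodesic equation `σ'' = Γ(σ) σ' σ'`, with velocities measured in units
of `κ`. -/
noncomputable def geodesicField (Γ : E → E →L[ℝ] E →L[ℝ] E) (κ : ℝ) (p : E × E) : E × E :=
  (κ • p.2, κ • Γ p.1 p.2 p.2)

/-- The joint vector field of the geodesic equation `σ'' = Γ(σ) σ' σ'` and of the equation
`Z' = Γ(σ) σ' Z` of parallel translation, with velocities measured in units of `κ`. -/
noncomputable def transportField (Γ : E → E →L[ℝ] E →L[ℝ] E) (κ : ℝ) (p : E × E × (E →L[ℝ] E)) :
    E × E × (E →L[ℝ] E) :=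
  (κ • p.2.1, κ • Γ p.1 p.2.1 p.2.1, κ • (Γ p.1 p.2.1 ∘L p.2.2))

theorem contDiffAt_geodesicField (κ : ℝ) {p : E × E} (h : ContDiffAt ℝ ∞ Γ p.1) :
    ContDiffAt ℝ ∞ (geodesicField Γ κ) p := by
  have h1 : ContDiffAt ℝ ∞ (fun p : E × E => Γ p.1) p := h.comp p contDiffAt_fst
  exact (contDiffAt_snd.const_smul κ).prodMk
    (((h1.clm_apply contDiffAt_snd).clm_apply contDiffAt_snd).const_smul κ)

theorem contDiffAt_transportField (κ : ℝ) {p : E × E × (E →L[ℝ] E)} (h : ContDiffAt ℝ ∞ Γ p.1) :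
    ContDiffAt ℝ ∞ (transportField Γ κ) p := by
  have h1 : ContDiffAt ℝ ∞ (fun p : E × E × (E →L[ℝ] E) => Γ p.1) p := h.comp p contDiffAt_fst
  have h2 : ContDiffAt ℝ ∞ (fun p : E × E × (E →L[ℝ] E) => p.2.1) p := contDiffAt_snd.fst
  have h3 : ContDiffAt ℝ ∞ (fun p : E × E × (E →L[ℝ] E) => p.2.2) p := contDiffAt_snd.snd
  have h4 := h1.clm_apply h2
  exact (h2.const_smul κ).prodMk (((h4.clm_apply h2).const_smul κ).prodMk
    ((h4.clm_comp h3).const_smul κ))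

/-- The derivative of `transportField Γ 1` at the equilibrium `(x, 0, P)`. -/
noncomputable def transportFieldDeriv (Γ₀ : E →L[ℝ] E →L[ℝ] E) (P : E →L[ℝ] E) :
    E × E × (E →L[ℝ] E) →L[ℝ] E × E × (E →L[ℝ] E) :=
  (ContinuousLinearMap.id ℝ E).prod ((0 : E →L[ℝ] E).prod
    (((ContinuousLinearMap.compL ℝ E E E).flip P) ∘L Γ₀)) ∘L
    ContinuousLinearMap.fst ℝ E (E →L[ℝ] E) ∘L ContinuousLinearMap.snd ℝ E (E × (E →L[ℝ] E))

theorem transportFieldDeriv_apply (Γ₀ : E →L[ℝ] E →L[ℝ] E) (P : E →L[ℝ] E)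
    (v : E × E × (E →L[ℝ] E)) : transportFieldDeriv Γ₀ P v = (v.2.1, 0, Γ₀ v.2.1 ∘L P) := rfl

theorem hasStrictFDerivAt_transportField (κ : ℝ) {x : E} (P : E →L[ℝ] E)
    (h : ContDiffAt ℝ ∞ Γ x) :
    HasStrictFDerivAt (transportField Γ κ) (κ • transportFieldDeriv (Γ x) P) (x, 0, P) := by
  set p₀ : E × E × (E →L[ℝ] E) := (x, 0, P)
  have h0 := h.hasStrictFDerivAt (by simp)
  have h1 : HasStrictFDerivAt (fun p : E × E × (E →L[ℝ] E) => Γ p.1) _ p₀ :=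
    HasStrictFDerivAt.comp (f := Prod.fst) p₀ h0 hasStrictFDerivAt_fst
  have h2 : HasStrictFDerivAt (fun p : E × E × (E →L[ℝ] E) => p.2.1) _ p₀ :=
    (ContinuousLinearMap.fst ℝ E (E →L[ℝ] E) ∘L
      ContinuousLinearMap.snd ℝ E (E × (E →L[ℝ] E))).hasStrictFDerivAt
  have h3 : HasStrictFDerivAt (fun p : E × E × (E →L[ℝ] E) => p.2.2) _ p₀ :=
    (ContinuousLinearMap.snd ℝ E (E →L[ℝ] E) ∘L
      ContinuousLinearMap.snd ℝ E (E × (E →L[ℝ] E))).hasStrictFDerivAt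
  have h4 := h1.clm_apply h2
  have h5 := (h2.const_smul κ).prodMk (((h4.clm_apply h2).const_smul κ).prodMk
    ((h4.clm_comp h3).const_smul κ))
  refine h5.congr_fderiv ?_
  refine ContinuousLinearMap.ext fun v => ?_
  simp [transportFieldDeriv_apply, p₀]

/-- The time-one map of the equations of geodesics and of parallel translation. -/
theorem exists_transport_flow [CompleteSpace E] {x : E} (P : E →L[ℝ] E) (h : ContDiffAt ℝ ∞ Γ x)
    {W : Set (E × E × (E →L[ℝ] E))} (hW : W ∈ 𝓝 (x, 0, P)) :
    ∃ (κ : ℝ) (α : E × E × (E →L[ℝ] E) → ℝ → E × E × (E →L[ℝ] E)), 0 < κ ∧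
      (∀ᶠ p in 𝓝 (x, 0, P), α p 0 = p ∧ ∀ t ∈ Set.Ioo (-1 : ℝ) 2,
        α p t ∈ W ∧ HasDerivAt (α p) (transportField Γ κ (α p t)) t) ∧
      (∀ W' ∈ 𝓝 (x, 0, P), ∀ᶠ p in 𝓝 (x, 0, P), ∀ t ∈ Set.Icc (0 : ℝ) 1, α p t ∈ W') ∧
      α (x, 0, P) 1 = (x, 0, P) ∧
      HasStrictFDerivAt (fun p => α p 1)
        (ContinuousLinearMap.id ℝ _ + κ • transportFieldDeriv (Γ x) P) (x, 0, P) := by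
  set A := transportFieldDeriv (Γ x) P
  -- Measuring velocities in units of `κ` multiplies the linearization by `κ`. This makes its norm
  -- at most 1/5, below the bound 1/4 under which the flow reaches time one.
  set κ : ℝ := 1 / (5 * (‖A‖ + 1))
  have hκ : 0 < κ := by positivity
  have hnorm : ‖κ • A‖ < 1 / 4 := by
    refine (ContinuousLinearMap.opNorm_smul_le κ A).trans_lt ?_
    rw [Real.norm_of_nonneg hκ.le]
    simp only [κ]
    rw [div_mul_eq_mul_div, div_lt_div_iff₀ (by positivity) (by norm_num)]
    linarith [norm_nonneg A]
  -- `A` depends only on the velocity component, and its output has velocity component zero.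
  have hsq : (κ • A) ∘L (κ • A) = 0 := by
    refine ContinuousLinearMap.ext fun v => ?_
    simp [A, transportFieldDeriv_apply]
  obtain ⟨α, hα⟩ := exists_flow_of_zero (hasStrictFDerivAt_transportField κ P h)
    (by simp [transportField]) hnorm hsq hW
  exact ⟨κ, α, hκ, hα⟩

end TransportField

/-! ### Inverting the exponential map -/

section Exponential

variable {E : Type*} [NormedAddCommGroup E] [NormedSpace ℝ E]

/-- The initial data `(x, κ⁻¹ P(x) u, P(x))` of the transport equations. -/
noncomputable def initialData (P : E → E →L[ℝ] E) (κ : ℝ) (q : E × E) : E × E × (E →L[ℝ] E) :=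
  (q.1, κ⁻¹ • P q.1 q.2, P q.1)

theorem hasStrictFDerivAt_initialData {P : E → E →L[ℝ] E} {P' : E →L[ℝ] E →L[ℝ] E} {x₀ : E}
    (hP : HasStrictFDerivAt P P' x₀) (κ : ℝ) :
    HasStrictFDerivAt (initialData P κ)
      ((ContinuousLinearMap.fst ℝ E E).prod ((κ⁻¹ • (P x₀ ∘L ContinuousLinearMap.snd ℝ E E)).prod
        (P' ∘L ContinuousLinearMap.fst ℝ E E))) (x₀, 0) := by
  have h1 : HasStrictFDerivAt (fun q : E × E => P q.1) _ (x₀, (0 : E)) :=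
    HasStrictFDerivAt.comp (f := Prod.fst) _ hP hasStrictFDerivAt_fst
  have h2 := (hasStrictFDerivAt_fst (p := (x₀, (0 : E)))).prodMk
    (((h1.clm_apply hasStrictFDerivAt_snd).const_smul κ⁻¹).prodMk h1)
  refine h2.congr_fderiv ?_
  refine ContinuousLinearMap.ext fun v => ?_
  simp

/-- The local inverse of the exponential map, made bijective by adding the normal component. -/
theorem exists_exp_inverse [CompleteSpace E] {P : E → E →L[ℝ] E} {P' Γ₀ : E →L[ℝ] E →L[ℝ] E}
    {x₀ : E} (hP : HasStrictFDerivAt P P' x₀) {Ψ : E × E × (E →L[ℝ] E) → E × E × (E →L[ℝ] E)} {κ : ℝ}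
    (hκ : κ ≠ 0) (hΨ : HasStrictFDerivAt Ψ
      (ContinuousLinearMap.id ℝ _ + κ • transportFieldDeriv Γ₀ (P x₀)) (x₀, 0, P x₀))
    (hΨ0 : Ψ (x₀, 0, P x₀) = (x₀, 0, P x₀)) :
    ∃ (ψ : E × E → E) (D : E × E →L[ℝ] E), HasStrictFDerivAt ψ D (x₀, x₀) ∧ ψ (x₀, x₀) = 0 ∧
      (∀ᶠ q in 𝓝 (x₀, x₀), (Ψ (initialData P κ (q.1, ψ q))).1 + ψ q - P q.1 (ψ q) = q.2) ∧
      ∀ᶠ v : (E × E) × E in 𝓝 ((x₀, x₀), 0),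
        (Ψ (initialData P κ (v.1.1, v.2))).1 + v.2 - P v.1.1 v.2 = v.1.2 → v.2 = ψ v.1 := by
  have hι0 : initialData P κ (x₀, 0) = (x₀, 0, P x₀) := by simp [initialData]
  have hι := hasStrictFDerivAt_initialData hP κ
  rw [← hι0] at hΨ
  have hA : HasStrictFDerivAt (fun v : (E × E) × E => (v.1.1, v.2)) _ ((x₀, x₀), (0 : E)) :=
    ((ContinuousLinearMap.fst ℝ E E ∘L ContinuousLinearMap.fst ℝ (E × E) E).prod
      (ContinuousLinearMap.snd ℝ (E × E) E)).hasStrictFDerivAt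
  have hΘ := (HasStrictFDerivAt.comp (f := fun v : (E × E) × E => (v.1.1, v.2))
    ((x₀, x₀), (0 : E)) (hΨ.comp _ hι) hA)
  have hP1 : HasStrictFDerivAt (fun v : (E × E) × E => P v.1.1) _ ((x₀, x₀), (0 : E)) :=
    HasStrictFDerivAt.comp (f := fun v : (E × E) × E => v.1.1) ((x₀, x₀), (0 : E)) hP
      (ContinuousLinearMap.fst ℝ E E ∘L ContinuousLinearMap.fst ℝ (E × E) E).hasStrictFDerivAt
  have hs : HasStrictFDerivAt (fun v : (E × E) × E => v.2) _ ((x₀, x₀), (0 : E)) :=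
    (ContinuousLinearMap.snd ℝ (E × E) E).hasStrictFDerivAt
  have hs' : HasStrictFDerivAt (fun v : (E × E) × E => v.1.2) _ ((x₀, x₀), (0 : E)) :=
    (ContinuousLinearMap.snd ℝ E E ∘L ContinuousLinearMap.fst ℝ (E × E) E).hasStrictFDerivAt
  have hf := ((hΘ.fst.add hs).sub (hP1.clm_apply hs)).sub hs'
  set f' := _
  change HasStrictFDerivAt (fun v : (E × E) × E =>
    (Ψ (initialData P κ (v.1.1, v.2))).1 + v.2 - P v.1.1 v.2 - v.1.2) f' ((x₀, x₀), 0) at hf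
  -- In the velocity variable the three terms have derivatives `P v`, `v` and `-P v`, so their sum
  -- is the identity. Without the normal correction `v - P v` only `P`, which need not be
  -- invertible, would remain.
  have hinv : f' ∘L ContinuousLinearMap.inr ℝ (E × E) E = ContinuousLinearMap.id ℝ E := by
    refine ContinuousLinearMap.ext fun v => ?_
    simp [f', transportFieldDeriv_apply, hκ]
  have hinv' : (f' ∘L ContinuousLinearMap.inr ℝ (E × E) E).IsInvertible :=
    ⟨ContinuousLinearEquiv.refl ℝ E, by rw [hinv]; rfl⟩
  have hf0 : (Ψ (initialData P κ (x₀, 0))).1 + 0 - P x₀ 0 - x₀ = 0 := by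
    rw [hι0, hΨ0]; simp
  have h2 := hf.eventually_apply_eq_iff_implicitFunctionOfProdDomain hinv'
  refine ⟨hf.implicitFunctionOfProdDomain hinv', _,
    hf.hasStrictFDerivAt_implicitFunctionOfProdDomain hinv', h2.self_of_nhds.1 rfl, ?_, ?_⟩
  · filter_upwards [hf.eventually_apply_implicitFunctionOfProdDomain hinv'] with q hq
    simp only [hf0] at hq
    exact sub_eq_zero.1 hq
  · filter_upwards [h2] with v hv hv'
    refine (hv.1 ?_).symm
    simp only [hf0]
    exact sub_eq_zero.2 hv'

end Exponential

/-! ### A straightening chart and a local projection onto the manifold -/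

section NormalChart

variable {d m : ℕ} {c : EuclideanSpace ℝ (Fin d) → EuclideanSpace ℝ (Fin m)}
  {xs : EuclideanSpace ℝ (Fin d)}

/-- The pseudoinverse `A (AᵀA)⁻¹` of `Aᵀ`. -/
noncomputable def normalLift (c : EuclideanSpace ℝ (Fin d) → EuclideanSpace ℝ (Fin m))
    (x : EuclideanSpace ℝ (Fin d)) : EuclideanSpace ℝ (Fin m) →L[ℝ] EuclideanSpace ℝ (Fin d) :=
  constraintGrad c x ∘L
    (ContinuousLinearMap.adjoint (constraintGrad c x) ∘L constraintGrad c x).inverse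

theorem tangentProj_add_normalLift (v : EuclideanSpace ℝ (Fin d)) :
    tangentProj c xs v + normalLift c xs (fderiv ℝ c xs v) = v := by
  have : ContinuousLinearMap.adjoint (constraintGrad c xs) = fderiv ℝ c xs := by
    simp [constraintGrad]
  simp [tangentProj, normalLift, this]

theorem IsRegularAt.fderiv_normalLift (h : IsRegularAt c xs) (w : EuclideanSpace ℝ (Fin m)) :
    fderiv ℝ c xs (normalLift c xs w) = w := by
  have h0 : ContinuousLinearMap.adjoint (constraintGrad c xs) = fderiv ℝ c xs := by
    simp [constraintGrad]
  have h1 := DFunLike.congr_fun (ContinuousLinearMap.IsInvertible.self_comp_inverse h) w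
  rw [← h0]
  exact h1

/-- A chart of the ambient space that straightens the constraint manifold near `xs`. -/
noncomputable def normalChart (c : EuclideanSpace ℝ (Fin d) → EuclideanSpace ℝ (Fin m))
    (xs z : EuclideanSpace ℝ (Fin d)) : EuclideanSpace ℝ (Fin d) :=
  tangentProj c xs (z - xs) + normalLift c xs (c z)

theorem contDiff_normalChart (hc : ContDiff ℝ ∞ c) : ContDiff ℝ ∞ (normalChart c xs) :=
  ((tangentProj c xs).contDiff.comp (contDiff_id.sub contDiff_const)).add
    ((normalLift c xs).contDiff.comp hc)

theorem hasFDerivAt_normalChart (hc : ContDiff ℝ ∞ c) :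
    HasFDerivAt (normalChart c xs) (ContinuousLinearMap.id ℝ _) xs := by
  have h1 := ((hc.differentiable (by simp)) xs).hasFDerivAt
  have h2 := ((tangentProj c xs).hasFDerivAt.comp xs ((hasFDerivAt_id xs).sub_const xs)).add
    ((normalLift c xs).hasFDerivAt.comp xs h1)
  refine h2.congr_fderiv (ContinuousLinearMap.ext fun v => ?_)
  exact tangentProj_add_normalLift v

theorem normalChart_of_feasible {z : EuclideanSpace ℝ (Fin d)} (hz : z ∈ feasibleSet c) :
    normalChart c xs z = tangentProj c xs (z - xs) := by
  have : c z = 0 := hz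
  simp [normalChart, this]

theorem IsRegularAt.feasible_of_normalChart (h : IsRegularAt c xs)
    {z w : EuclideanSpace ℝ (Fin d)} (hz : normalChart c xs z = tangentProj c xs w) :
    z ∈ feasibleSet c := by
  have h1 := congrArg (fderiv ℝ c xs) hz
  rw [normalChart, map_add, h.fderiv_normalLift, mem_tangentSpace_iff.1 (h.tangentProj_mem _),
    mem_tangentSpace_iff.1 (h.tangentProj_mem _), zero_add] at h1
  exact h1

/-- Nearby points of the constraint manifold do not differ by a normal vector. -/
theorem exists_nhds_eq_of_normal_sub (hc : ContDiff ℝ ∞ c) (h : IsRegularAt c xs) :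
    ∃ s ∈ 𝓝 xs, ∀ x ∈ s, ∀ y ∈ s, ∀ z ∈ s, y ∈ feasibleSet c → z ∈ feasibleSet c →
      tangentProj c x (y - z) = 0 → y = z := by
  have hstr := (contDiff_normalChart (xs := xs) hc).contDiffAt.hasStrictFDerivAt'
    (hasFDerivAt_normalChart hc) (by simp)
  -- Two errors of a quarter each: the chart has derivative the identity at `xs`, so `P(xs)(y - z)`
  -- is within `‖y - z‖ / 4` of `y - z`; and `P(xs)` is within 1/4 of `P(x)`, which kills `y - z`.
  -- Together `‖y - z‖ ≤ ‖y - z‖ / 2`.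
  obtain ⟨s, hs, happ⟩ := hstr.approximates_deriv_on_nhds (c := 1 / 4) (Or.inr (by norm_num))
  have hP := (h.contDiffAt_tangentProj hc).continuousAt
  have hP' := hP.eventually (Metric.ball_mem_nhds _ (by norm_num : (0 : ℝ) < 1 / 4))
  refine ⟨_, Filter.inter_mem hs hP', ?_⟩
  rintro x ⟨-, hx⟩ y ⟨hys, -⟩ z ⟨hzs, -⟩ hy hz hyz
  have h1 := happ _ hys _ hzs
  rw [normalChart_of_feasible hy, normalChart_of_feasible hz, ← map_sub,
    sub_sub_sub_cancel_right, ContinuousLinearMap.id_apply] at h1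
  have h2 : ‖tangentProj c xs (y - z)‖ ≤ 1 / 4 * ‖y - z‖ := by
    have h3 : tangentProj c xs (y - z) = -((tangentProj c x - tangentProj c xs) (y - z)) := by
      rw [sub_apply, hyz, zero_sub, neg_neg]
    rw [h3, norm_neg]
    refine (ContinuousLinearMap.le_opNorm _ _).trans ?_
    gcongr
    exact (mem_ball_iff_norm.1 hx).le
  have h4 : ‖y - z‖ ≤ ‖tangentProj c xs (y - z)‖ + ‖tangentProj c xs (y - z) - (y - z)‖ := by
    rw [norm_sub_rev (tangentProj c xs (y - z))]
    exact norm_le_norm_add_norm_sub' _ _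
  push_cast at h1
  have h5 : ‖y - z‖ ≤ 0 := by linarith
  exact sub_eq_zero.1 (norm_le_zero_iff.1 h5)

/-- A smooth retraction of a neighbourhood of `xs` onto the constraint manifold. -/
theorem exists_nearby_projection (hc : ContDiff ℝ ∞ c) (h : IsRegularAt c xs)
    (hxs : xs ∈ feasibleSet c) :
    ∃ π : EuclideanSpace ℝ (Fin d) → EuclideanSpace ℝ (Fin d), ContDiffAt ℝ ∞ π xs ∧
      HasFDerivAt π (tangentProj c xs) xs ∧ π xs = xs ∧ (∀ᶠ z in 𝓝 xs, π z ∈ feasibleSet c) ∧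
      ∀ᶠ z in 𝓝 xs, z ∈ feasibleSet c → π z = z := by
  have hg := (contDiff_normalChart (xs := xs) hc).contDiffAt (x := xs)
  have hg' : HasFDerivAt (normalChart c xs)
      ((ContinuousLinearEquiv.refl ℝ (EuclideanSpace ℝ (Fin d)) :
        EuclideanSpace ℝ (Fin d) ≃L[ℝ] EuclideanSpace ℝ (Fin d)) :
        EuclideanSpace ℝ (Fin d) →L[ℝ] EuclideanSpace ℝ (Fin d)) xs := hasFDerivAt_normalChart hc
  have hstr := hg.hasStrictFDerivAt' hg' (by simp)
  have hg0 : normalChart c xs xs = 0 := by rw [normalChart_of_feasible hxs]; simp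
  set θ := hg.localInverse hg' (by simp)
  have hθ : ContDiffAt ℝ ∞ θ 0 := hg0 ▸ hg.to_localInverse hg' (by simp)
  have hθ0 : θ 0 = xs := hg0 ▸ hg.localInverse_apply_image hg' (by simp)
  have hθ' : HasFDerivAt θ (ContinuousLinearMap.id ℝ _) 0 :=
    hg0 ▸ hstr.to_localInverse.hasFDerivAt
  have hl : ∀ᶠ z in 𝓝 xs, θ (normalChart c xs z) = z := hstr.eventually_left_inverse
  have hr : ∀ᶠ z in 𝓝 0, normalChart c xs (θ z) = z := hg0 ▸ hstr.eventually_right_inverse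
  have hPg : ContDiff ℝ ∞ fun z => tangentProj c xs (normalChart c xs z) :=
    (tangentProj c xs).contDiff.comp (contDiff_normalChart hc)
  have hPg0 : tangentProj c xs (normalChart c xs xs) = 0 := by rw [hg0, map_zero]
  -- In the chart the manifold is the tangent space at `xs`, so the linear projector can be pulled
  -- back through the chart.
  refine ⟨fun z => θ (tangentProj c xs (normalChart c xs z)), ?_, ?_, ?_, ?_, ?_⟩
  · exact ContDiffAt.comp (f := fun z => tangentProj c xs (normalChart c xs z)) xs
      (by rw [hPg0]; exact hθ) hPg.contDiffAt
  · exact HasFDerivAt.comp (f := fun z => tangentProj c xs (normalChart c xs z)) xs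
      (by rw [hPg0]; exact hθ')
      ((tangentProj c xs).hasFDerivAt.comp xs (hasFDerivAt_normalChart hc))
  · simp only [hPg0, hθ0]
  · have h1 : Filter.Tendsto (fun z => tangentProj c xs (normalChart c xs z)) (𝓝 xs) (𝓝 0) := by
      have := hPg.continuous.tendsto xs
      rwa [hPg0] at this
    filter_upwards [h1.eventually hr] with z hz
    exact h.feasible_of_normalChart hz
  · filter_upwards [hl] with z hz hzM
    simp only [normalChart_of_feasible hzM, h.tangentProj_idem] at hz ⊢
    exact hz

end NormalChart

/-! ### Short geodesics between nearby points and transport along them -/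

section LocalTransport

open Set

theorem exists_geodesicField_unique {E : Type*} [NormedAddCommGroup E] [NormedSpace ℝ E]
    {Γ : E → E →L[ℝ] E →L[ℝ] E} {x₀ : E} (hΓ : ContDiffAt ℝ ∞ Γ x₀) (κ : ℝ) :
    ∃ r > 0, ∀ a b : ℝ → E × E,
      (∀ t ∈ Icc (0 : ℝ) 1, HasDerivAt a (geodesicField Γ κ (a t)) t) →
      (∀ t ∈ Icc (0 : ℝ) 1, HasDerivAt b (geodesicField Γ κ (b t)) t) →
      (∀ t ∈ Icc (0 : ℝ) 1, a t ∈ Metric.ball (x₀, 0) r) →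
      (∀ t ∈ Icc (0 : ℝ) 1, b t ∈ Metric.ball (x₀, 0) r) →
      a 0 = b 0 → EqOn a b (Icc 0 1) := by
  obtain ⟨K, s, hs, hlip⟩ := ((contDiffAt_geodesicField κ (p := (x₀, 0)) hΓ).of_le
    (by exact_mod_cast le_top : (1 : WithTop ℕ∞) ≤ ∞)).exists_lipschitzOnWith
  obtain ⟨r, hr, hrs⟩ := Metric.mem_nhds_iff.1 hs
  refine ⟨r, hr, fun a b ha hb has hbs h0 => ?_⟩
  exact ODE_solution_unique_of_mem_Icc_right (v := fun _ => geodesicField Γ κ)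
    (s := fun _ => Metric.ball (x₀, 0) r) (fun _ _ => hlip.mono hrs)
    (fun t ht => (ha t ht).continuousAt.continuousWithinAt)
    (fun t ht => (ha t (Ico_subset_Icc_self ht)).hasDerivWithinAt)
    (fun t ht => has t (Ico_subset_Icc_self ht))
    (fun t ht => (hb t ht).continuousAt.continuousWithinAt)
    (fun t ht => (hb t (Ico_subset_Icc_self ht)).hasDerivWithinAt)
    (fun t ht => hbs t (Ico_subset_Icc_self ht)) h0

theorem hasDerivAt_transport_components {E : Type*} [NormedAddCommGroup E] [NormedSpace ℝ E]
    {Γ : E → E →L[ℝ] E →L[ℝ] E} {κ t : ℝ} {γ : ℝ → E × E × (E →L[ℝ] E)}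
    (h : HasDerivAt γ (transportField Γ κ (γ t)) t) :
    HasDerivAt (fun t => (γ t).1) (κ • (γ t).2.1) t ∧
      HasDerivAt (fun t => (γ t).2.1) (κ • Γ (γ t).1 (γ t).2.1 (γ t).2.1) t ∧
      HasDerivAt (fun t => (γ t).2.2) (κ • (Γ (γ t).1 (γ t).2.1 ∘L (γ t).2.2)) t :=
  ⟨(ContinuousLinearMap.fst ℝ E (E × (E →L[ℝ] E))).hasFDerivAt.comp_hasDerivAt t h,
    (ContinuousLinearMap.fst ℝ E (E →L[ℝ] E) ∘L
      ContinuousLinearMap.snd ℝ E (E × (E →L[ℝ] E))).hasFDerivAt.comp_hasDerivAt t h,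
    (ContinuousLinearMap.snd ℝ E (E →L[ℝ] E) ∘L
      ContinuousLinearMap.snd ℝ E (E × (E →L[ℝ] E))).hasFDerivAt.comp_hasDerivAt t h⟩

variable {d m : ℕ} {c : EuclideanSpace ℝ (Fin d) → EuclideanSpace ℝ (Fin m)}
  {xs : EuclideanSpace ℝ (Fin d)}

theorem IsGeodesic.hasDerivAt_geodesicField {σ : ℝ → EuclideanSpace ℝ (Fin d)}
    {x y : EuclideanSpace ℝ (Fin d)} (h : IsGeodesic c σ x y) (hc : ContDiff ℝ ∞ c)
    (hL : SatisfiesLICQ c) {κ : ℝ} (hκ : κ ≠ 0) : ∀ t ∈ Icc (0 : ℝ) 1,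
    HasDerivAt (fun t => (σ t, κ⁻¹ • deriv σ t))
      (geodesicField (fderiv ℝ (tangentProj c)) κ (σ t, κ⁻¹ • deriv σ t)) t := by
  intro t ht
  refine ((h.hasDerivAt t).prodMk ((h.hasDerivAt_deriv hc hL t ht).const_smul κ⁻¹)).congr_deriv ?_
  simp [geodesicField, smul_smul, hκ]

/-- The geodesic from `q.1` to `q.2` is the solution with initial velocity `ψ q`, where `ψ` is the
local inverse of the exponential map, and `𝒯 q` is the value at time one of `Z` along it.
Conversely, a geodesic with initial speed below `ε` solves the same equation, so its initial
velocity satisfies the relation that characterizes `ψ q`; this yields uniqueness. -/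
theorem exists_local_transport (hc : ContDiff ℝ ∞ c) (hL : SatisfiesLICQ c)
    (hxs : xs ∈ feasibleSet c) :
    ∃ (𝒯 : EuclideanSpace ℝ (Fin d) × EuclideanSpace ℝ (Fin d) →
        EuclideanSpace ℝ (Fin d) →L[ℝ] EuclideanSpace ℝ (Fin d))
      (D : EuclideanSpace ℝ (Fin d) × EuclideanSpace ℝ (Fin d) →L[ℝ]
        EuclideanSpace ℝ (Fin d) →L[ℝ] EuclideanSpace ℝ (Fin d)) (ε : ℝ), 0 < ε ∧
      HasStrictFDerivAt 𝒯 D (xs, xs) ∧ 𝒯 (xs, xs) = tangentProj c xs ∧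
      ∀ᶠ q in 𝓝 (xs, xs), q.1 ∈ feasibleSet c → q.2 ∈ feasibleSet c →
        (∃ σ, IsGeodesic c σ q.1 q.2 ∧ ‖deriv σ 0‖ < ε ∧ ∀ v ∈ tangentSpace c q.1,
          ∃ ζ, IsParallelAlong c σ ζ ∧ ζ 0 = v ∧ ζ 1 = 𝒯 q v) ∧
        𝒯 q ∘L tangentProj c q.1 = 𝒯 q ∧
        ∀ σ τ, IsGeodesic c σ q.1 q.2 → IsGeodesic c τ q.1 q.2 → ‖deriv σ 0‖ < ε →
          ‖deriv τ 0‖ < ε → EqOn σ τ (Icc 0 1) := by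
  have hreg := hL.isRegularAt hxs
  have hΓ : ContDiffAt ℝ ∞ (fderiv ℝ (tangentProj c)) xs :=
    (hreg.contDiffAt_tangentProj hc).fderiv_right (by simp)
  have hP := (hreg.contDiffAt_tangentProj hc).hasStrictFDerivAt (by simp)
  set P := tangentProj c with hPdef
  set Γ := fderiv ℝ P with hΓdef
  have hW : {p : EuclideanSpace ℝ (Fin d) × EuclideanSpace ℝ (Fin d) ×
      (EuclideanSpace ℝ (Fin d) →L[ℝ] EuclideanSpace ℝ (Fin d)) | IsRegularAt c p.1} ∈
      𝓝 (xs, 0, P xs) := continuousAt_fst.eventually (hreg.eventually hc)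
  obtain ⟨κ, α, hκ, hsol, hnear, hfix, hstr⟩ := exists_transport_flow (P xs) hΓ hW
  obtain ⟨ψ, Dψ, hψ, hψ0, hψr, hψu⟩ := exists_exp_inverse hP hκ.ne' hstr hfix
  obtain ⟨r, hr, huniq⟩ := exists_geodesicField_unique hΓ κ
  obtain ⟨s, hs, hnormal⟩ := exists_nhds_eq_of_normal_sub hc hreg
  have hι := hasStrictFDerivAt_initialData hP κ
  have hι0 : initialData P κ (xs, 0) = (xs, 0, P xs) := by simp [initialData]
  have h01 : ∀ t ∈ Icc (0 : ℝ) 1, t ∈ Ioo (-1 : ℝ) 2 := fun t ht =>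
    ⟨by linarith [ht.1], by linarith [ht.2]⟩
  -- good initial data
  have hgood : ∀ᶠ q in 𝓝 (xs, (0 : EuclideanSpace ℝ (Fin d))),
      (α (initialData P κ q) 0 = initialData P κ q ∧ ∀ t ∈ Ioo (-1 : ℝ) 2,
        IsRegularAt c (α (initialData P κ q) t).1 ∧ HasDerivAt (α (initialData P κ q))
          (transportField Γ κ (α (initialData P κ q) t)) t) ∧
      (∀ t ∈ Icc (0 : ℝ) 1, ((α (initialData P κ q) t).1, (α (initialData P κ q) t).2.1) ∈
        Metric.ball (xs, (0 : EuclideanSpace ℝ (Fin d))) r) ∧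
      (α (initialData P κ q) 1).1 ∈ s := by
    have h1 := hι.continuousAt
    rw [ContinuousAt, hι0] at h1
    have hcont : Continuous fun p : EuclideanSpace ℝ (Fin d) × EuclideanSpace ℝ (Fin d) ×
      (EuclideanSpace ℝ (Fin d) →L[ℝ] EuclideanSpace ℝ (Fin d)) => (p.1, p.2.1) :=
      continuous_fst.prodMk continuous_snd.fst
    have h2 := hnear _ ((hcont.tendsto (xs, 0, P xs)) (Metric.ball_mem_nhds _ hr))
    have h3 := hnear _ ((continuous_fst.tendsto (xs, 0, P xs)) hs)
    refine (h1.eventually hsol).and ((h1.eventually h2).and ?_)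
    filter_upwards [h1.eventually h3] with q hq
    exact hq 1 (by simp)
  -- geodesics with small initial velocity come from `ψ`
  obtain ⟨s₁, hs₁, s₂, hs₂, hs12⟩ := Filter.mem_prod_iff.1 (nhds_prod_eq (X :=
    EuclideanSpace ℝ (Fin d) × EuclideanSpace ℝ (Fin d)) (Y := EuclideanSpace ℝ (Fin d)) ▸ hψu)
  obtain ⟨s₃, hs₃, s₄, hs₄, hs34⟩ := Filter.mem_prod_iff.1 (nhds_prod_eq (X :=
    EuclideanSpace ℝ (Fin d)) (Y := EuclideanSpace ℝ (Fin d)) ▸ hgood)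
  obtain ⟨ε₀, hε₀, hball⟩ := Metric.mem_nhds_iff.1 (Filter.inter_mem hs₂ hs₄)
  -- `ε₀` keeps the initial velocity where `ψ` and the flow are controlled, `r / 2` keeps the curve
  -- within `r` of `xs`, and `κ * r` keeps the rescaled velocity `κ⁻¹ • σ'` below `r`.
  set ε := min ε₀ (min (r / 2) (κ * r)) with hεdef
  have hε : 0 < ε := by positivity
  have hclose : ∀ᶠ q : EuclideanSpace ℝ (Fin d) × EuclideanSpace ℝ (Fin d) in 𝓝 (xs, xs),
      q ∈ s₁ ∧ q.1 ∈ s₃ ∧ ‖q.1 - xs‖ < r / 2 := by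
    have h1 := (continuous_fst (X := EuclideanSpace ℝ (Fin d))
      (Y := EuclideanSpace ℝ (Fin d))).tendsto
      (xs, xs)
    filter_upwards [hs₁, h1 hs₃, h1 (Metric.ball_mem_nhds xs (half_pos hr))] with q hq1 hq2 hq3
    exact ⟨hq1, hq2, mem_ball_iff_norm.1 hq3⟩
  have hcurve : ∀ x y σ, ‖x - xs‖ < r / 2 → IsGeodesic c σ x y → ‖deriv σ 0‖ < ε →
      ∀ t ∈ Icc (0 : ℝ) 1, (σ t, κ⁻¹ • deriv σ t) ∈
        Metric.ball (xs, (0 : EuclideanSpace ℝ (Fin d))) r := by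
    intro x y σ hx hσ hσε t ht
    have hε1 : ε ≤ r / 2 := (min_le_right _ _).trans (min_le_left _ _)
    have hε2 : ε ≤ κ * r := (min_le_right _ _).trans (min_le_right _ _)
    rw [mem_ball_iff_norm, Prod.mk_sub_mk, Prod.norm_mk, sub_zero, max_lt_iff]
    constructor
    · have h1 := hσ.norm_sub_le hc ht
      have h2 := norm_sub_le_norm_sub_add_norm_sub (σ t) x xs
      linarith
    · rw [norm_smul, hσ.norm_deriv hc ht, Real.norm_of_nonneg (inv_nonneg.2 hκ.le),
        inv_mul_lt_iff₀ hκ]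
      linarith
  have hvel : ∀ q : EuclideanSpace ℝ (Fin d) × EuclideanSpace ℝ (Fin d),
      q ∈ s₁ → q.1 ∈ s₃ → ‖q.1 - xs‖ < r / 2 → ∀ σ, IsGeodesic c σ q.1 q.2 → ‖deriv σ 0‖ < ε →
      deriv σ 0 = ψ q := by
    intro q hq1 hq3 hqr σ hσ hσε
    have hb : deriv σ 0 ∈ Metric.ball (0 : EuclideanSpace ℝ (Fin d)) ε₀ :=
      mem_ball_zero_iff.2 (hσε.trans_le (min_le_left _ _))
    obtain ⟨⟨hg0, hg1⟩, hg2, -⟩ := hs34 (mk_mem_prod hq3 (hball hb).2)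
    have hT : deriv σ 0 ∈ tangentSpace c q.1 := by
      have := hσ.deriv_mem hc (t := 0) (by simp)
      rwa [hσ.source] at this
    have hPT : P q.1 (deriv σ 0) = deriv σ 0 := tangentProj_of_mem hT
    have heq := huniq _ (fun t => ((α (initialData P κ (q.1, deriv σ 0)) t).1,
      (α (initialData P κ (q.1, deriv σ 0)) t).2.1)) (hσ.hasDerivAt_geodesicField hc hL hκ.ne')
      (fun t ht => (hasDerivAt_transport_components (hg1 t (h01 t ht)).2).1.prodMk
        (hasDerivAt_transport_components (hg1 t (h01 t ht)).2).2.1)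
      (hcurve _ _ _ hqr hσ hσε) hg2 (by rw [hg0]; simp [initialData, hσ.source, hPT])
    have h1 := congrArg Prod.fst (heq (show (1 : ℝ) ∈ Icc (0 : ℝ) 1 by simp))
    simp only [hσ.target] at h1
    refine hs12 (mk_mem_prod hq1 (hball hb).1) ?_
    simp only [← h1, hPT, add_sub_cancel_right]
  -- the transport map
  have hψι : HasStrictFDerivAt (fun q : EuclideanSpace ℝ (Fin d) × EuclideanSpace ℝ (Fin d) =>
      (q.1, ψ q)) _ (xs, xs) := hasStrictFDerivAt_fst.prodMk hψ
  have hψι0 : ((xs, xs).1, ψ (xs, xs)) = (xs, (0 : EuclideanSpace ℝ (Fin d))) := by rw [hψ0]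
  have hΘ := hstr
  rw [← hι0] at hΘ
  have hΘ' := hΘ.comp _ hι
  rw [← hψι0] at hΘ'
  have hΘ'' := hΘ'.comp (f := fun q : EuclideanSpace ℝ (Fin d) × EuclideanSpace ℝ (Fin d) =>
      (q.1, ψ q)) (xs, xs) hψι
  have hP1 : HasStrictFDerivAt (fun q : EuclideanSpace ℝ (Fin d) × EuclideanSpace ℝ (Fin d) =>
      P q.1) _ (xs, xs) := HasStrictFDerivAt.comp (f := Prod.fst) (xs, xs) hP hasStrictFDerivAt_fst
  -- The final factor `P q.1` makes the operator vanish on the normal space at `q.1`.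
  have h𝒯 := hΘ''.snd.snd.clm_comp hP1
  refine ⟨_, _, ε, hε, h𝒯, ?_, ?_⟩
  · simp only [hψ0, hι0, hfix]
    ext1 u
    exact hreg.tangentProj_idem u
  have hψt : Filter.Tendsto (fun q : EuclideanSpace ℝ (Fin d) × EuclideanSpace ℝ (Fin d) =>
      (q.1, ψ q)) (𝓝 (xs, xs)) (𝓝 (xs, 0)) := by
    have := hψι.continuousAt
    rwa [ContinuousAt, hψι0] at this
  have hψsmall : ∀ᶠ q in 𝓝 (xs, xs), ‖ψ q‖ < ε := by
    have := hψ.continuousAt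
    rw [ContinuousAt, hψ0] at this
    filter_upwards [this (Metric.ball_mem_nhds 0 hε)] with q hq
    exact mem_ball_zero_iff.1 hq
  have hsnd : ∀ᶠ q : EuclideanSpace ℝ (Fin d) × EuclideanSpace ℝ (Fin d) in 𝓝 (xs, xs),
      q.1 ∈ s ∧ q.2 ∈ s := by
    rw [nhds_prod_eq]
    exact Filter.Eventually.prod_mk hs hs
  filter_upwards [hclose, hψt.eventually hgood, hψsmall, hψr, hsnd]
    with q hq hqg hqε hqr hqs hq1 hq2
  obtain ⟨⟨hg0, hg1⟩, -, hgs⟩ := hqg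
  have hreg1 := hL.isRegularAt hq1
  set γ := α (initialData P κ (q.1, ψ q)) with hγ
  have hγC : ∀ n : ℕ, ContDiffOn ℝ n γ (Ioo (-1) 2) := contDiffOn_of_hasDerivAt_field isOpen_Ioo
    (fun t ht => (hg1 t ht).2) (fun t ht => contDiffAt_transportField κ
      (((hg1 t ht).1.contDiffAt_tangentProj hc).fderiv_right (by simp)))
  have hd1 : ∀ t ∈ Ioo (-1 : ℝ) 2, HasDerivAt (fun t => (γ t).1) (κ • (γ t).2.1) t := fun t ht =>
    (hasDerivAt_transport_components (hg1 t ht).2).1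
  have hd2 : ∀ t ∈ Ioo (-1 : ℝ) 2, HasDerivAt (fun t => κ • (γ t).2.1)
      (Γ (γ t).1 (κ • (γ t).2.1) (κ • (γ t).2.1)) t := fun t ht =>
    ((hasDerivAt_transport_components (hg1 t ht).2).2.1.const_smul κ).congr_deriv (by simp)
  have hd3 : ∀ t ∈ Ioo (-1 : ℝ) 2, HasDerivAt (fun t => (γ t).2.2)
      (Γ (γ t).1 (κ • (γ t).2.1) ∘L (γ t).2.2) t := fun t ht =>
    (hasDerivAt_transport_components (hg1 t ht).2).2.2.congr_deriv (by simp)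
  have hγ00 : (γ 0).1 = q.1 := by rw [hg0]; rfl
  have hγ01 : κ • (γ 0).2.1 = P q.1 (ψ q) := by rw [hg0]; simp [initialData, hκ.ne']
  have hγ02 : (γ 0).2.2 = P q.1 := by rw [hg0]; rfl
  obtain ⟨σ, hσ, hσ0, hσp⟩ := exists_geodesic_of_solution (x := q.1) hc
    (fun t ht => (hg1 t (h01 t ht)).1) hd1 hd2 hd3
    (hγC 2).fst (hγC 1).snd.snd hγ00 hq1 (by rw [hγ01]; exact hreg1.tangentProj_mem _)
  -- The equation defining `ψ` only says that `q.2` and the end point of the flow line differ by a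
  -- vector normal at `q.1`. Both lie on the manifold near `xs`, hence coincide; then `ψ q` has no
  -- normal part.
  have hend : q.2 = (γ 1).1 := by
    refine hnormal q.1 hqs.1 _ hqs.2 _ hgs hq2 ?_ ?_
    · have := hσ.mem 1 (by simp)
      rwa [hσ.target] at this
    · rw [← hqr, add_sub_assoc, add_sub_cancel_left, map_sub]
      change P q.1 (ψ q) - P q.1 (P q.1 (ψ q)) = 0
      rw [hPdef, hreg1.tangentProj_idem, sub_self]
  rw [← hend] at hσ
  have hPψ : P q.1 (ψ q) = ψ q := by
    have h1 := hqr
    rw [hend, add_sub_assoc] at h1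
    exact (sub_eq_zero.1 (left_eq_add.1 h1.symm)).symm
  refine ⟨⟨σ, hσ, by rw [hσ0, hγ01, hPψ]; exact hqε, fun v hv => ?_⟩, ?_, ?_⟩
  · have hPv : P q.1 v = v := tangentProj_of_mem hv
    obtain ⟨ζ, hζ, hζ0, hζ1⟩ := hσp v hv (by rw [hγ02, hPv])
    refine ⟨ζ, hζ, hζ0, ?_⟩
    rw [hζ1]
    simp only [ContinuousLinearMap.comp_apply, hPv]
  · ext1 u
    simp only [ContinuousLinearMap.comp_apply]
    rw [hPdef, hreg1.tangentProj_idem]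
  · intro τ τ' hτ hτ' hτε hτε'
    have heq := huniq _ _ (hτ.hasDerivAt_geodesicField hc hL hκ.ne')
      (hτ'.hasDerivAt_geodesicField hc hL hκ.ne') (hcurve _ _ _ hq.2.2 hτ hτε)
      (hcurve _ _ _ hq.2.2 hτ' hτε') (by
        rw [hvel q hq.1 hq.2.1 hq.2.2 τ hτ hτε, hvel q hq.1 hq.2.1 hq.2.2 τ' hτ' hτε', hτ.source,
          hτ'.source])
    exact fun t ht => congrArg Prod.fst (heq ht)

end LocalTransport

/-! ### Identification with the selected parallel translation -/

section ParallelTranslation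

open Set
open scoped InnerProductSpace

variable {d m : ℕ} {c : EuclideanSpace ℝ (Fin d) → EuclideanSpace ℝ (Fin m)}
  {xs x y : EuclideanSpace ℝ (Fin d)} {σ τ ζ ξ : ℝ → EuclideanSpace ℝ (Fin d)}

theorem IsGeodesic.deriv_eqOn (hσ : IsGeodesic c σ x y) (hτ : IsGeodesic c τ x y)
    (h : EqOn σ τ (Icc 0 1)) : EqOn (deriv σ) (deriv τ) (Icc 0 1) := fun t ht =>
  deriv_unique_of_eqOn_Icc h ht (hσ.hasDerivAt t) (hτ.hasDerivAt t)

theorem IsGeodesic.curveLength_le_iff {x' y' : EuclideanSpace ℝ (Fin d)}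
    (hσ : IsGeodesic c σ x y) (hτ : IsGeodesic c τ x' y') (hc : ContDiff ℝ ∞ c) :
    curveLength σ ≤ curveLength τ ↔ ‖deriv σ 0‖ ≤ ‖deriv τ 0‖ := by
  rw [hσ.curveLength_eq hc, hτ.curveLength_eq hc, ← ofReal_norm, ← ofReal_norm,
    ENNReal.ofReal_le_ofReal_iff (norm_nonneg _)]

/-- Parallel fields along the same geodesic with the same initial value agree. -/
theorem IsParallelAlong.eq_of_eqOn (hζ : IsParallelAlong c σ ζ) (hξ : IsParallelAlong c τ ξ)
    (hσ : IsGeodesic c σ x y) (hτ : IsGeodesic c τ x y) (h : EqOn σ τ (Icc 0 1))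
    (hc : ContDiff ℝ ∞ c) (hL : SatisfiesLICQ c) (h0 : ζ 0 = ξ 0) : ζ 1 = ξ 1 := by
  refine eq_of_linear_ode (B := fun t => fderiv ℝ (tangentProj c) (σ t) (deriv σ t))
    (continuousOn_fderiv_tangentProj_comp hc (fun t ht => hL.isRegularAt (hσ.mem t ht))
      hσ.contDiff.continuous.continuousOn hσ.contDiff_deriv.continuous.continuousOn)
    (hζ.hasDerivAt hσ hc hL) (fun t ht => ?_) h0 1 (by simp)
  rw [h ht, hσ.deriv_eqOn hτ h ht]
  exact hξ.hasDerivAt hτ hc hL t ht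

/-- Near a point of the constraint manifold, parallel translation is strictly differentiable. -/
theorem exists_parallelTranslation_eq (hc : ContDiff ℝ ∞ c) (hL : SatisfiesLICQ c)
    (hxs : xs ∈ feasibleSet c) :
    ∃ (𝒯 : EuclideanSpace ℝ (Fin d) × EuclideanSpace ℝ (Fin d) →
        EuclideanSpace ℝ (Fin d) →L[ℝ] EuclideanSpace ℝ (Fin d))
      (D : EuclideanSpace ℝ (Fin d) × EuclideanSpace ℝ (Fin d) →L[ℝ]
        EuclideanSpace ℝ (Fin d) →L[ℝ] EuclideanSpace ℝ (Fin d)),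
      HasStrictFDerivAt 𝒯 D (xs, xs) ∧ 𝒯 (xs, xs) = tangentProj c xs ∧
      ∀ᶠ q in 𝓝 (xs, xs), q.1 ∈ feasibleSet c → q.2 ∈ feasibleSet c →
        parallelTranslation c q.1 q.2 = 𝒯 q ∧ parallelTranslation c q.2 q.1 = 𝒯 q.swap ∧
        (∀ u v, ⟪𝒯 q u, v⟫_ℝ = ⟪u, 𝒯 q.swap v⟫_ℝ) ∧ (∀ u, 𝒯 q u ∈ tangentSpace c q.2) ∧
        𝒯 q.swap ∘L tangentProj c q.2 = 𝒯 q.swap := by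
  obtain ⟨𝒯, D, ε, hε, hD, h𝒯0, hev⟩ := exists_local_transport hc hL hxs
  refine ⟨𝒯, D, hD, h𝒯0, ?_⟩
  have key : ∀ᶠ q in 𝓝 (xs, xs), q.1 ∈ feasibleSet c → q.2 ∈ feasibleSet c →
      parallelTranslation c q.1 q.2 = 𝒯 q := by
    filter_upwards [hev] with q hq hq1 hq2
    obtain ⟨⟨σ, hσ, hσε, hσp⟩, hTP, huniq⟩ := hq hq1 hq2
    -- The constructed geodesic is shortest: a strictly shorter one would also have initial speed
    -- below `ε`, and would then coincide with it.
    have hex : ∃ T, IsParallelTranslation c q.1 q.2 T := by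
      refine ⟨𝒯 q, ⟨σ, ⟨hσ, fun τ hτ => ?_⟩, hσp⟩, hTP⟩
      rw [hσ.curveLength_le_iff hτ hc]
      by_contra! hlt
      have := hσ.deriv_eqOn hτ (huniq σ τ hσ hτ hσε (hlt.trans hσε))
        (show (0 : ℝ) ∈ Icc (0 : ℝ) 1 by simp)
      rw [this] at hlt
      exact lt_irrefl _ hlt
    -- Whatever operator `Classical.epsilon` selects translates along some shortest geodesic. That
    -- geodesic is no longer than `σ`, so uniqueness applies to it and the two translations agree.
    obtain ⟨⟨τ, ⟨hτ, hmin⟩, hτp⟩, hTP'⟩ : IsParallelTranslation c q.1 q.2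
        (parallelTranslation c q.1 q.2) := Classical.epsilon_spec hex
    have hle := (hτ.curveLength_le_iff hσ hc).1 (hmin σ hσ)
    have heq := huniq τ σ hτ hσ (hle.trans_lt hσε) hσε
    have hT : ∀ v ∈ tangentSpace c q.1, parallelTranslation c q.1 q.2 v = 𝒯 q v := by
      intro v hv
      obtain ⟨ζ, hζ, hζ0, hζ1⟩ := hσp v hv
      obtain ⟨ξ, hξ, hξ0, hξ1⟩ := hτp v hv
      rw [← hζ1, ← hξ1]
      exact hξ.eq_of_eqOn hζ hτ hσ heq hc hL (hξ0.trans hζ0.symm)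
    ext1 u
    rw [← hTP, ← hTP', ContinuousLinearMap.comp_apply, ContinuousLinearMap.comp_apply]
    exact hT _ ((hL.isRegularAt hq1).tangentProj_mem u)
  have hswap : Filter.Tendsto Prod.swap (𝓝 (xs, xs)) (𝓝 (xs, xs)) :=
    (continuous_swap (X := EuclideanSpace ℝ (Fin d)) (Y := EuclideanSpace ℝ (Fin d))).tendsto
      (xs, xs)
  filter_upwards [key, hswap.eventually key, hev, hswap.eventually hev] with q hk hks he hes hq1 hq2
  obtain ⟨⟨σ, hσ, hσε, hσp⟩, hTP, huniq⟩ := he hq1 hq2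
  obtain ⟨⟨τ, hτ, hτε, hτp⟩, hTP', -⟩ := hes hq2 hq1
  simp only [Prod.fst_swap, Prod.snd_swap] at hτ hτp hTP'
  have hreg1 := hL.isRegularAt hq1
  have hreg2 := hL.isRegularAt hq2
  have hmem : ∀ q : EuclideanSpace ℝ (Fin d) × EuclideanSpace ℝ (Fin d), ∀ σ,
      IsGeodesic c σ q.1 q.2 → IsRegularAt c q.1 → 𝒯 q ∘L tangentProj c q.1 = 𝒯 q →
      (∀ v ∈ tangentSpace c q.1, ∃ ζ, IsParallelAlong c σ ζ ∧ ζ 0 = v ∧ ζ 1 = 𝒯 q v) →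
      ∀ u, 𝒯 q u ∈ tangentSpace c q.2 := by
    intro q σ hσ hreg hTP hσp u
    obtain ⟨ζ, hζ, hζ0, hζ1⟩ := hσp _ (hreg.tangentProj_mem u)
    have h1 := hζ.mem 1 (by simp)
    rwa [hζ1, hσ.target, ← ContinuousLinearMap.comp_apply, hTP] at h1
  refine ⟨hk hq1 hq2, hks hq2 hq1, fun u v => ?_, hmem q σ hσ hreg1 hTP hσp, hTP'⟩
  -- The reverse of the short geodesic from `q.2` to `q.1` is the short geodesic from `q.1` to
  -- `q.2`, so constancy of inner products makes the two translations adjoint.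
  have hrev := huniq (fun t => τ (1 - t)) σ hτ.reverse hσ (by
    rw [deriv_comp_const_sub, norm_neg, sub_zero, hτ.norm_deriv hc (by simp)]
    exact hτε) hσε
  have hrev' : EqOn τ (fun t => σ (1 - t)) (Icc 0 1) := fun t ht => by
    have := hrev (show 1 - t ∈ Icc (0 : ℝ) 1 from ⟨by linarith [ht.2], by linarith [ht.1]⟩)
    simpa using this
  obtain ⟨ζ, hζ, hζ0, hζ1⟩ := hσp _ (hreg1.tangentProj_mem u)
  obtain ⟨ξ, hξ, hξ0, hξ1⟩ := hτp _ (hreg2.tangentProj_mem v)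
  have h1 := inner_parallel_reverse hrev' hζ hξ
  have h2 : 𝒯 q.swap v ∈ tangentSpace c q.1 := hmem q.swap τ hτ hreg2 hTP' hτp v
  rw [hζ0, hζ1, hξ0, hξ1, ← ContinuousLinearMap.comp_apply (𝒯 q), hTP,
    ← ContinuousLinearMap.comp_apply (𝒯 q.swap), hTP', ← hreg2.inner_tangentProj_left,
    hreg1.inner_tangentProj_left, tangentProj_of_mem (hmem q σ hσ hreg1 hTP hσp u),
    tangentProj_of_mem h2] at h1
  exact h1

end ParallelTranslation

/-! ### Local sign function and eigenvalue counting -/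

section Sign

/-- The involutions commuting with a given element of a Banach algebra depend, locally, strictly
differentiably on that element. -/
theorem exists_local_sign {A : Type*} [NormedRing A] [NormedAlgebra ℝ A] [CompleteSpace A]
    {S₀ : A} (hS₀ : S₀ * S₀ = 1) :
    ∃ (𝒮 : A → A) (D : A →L[ℝ] A), HasStrictFDerivAt 𝒮 D S₀ ∧ 𝒮 S₀ = S₀ ∧
      (∀ W, D W = (1 / 2 : ℝ) • (W - S₀ * W * S₀)) ∧
      ∀ᶠ p : A × A in 𝓝 (S₀, S₀), p.2 * p.2 = 1 → p.2 * p.1 = p.1 * p.2 → p.2 = 𝒮 p.1 := by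
  have h1 : HasStrictFDerivAt (fun p : A × A => p.1) (ContinuousLinearMap.fst ℝ A A) (S₀, S₀) :=
    hasStrictFDerivAt_fst
  have h2 : HasStrictFDerivAt (fun p : A × A => p.2) (ContinuousLinearMap.snd ℝ A A) (S₀, S₀) :=
    hasStrictFDerivAt_snd
  -- An involution `S` commuting with `B` solves the single equation `S² - 1 + (B S - S B) = 0`. At
  -- `B = S = S₀` the derivative in `S` is `W ↦ 2 S₀ W`: the commutator cancels `W S₀` against the
  -- derivative of the square, and what is left is invertible because `S₀² = 1`.
  have hf := ((h2.mul' h2).sub_const 1).add ((h1.mul' h2).sub (h2.mul' h1))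
  set f' := _
  change HasStrictFDerivAt (fun p : A × A => p.2 * p.2 - 1 + (p.1 * p.2 - p.2 * p.1)) f' (S₀, S₀)
    at hf
  have hr : ∀ W, (f' ∘L ContinuousLinearMap.inr ℝ A A) W = (2 : ℝ) • (S₀ * W) := by
    intro W
    simp [f', two_smul]
  have hl : ∀ W, (f' ∘L ContinuousLinearMap.inl ℝ A A) W = W * S₀ - S₀ * W := by
    intro W
    simp [f']
  have hinv : (f' ∘L ContinuousLinearMap.inr ℝ A A).IsInvertible := by
    refine ContinuousLinearMap.IsInvertible.of_inverse
      (g := (1 / 2 : ℝ) • ContinuousLinearMap.mul ℝ A S₀) ?_ ?_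
    · refine ContinuousLinearMap.ext fun W => ?_
      rw [ContinuousLinearMap.comp_apply, hr]
      simp [← mul_assoc, hS₀, smul_smul]
    · refine ContinuousLinearMap.ext fun W => ?_
      rw [ContinuousLinearMap.comp_apply, hr]
      simp [← mul_assoc, hS₀, smul_smul]
  have hiff := hf.eventually_apply_eq_iff_implicitFunctionOfProdDomain hinv
  refine ⟨hf.implicitFunctionOfProdDomain hinv, _,
    hf.hasStrictFDerivAt_implicitFunctionOfProdDomain hinv,
    hiff.self_of_nhds.1 rfl, fun W => ?_, ?_⟩
  · set V := (-(f' ∘L ContinuousLinearMap.inr ℝ A A).inverse ∘L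
      (f' ∘L ContinuousLinearMap.inl ℝ A A)) W with hV
    have h3 : (2 : ℝ) • (S₀ * V) = -(W * S₀ - S₀ * W) := by
      rw [← hr, ← hl, hV]
      have := DFunLike.congr_fun (ContinuousLinearMap.IsInvertible.self_comp_inverse hinv)
        ((f' ∘L ContinuousLinearMap.inl ℝ A A) W)
      simp only [ContinuousLinearMap.comp_apply, ContinuousLinearMap.id_apply, map_neg,
        neg_apply] at this ⊢
      rw [this]
    have h4 : V = (1 / 2 : ℝ) • (S₀ * ((2 : ℝ) • (S₀ * V))) := by
      rw [mul_smul_comm, ← mul_assoc, hS₀, one_mul, smul_smul]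
      norm_num
    rw [h4, h3, mul_neg, mul_sub, ← mul_assoc, ← mul_assoc, hS₀, one_mul, neg_sub]
  · filter_upwards [hiff] with p hp hp1 hp2
    refine (hp.1 ?_).symm
    simp [hp1, hp2, hS₀]

/-- Increasing numbers close to `±1` whose sum is close to `n - 2k` are close to
`-1, …, -1, 1, …, 1` with `k` entries `-1`. -/
theorem abs_sub_sign_le {n k : ℕ} (hk : k ≤ n) {lam : Fin n → ℝ} (hmono : Monotone lam) {η : ℝ}
    (hη : η * (2 * n) ≤ 1) (hlam : ∀ i, |lam i ^ 2 - 1| ≤ η)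
    (hsum : |∑ i, lam i - ∑ i : Fin n, (if (i : ℕ) < k then (-1 : ℝ) else 1)| < 1 / 2) (i : Fin n) :
    |lam i - if (i : ℕ) < k then (-1 : ℝ) else 1| ≤ η := by
  -- In `lam i ^ 2 - 1 = (lam i - 1) * (lam i + 1)` the factor away from the nearer root has modulus
  -- at least 1.
  have hs : ∀ i, |lam i - if lam i < 0 then (-1 : ℝ) else 1| ≤ η := by
    intro i
    refine le_trans ?_ (hlam i)
    have h1 : lam i ^ 2 - 1 = (lam i - 1) * (lam i + 1) := by ring
    rw [h1, abs_mul]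
    split_ifs with h
    · rw [sub_neg_eq_add]
      have : 1 ≤ |lam i - 1| := by rw [abs_of_neg (by linarith)]; linarith
      exact le_mul_of_one_le_left (abs_nonneg _) this
    · have : 1 ≤ |lam i + 1| := by rw [abs_of_nonneg (by linarith)]; linarith
      exact le_mul_of_one_le_right (abs_nonneg _) this
  set F : Finset (Fin n) := Finset.univ.filter fun i => lam i < 0 with hF
  set G : Finset (Fin n) := Finset.univ.filter fun i => (i : ℕ) < k with hG
  have hcount : ∀ p : Fin n → Prop, ∀ [DecidablePred p],
      ∑ i, (if p i then (-1 : ℝ) else 1) = n - 2 * (Finset.univ.filter p).card := by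
    intro p _
    have : ∀ i, (if p i then (-1 : ℝ) else 1) = 1 - 2 * (if p i then 1 else 0) := by
      intro i; split_ifs <;> norm_num
    simp only [this, Finset.sum_sub_distrib, ← Finset.mul_sum]
    simp
  have hGcard : G.card = k := by
    rw [hG, Fin.card_filter_val_lt, min_eq_right hk]
  -- The signs sum to within 1/2 of `∑ lam i`, hence to strictly within 1 of `n - 2k`, so exactly
  -- `k` of them are negative.
  have hclose : |∑ i, lam i - ∑ i, (if lam i < 0 then (-1 : ℝ) else 1)| ≤ 1 / 2 := by
    rw [← Finset.sum_sub_distrib]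
    refine (Finset.abs_sum_le_sum_abs _ _).trans ((Finset.sum_le_sum fun i _ => hs i).trans ?_)
    simp only [Finset.sum_const, Finset.card_univ, Fintype.card_fin, nsmul_eq_mul]
    linarith
  have hcard : F.card = k := by
    rw [hcount] at hclose
    rw [hcount, ← hG, hGcard] at hsum
    rw [← hF] at hclose
    rw [abs_lt] at hsum
    rw [abs_le] at hclose
    have h1 : (F.card : ℝ) < k + 1 := by linarith [hsum.1, hsum.2, hclose.1, hclose.2]
    have h2 : (k : ℝ) < F.card + 1 := by linarith [hsum.1, hsum.2, hclose.1, hclose.2]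
    have h3 : F.card < k + 1 := by exact_mod_cast h1
    have h4 : k < F.card + 1 := by exact_mod_cast h2
    omega
  -- By monotonicity the negative entries form an initial segment, and it has `k` elements.
  have hiff : lam i < 0 ↔ (i : ℕ) < k := by
    constructor
    · intro h
      have hsub : Finset.Iic i ⊆ F := fun j hj => by
        simp only [hF, Finset.mem_filter, Finset.mem_univ, true_and]
        exact (hmono (Finset.mem_Iic.1 hj)).trans_lt h
      have := Finset.card_le_card hsub
      rw [Fin.card_Iic, hcard] at this
      omega
    · intro h
      by_contra hn
      have hsub : F ⊆ Finset.Iio i := fun j hj => by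
        simp only [hF, Finset.mem_filter, Finset.mem_univ, true_and] at hj
        rw [Finset.mem_Iio]
        by_contra hji
        exact hn ((hmono (not_lt.1 hji)).trans_lt hj)
      have := Finset.card_le_card hsub
      rw [Fin.card_Iio, hcard] at this
      omega
  have := hs i
  simpa only [hiff] using this

end Sign

/-! ### The orthogonalization step -/

section Orth

open scoped InnerProductSpace

variable {d m k : ℕ} {c : EuclideanSpace ℝ (Fin d) → EuclideanSpace ℝ (Fin m)}
  {x xs : EuclideanSpace ℝ (Fin d)} {B S : EuclideanSpace ℝ (Fin d) →L[ℝ] EuclideanSpace ℝ (Fin d)}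

theorem IsTangentSymmetric.exists_eigenbasis (hB : IsTangentSymmetric c x B)
    (hx : IsRegularAt c x) : ∃ (lam : Fin (d - m) → ℝ)
      (b : OrthonormalBasis (Fin (d - m)) ℝ (tangentSpace c x)),
        IsOrderedEigenbasis c x B lam b := by
  set A : tangentSpace c x →ₗ[ℝ] tangentSpace c x :=
    B.toLinearMap.restrict (fun v _ => hB.2.1 v) with hA
  have hsym : A.IsSymmetric := by
    intro u v
    have := ContinuousLinearMap.isSelfAdjoint_iff_isSymmetric.1 hB.1
    exact this u v
  have hn := hx.finrank_tangentSpace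
  -- The spectral theorem lists the eigenvalues in decreasing order; `Fin.rev` reverses them.
  refine ⟨fun i => hsym.eigenvalues hn (Fin.rev i),
    (hsym.eigenvectorBasis hn).reindex Fin.revPerm, fun i j hij => ?_, fun i => ?_⟩
  · exact hsym.eigenvalues_antitone hn (Fin.rev_le_rev.2 hij)
  · have := congrArg Subtype.val (hsym.apply_eigenvectorBasis hn (Fin.rev i))
    simp only [OrthonormalBasis.reindex_apply, Fin.revPerm_symm, Fin.revPerm_apply]
    exact this

theorem isTangentSymmetric_diagOp {ι : Type*} [Fintype ι] (hx : IsRegularAt c x)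
    (b : OrthonormalBasis ι ℝ (tangentSpace c x)) (φ : ι → ℝ) :
    IsTangentSymmetric c x (diagOp b φ) := by
  refine ⟨ContinuousLinearMap.isSelfAdjoint_iff_isSymmetric.2 fun u v => inner_diagOp_left b φ u v,
    diagOp_mem b φ, ?_⟩
  rw [hx.tangentProj_eq_diagOp b, diagOp_comp, mul_one]

theorem IsTangentSymmetric.exists_isOrth (hB : IsTangentSymmetric c x B) (hx : IsRegularAt c x) :
    ∃ S, IsOrth c k x B S := by
  obtain ⟨lam, b, hb⟩ := hB.exists_eigenbasis hx
  refine ⟨diagOp b fun i => if (i : ℕ) < k then -1 else 1, ⟨lam, b, hb, fun i => ?_⟩,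
    (isTangentSymmetric_diagOp hx b _).2.2⟩
  rw [diagOp_apply_basis]
  split_ifs <;> simp

theorem IsOrth.eq_diagOp (h : IsOrth c k x B S) (hB : IsTangentSymmetric c x B)
    (hx : IsRegularAt c x) : ∃ (lam : Fin (d - m) → ℝ)
      (b : OrthonormalBasis (Fin (d - m)) ℝ (tangentSpace c x)), Monotone lam ∧ B = diagOp b lam ∧
        S = diagOp b fun i => if (i : ℕ) < k then -1 else 1 := by
  obtain ⟨⟨lam, b, ⟨hmono, hlam⟩, hS⟩, hSP⟩ := h
  have hP := hx.tangentProj_eq_diagOp b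
  refine ⟨lam, b, hmono, SaddleDynamics.eq_diagOp b (hP ▸ hB.2.2) hlam,
    SaddleDynamics.eq_diagOp b (hP ▸ hSP) fun i => ?_⟩
  rw [hS]
  split_ifs <;> simp

theorem diagOp_sign_sq {ι : Type*} [Fintype ι] (hx : IsRegularAt c x)
    (b : OrthonormalBasis ι ℝ (tangentSpace c x)) (p : ι → Prop) [DecidablePred p] :
    (diagOp b fun i => if p i then -1 else 1) * (diagOp b fun i => if p i then -1 else 1) =
      tangentProj c x := by
  rw [ContinuousLinearMap.mul_def, diagOp_comp, hx.tangentProj_eq_diagOp b]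
  congr 1
  ext i
  simp only [Pi.mul_apply, Pi.one_apply]
  split_ifs <;> norm_num

theorem diagOp_mul_normal {ι : Type*} [Fintype ι] (hx : IsRegularAt c x)
    (b : OrthonormalBasis ι ℝ (tangentSpace c x)) (φ : ι → ℝ) :
    diagOp b φ * (1 - tangentProj c x) = 0 ∧ (1 - tangentProj c x) * diagOp b φ = 0 := by
  rw [hx.tangentProj_eq_diagOp b, mul_sub, sub_mul, mul_one, one_mul, ContinuousLinearMap.mul_def,
    ContinuousLinearMap.mul_def, diagOp_comp, diagOp_comp]
  simp

theorem tangentProj_mul_self (hx : IsRegularAt c x) :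
    tangentProj c x * tangentProj c x = tangentProj c x := by
  ext1 u
  exact hx.tangentProj_idem u

theorem normalProj_mul_self (hx : IsRegularAt c x) :
    (1 - tangentProj c x) * (1 - tangentProj c x) = 1 - tangentProj c x := by
  rw [mul_sub, sub_mul, sub_mul, tangentProj_mul_self hx]
  simp

theorem add_normalProj_mul {ι : Type*} [Fintype ι] (hx : IsRegularAt c x)
    (b : OrthonormalBasis ι ℝ (tangentSpace c x)) (φ ψ : ι → ℝ) :
    (diagOp b φ + (1 - tangentProj c x)) * (diagOp b ψ + (1 - tangentProj c x)) =
      diagOp b φ * diagOp b ψ + (1 - tangentProj c x) := by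
  rw [add_mul, mul_add, mul_add, (diagOp_mul_normal hx b φ).1, (diagOp_mul_normal hx b ψ).2,
    normalProj_mul_self hx]
  simp

/-- Near a reflection, the orthogonalization step is a strictly differentiable function. -/
theorem exists_orth_eq (hc : ContDiff ℝ ∞ c) (hL : SatisfiesLICQ c) (hxs : xs ∈ feasibleSet c)
    (hk : k ≤ d - m) (b : OrthonormalBasis (Fin (d - m)) ℝ (tangentSpace c xs))
    {R S₀ : EuclideanSpace ℝ (Fin d) →L[ℝ] EuclideanSpace ℝ (Fin d)}
    (hR : R = diagOp b fun i => if (i : ℕ) < k then -1 else 1)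
    (hS₀ : S₀ = R + (1 - tangentProj c xs)) :
    ∃ (𝒮 : (EuclideanSpace ℝ (Fin d) →L[ℝ] EuclideanSpace ℝ (Fin d)) →
        EuclideanSpace ℝ (Fin d) →L[ℝ] EuclideanSpace ℝ (Fin d))
      (D : (EuclideanSpace ℝ (Fin d) →L[ℝ] EuclideanSpace ℝ (Fin d)) →L[ℝ]
        EuclideanSpace ℝ (Fin d) →L[ℝ] EuclideanSpace ℝ (Fin d)),
      HasStrictFDerivAt 𝒮 D S₀ ∧ 𝒮 S₀ = S₀ ∧ (∀ W, D W = (1 / 2 : ℝ) • (W - S₀ * W * S₀)) ∧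
      ∀ᶠ p in 𝓝 (xs, R), p.1 ∈ feasibleSet c → IsTangentSymmetric c p.1 p.2 →
        orth c k p.1 p.2 = 𝒮 (p.2 + (1 - tangentProj c p.1)) - (1 - tangentProj c p.1) ∧
        IsTangentSymmetric c p.1 (orth c k p.1 p.2) := by
  have hreg := hL.isRegularAt hxs
  have hRR : R * R = tangentProj c xs := by rw [hR]; exact diagOp_sign_sq hreg b _
  have hSS : S₀ * S₀ = 1 := by
    rw [hS₀, hR, add_normalProj_mul hreg, ← hR, hRR]
    simp
  obtain ⟨𝒮, D, hD, h𝒮0, hDW, hev⟩ := exists_local_sign hSS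
  refine ⟨𝒮, D, hD, h𝒮0, hDW, ?_⟩
  obtain ⟨r, hr, hball⟩ := Metric.mem_nhds_iff.1 hev
  -- `r / 4` controls the distance from `B` to `Orth B`, and the second term gives the bound
  -- required by `abs_sub_sign_le`; the `+ 1` covers `d - m = 0`.
  set η : ℝ := min (r / 4) (1 / (2 * ((d - m : ℕ) : ℝ) + 1)) with hη
  have hη0 : 0 < η := by positivity
  have hηn : η * (2 * ((d - m : ℕ) : ℝ)) ≤ 1 := by
    have h1 : η ≤ 1 / (2 * ((d - m : ℕ) : ℝ) + 1) := min_le_right _ _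
    rw [le_div_iff₀ (by positivity)] at h1
    nlinarith
  have hPc : ContinuousAt (fun p : EuclideanSpace ℝ (Fin d) ×
      (EuclideanSpace ℝ (Fin d) →L[ℝ] EuclideanSpace ℝ (Fin d)) => tangentProj c p.1) (xs, R) :=
    (hreg.contDiffAt_tangentProj hc).continuousAt.tendsto.comp (continuous_fst.tendsto (xs, R))
  have hBc : ContinuousAt (fun p : EuclideanSpace ℝ (Fin d) ×
      (EuclideanSpace ℝ (Fin d) →L[ℝ] EuclideanSpace ℝ (Fin d)) => p.2) (xs, R) := continuousAt_snd
  -- Near the reflection, `B² ≈ P` pushes the eigenvalues towards `±1`, and continuity of the trace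
  -- fixes how many are negative.
  have he1 : ∀ᶠ p in 𝓝 (xs, R), ‖p.2 * p.2 - tangentProj c p.1‖ < η := by
    have h1 := ((hBc.mul hBc).sub hPc).norm
    refine h1.eventually (gt_mem_nhds ?_)
    simpa [hRR] using hη0
  have he2 : ∀ᶠ p in 𝓝 (xs, R), ‖p.2 + (1 - tangentProj c p.1) - S₀‖ < r / 2 := by
    have h1 := ((hBc.add (continuousAt_const (y := 1) |>.sub hPc)).sub
      (continuousAt_const (y := S₀))).norm
    refine h1.eventually (gt_mem_nhds ?_)
    simpa [hS₀] using half_pos hr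
  have he3 : ∀ᶠ p in 𝓝 (xs, R), |LinearMap.trace ℝ (EuclideanSpace ℝ (Fin d)) p.2.toLinearMap -
      LinearMap.trace ℝ (EuclideanSpace ℝ (Fin d)) R.toLinearMap| < 1 / 2 := by
    have h0 : Continuous fun B : EuclideanSpace ℝ (Fin d) →L[ℝ] EuclideanSpace ℝ (Fin d) =>
        LinearMap.trace ℝ (EuclideanSpace ℝ (Fin d)) B.toLinearMap :=
      ((LinearMap.trace ℝ (EuclideanSpace ℝ (Fin d))) ∘ₗ
        ContinuousLinearMap.coeLM ℝ).continuous_of_finiteDimensional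
    have h1 := ((h0.continuousAt.comp hBc).sub (continuousAt_const
      (y := LinearMap.trace ℝ (EuclideanSpace ℝ (Fin d)) R.toLinearMap))).abs
    refine h1.eventually (gt_mem_nhds ?_)
    simp
  filter_upwards [he1, he2, he3] with p hp1 hp2 hp3 hpM hpS
  have hx := hL.isRegularAt hpM
  have hOrth : IsOrth c k p.1 p.2 (orth c k p.1 p.2) :=
    Classical.epsilon_spec (hpS.exists_isOrth (k := k) hx)
  obtain ⟨lam, b', hmono, hB, hS⟩ := hOrth.eq_diagOp hpS hx
  have hP := hx.tangentProj_eq_diagOp b'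
  have hlam : ∀ i, |lam i ^ 2 - 1| ≤ η := by
    intro i
    have h1 : p.2 * p.2 - tangentProj c p.1 = diagOp b' (lam * lam - 1) := by
      rw [hB, hP, ContinuousLinearMap.mul_def, diagOp_comp, ← diagOp_sub]
    have h2 : (p.2 * p.2 - tangentProj c p.1) (b' i : EuclideanSpace ℝ (Fin d)) =
        (lam i ^ 2 - 1) • (b' i : EuclideanSpace ℝ (Fin d)) := by
      rw [h1, diagOp_apply_basis]
      simp [sq]
    have h3 := (p.2 * p.2 - tangentProj c p.1).le_opNorm (b' i : EuclideanSpace ℝ (Fin d))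
    have h4 : ‖(b' i : EuclideanSpace ℝ (Fin d))‖ = 1 := (orthonormal_coe_basis b').1 i
    rw [h2, norm_smul, h4, mul_one, mul_one, Real.norm_eq_abs] at h3
    exact h3.trans hp1.le
  have hsum : |∑ i, lam i - ∑ i : Fin (d - m), (if (i : ℕ) < k then (-1 : ℝ) else 1)| < 1 / 2 := by
    rwa [hB, hR, trace_diagOp, trace_diagOp] at hp3
  have hdiff : ‖orth c k p.1 p.2 - p.2‖ ≤ η := by
    conv_lhs => rw [hS, hB, ← diagOp_sub]
    refine norm_diagOp_le b' hη0.le fun i => ?_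
    rw [Pi.sub_apply, abs_sub_comm]
    exact abs_sub_sign_le hk hmono hηn hlam hsum i
  refine ⟨?_, by rw [hS]; exact isTangentSymmetric_diagOp hx b' _⟩
  -- Adding the normal projector turns operators on the varying tangent space into operators on
  -- `ℝᵈ`, and `Orth B` into a true involution commuting with the extended `B`.
  rw [eq_sub_iff_add_eq]
  refine hball (a := (p.2 + (1 - tangentProj c p.1), orth c k p.1 p.2 + (1 - tangentProj c p.1)))
    ?_ ?_ ?_
  · have h5 : η ≤ r / 4 := min_le_left _ _
    rw [mem_ball_iff_norm, Prod.mk_sub_mk, Prod.norm_mk, max_lt_iff]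
    refine ⟨hp2.trans (half_lt_self hr), ?_⟩
    calc ‖orth c k p.1 p.2 + (1 - tangentProj c p.1) - S₀‖
        = ‖(orth c k p.1 p.2 - p.2) + (p.2 + (1 - tangentProj c p.1) - S₀)‖ := by congr 1; abel
      _ ≤ ‖orth c k p.1 p.2 - p.2‖ + ‖p.2 + (1 - tangentProj c p.1) - S₀‖ := norm_add_le _ _
      _ < r := by linarith
  · simp only
    rw [hS, add_normalProj_mul hx, diagOp_sign_sq hx b']
    simp
  · simp only
    conv_lhs => rw [hS, hB]
    conv_rhs => rw [hS, hB]
    rw [add_normalProj_mul hx, add_normalProj_mul hx, ContinuousLinearMap.mul_def,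
      ContinuousLinearMap.mul_def, diagOp_comp, diagOp_comp, mul_comm lam]

end Orth

/-! ### The Hessian and the reflection in a common eigenbasis -/

section Eigenstructure

open scoped InnerProductSpace

variable {d m k : ℕ} {f : EuclideanSpace ℝ (Fin d) → ℝ}
  {c : EuclideanSpace ℝ (Fin d) → EuclideanSpace ℝ (Fin m)} {xs : EuclideanSpace ℝ (Fin d)}

theorem geodesicDist_self {x : EuclideanSpace ℝ (Fin d)} (hx : x ∈ feasibleSet c) :
    geodesicDist c x x = 0 := by
  refine le_antisymm (sInf_le ⟨fun _ => x, contDiff_const, rfl, rfl, fun _ _ => hx, ?_⟩) bot_le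
  simp [curveLength]

theorem StrictSaddle.exists_eigenbasis {δ μ L : ℝ} (h : StrictSaddle f c k xs δ μ L)
    (hx : IsRegularAt c xs) (hxs : xs ∈ feasibleSet c) : ∃ (lam : Fin (d - m) → ℝ)
      (b : OrthonormalBasis (Fin (d - m)) ℝ (tangentSpace c xs)),
        riemHess f c xs = diagOp b lam ∧
        (∀ i : Fin (d - m), (i : ℕ) < k → -L ≤ lam i ∧ lam i ≤ -μ) ∧
        (∀ i : Fin (d - m), k ≤ (i : ℕ) → μ ≤ lam i ∧ lam i ≤ L) := by
  obtain ⟨hδ, -, -, hev⟩ := h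
  obtain ⟨lam, b, ⟨-, hb⟩, h1, h2⟩ := hev xs hxs (by simpa [geodesicDist_self hxs] using hδ)
  refine ⟨lam, b, eq_diagOp b ?_ hb, h1, h2⟩
  rw [← hx.tangentProj_eq_diagOp b]
  ext1 u
  simp [riemHess, hx.tangentProj_idem]

theorem Orthonormal.sum_inner_smul_of_mem_span {F ι : Type*} [NormedAddCommGroup F]
    [InnerProductSpace ℝ F] [Fintype ι] {v : ι → F} (hv : Orthonormal ℝ v) {u : F}
    (hu : u ∈ Submodule.span ℝ (Set.range v)) : ∑ j, ⟪v j, u⟫_ℝ • v j = u := by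
  classical
  induction hu using Submodule.span_induction with
  | mem x h =>
    obtain ⟨i, rfl⟩ := h
    simp [orthonormal_iff_ite.1 hv]
  | zero => simp
  | add x y _ _ hx hy =>
    simp only [inner_add_right, add_smul, Finset.sum_add_distrib, hx, hy]
  | smul a x _ hx =>
    simp only [inner_smul_right, mul_smul, ← Finset.smul_sum, hx]

/-- The reflection built from the eigenvectors with negative eigenvalues is diagonal in every
eigenbasis. -/
theorem householder_eq_diagOp {lam : Fin (d - m) → ℝ}
    {b : OrthonormalBasis (Fin (d - m)) ℝ (tangentSpace c xs)} (hk : k ≤ d - m)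
    (hx : IsRegularAt c xs) (hH : riemHess f c xs = diagOp b lam)
    (hpos : ∀ i : Fin (d - m), k ≤ (i : ℕ) → 0 < lam i)
    {v : Fin k → EuclideanSpace ℝ (Fin d)} (hv : Orthonormal ℝ v)
    (hvT : ∀ i, v i ∈ tangentSpace c xs)
    (hvE : ∀ i, ∃ l : ℝ, l < 0 ∧ riemHess f c xs (v i) = l • v i) :
    householder c xs v = diagOp b fun i => if (i : ℕ) < k then -1 else 1 := by
  have horth : ∀ (j : Fin k) (i : Fin (d - m)), k ≤ (i : ℕ) →
      ⟪v j, (b i : EuclideanSpace ℝ (Fin d))⟫_ℝ = 0 := by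
    intro j i hi
    obtain ⟨l, hl, hlv⟩ := hvE j
    have h1 := inner_diagOp b lam (v j) i
    rw [← hH, hlv, inner_smul_right] at h1
    have h2 : (lam i - l) * ⟪(b i : EuclideanSpace ℝ (Fin d)), v j⟫_ℝ = 0 := by linarith
    rw [real_inner_comm]
    exact (mul_eq_zero.1 h2).resolve_left (by linarith [hpos i hi])
  set w : Fin k → EuclideanSpace ℝ (Fin d) := fun j => b (Fin.castLE hk j) with hw
  have hwo : Orthonormal ℝ w :=
    (orthonormal_coe_basis b).comp _ (Fin.castLE_injective hk)
  -- Each `v j` is orthogonal to the eigenvectors with positive eigenvalue, so it lies in the span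
  -- of the first `k` basis vectors; both spans have dimension `k`.
  have hspan : Submodule.span ℝ (Set.range v) = Submodule.span ℝ (Set.range w) := by
    refine Submodule.eq_of_le_of_finrank_eq (Submodule.span_le.2 ?_) ?_
    · rintro _ ⟨j, rfl⟩
      have h1 := diagOp_one_of_mem b (hvT j)
      rw [diagOp_apply] at h1
      rw [← h1]
      refine Submodule.sum_mem _ fun i _ => ?_
      by_cases hi : (i : ℕ) < k
      · exact Submodule.smul_mem _ _ (Submodule.subset_span ⟨⟨i, hi⟩, rfl⟩)
      · rw [real_inner_comm, horth j i (not_lt.1 hi)]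
        simp
    · rw [finrank_span_eq_card hv.linearIndependent, finrank_span_eq_card hwo.linearIndependent]
  refine eq_diagOp b ?_ fun i => ?_
  · rw [← hx.tangentProj_eq_diagOp b]
    ext1 u
    have : ∀ j, ⟪v j, tangentProj c xs u⟫_ℝ = ⟪v j, u⟫_ℝ := fun j => by
      rw [← hx.inner_tangentProj_left, tangentProj_of_mem (hvT j)]
    simp [householder, hx.tangentProj_idem, this]
  · have h1 : householder c xs v (b i : EuclideanSpace ℝ (Fin d)) =
        (b i : EuclideanSpace ℝ (Fin d)) -
          (2 : ℝ) • ∑ j, ⟪v j, (b i : EuclideanSpace ℝ (Fin d))⟫_ℝ • v j := by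
      simp [householder, tangentProj_of_mem (b i).2]
    rw [h1]
    split_ifs with hi
    · rw [Orthonormal.sum_inner_smul_of_mem_span hv
        (hspan ▸ Submodule.subset_span ⟨⟨i, hi⟩, rfl⟩)]
      module
    · simp [horth _ i (not_lt.1 hi)]

end Eigenstructure

/-! ### Geodesic distance, gradient, Hessian and retraction near the saddle -/

section Regularity

variable {d m k : ℕ} {f : EuclideanSpace ℝ (Fin d) → ℝ}
  {c : EuclideanSpace ℝ (Fin d) → EuclideanSpace ℝ (Fin m)} {xs : EuclideanSpace ℝ (Fin d)}

/-- Projecting the segment from `x` to `xs` by `π` gives an admissible curve of length at most a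
constant times `‖xs - x‖`. The strict saddle condition thereby holds on an ambient neighbourhood. -/
theorem eventually_geodesicDist_lt (hc : ContDiff ℝ ∞ c) (h : IsRegularAt c xs)
    (hxs : xs ∈ feasibleSet c) {δ : ℝ} (hδ : 0 < δ) :
    ∀ᶠ x in 𝓝 xs, x ∈ feasibleSet c → geodesicDist c x xs < ENNReal.ofReal δ := by
  obtain ⟨π, hπ, -, hπ0, hπM, hπid⟩ := exists_nearby_projection hc h hxs
  have hπ1 : ContDiffAt ℝ 1 π xs := hπ.of_le (by norm_num)
  obtain ⟨K, hK⟩ : ∃ K, ∀ t ∈ Set.Icc (0 : ℝ) 1, ‖deriv Real.smoothTransition t‖ ≤ K :=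
    isCompact_Icc.exists_bound_of_continuousOn
      ((Real.smoothTransition.contDiff (n := 1)).continuous_deriv le_rfl).continuousOn
  have hK0 : 0 ≤ K := (norm_nonneg _).trans (hK 0 (by simp))
  set C := ‖fderiv ℝ π xs‖ + 1 with hC
  have hfd : ∀ᶠ z in 𝓝 xs, ‖fderiv ℝ π z‖ < C :=
    ((hπ1.fderiv_right (m := 0) (by norm_num)).continuousAt.norm).eventually
      (gt_mem_nhds (lt_add_one _))
  obtain ⟨r, hr, hball⟩ := Metric.eventually_nhds_iff_ball.1
    ((hπ1.eventually (by simp)).and (hπM.and hfd))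
  have hsmall : ∀ᶠ x in 𝓝 xs, C * (K * ‖xs - x‖) < δ := by
    have : ContinuousAt (fun x => C * (K * ‖xs - x‖)) xs := by fun_prop
    exact this.eventually (gt_mem_nhds (by simpa using hδ))
  filter_upwards [Metric.ball_mem_nhds xs hr, hπid, hsmall] with x hx hxid hxδ hxM
  -- The smooth transition keeps `σ t` on the segment for every real `t`, so that `π ∘ σ` is `C¹` on
  -- the whole line.
  set σ : ℝ → EuclideanSpace ℝ (Fin d) := fun t => x + Real.smoothTransition t • (xs - x) with hσ
  have hmem : ∀ t, σ t ∈ Metric.ball xs r := fun t =>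
    (convex_ball xs r).add_smul_sub_mem hx (Metric.mem_ball_self hr)
      ⟨Real.smoothTransition.nonneg t, Real.smoothTransition.le_one t⟩
  have hσd : ContDiff ℝ 1 σ :=
    contDiff_const.add (Real.smoothTransition.contDiff.smul contDiff_const)
  have hder : ∀ t, HasDerivAt (fun t => π (σ t))
      (fderiv ℝ π (σ t) (deriv Real.smoothTransition t • (xs - x))) t := by
    intro t
    have h1 : HasDerivAt σ (deriv Real.smoothTransition t • (xs - x)) t :=
      (((Real.smoothTransition.contDiff (n := 1)).differentiable one_ne_zero
        t).hasDerivAt.smul_const _).const_add _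
    exact (((hball _ (hmem t)).1.differentiableAt one_ne_zero).hasFDerivAt).comp_hasDerivAt t h1
  refine lt_of_le_of_lt (sInf_le ⟨fun t => π (σ t), ?_, ?_, ?_,
    fun t _ => (hball _ (hmem t)).2.1, rfl⟩) ?_
  · exact contDiff_iff_contDiffAt.2 fun t => (hball _ (hmem t)).1.comp t hσd.contDiffAt
  · simp [hσ, hxid hxM]
  · simp [hσ, hπ0]
  · refine lt_of_le_of_lt ?_ ((ENNReal.ofReal_lt_ofReal_iff hδ).2 hxδ)
    calc curveLength (fun t => π (σ t))
        ≤ ∫⁻ _ in Set.Icc (0 : ℝ) 1, ENNReal.ofReal (C * (K * ‖xs - x‖)) := by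
          refine MeasureTheory.setLIntegral_mono measurable_const fun t ht => ?_
          rw [(hder t).deriv, ← ofReal_norm]
          refine ENNReal.ofReal_le_ofReal ((ContinuousLinearMap.le_opNorm _ _).trans ?_)
          rw [norm_smul]
          have := (hball _ (hmem t)).2.2.le
          have := hK t ht
          gcongr
      _ = ENNReal.ofReal (C * (K * ‖xs - x‖)) := by simp

theorem IsRegularAt.contDiffAt_riemGrad (h : IsRegularAt c xs) (hc : ContDiff ℝ ∞ c)
    (hf : ContDiff ℝ ∞ f) : ContDiffAt ℝ ∞ (riemGrad f c) xs := by
  refine (h.contDiffAt_tangentProj hc).clm_apply ?_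
  exact ((InnerProductSpace.toDual ℝ (EuclideanSpace ℝ (Fin d))).symm.contDiff.comp
    (hf.fderiv_right (m := ∞) (by simp))).contDiffAt

theorem IsRegularAt.contDiffAt_riemHess (h : IsRegularAt c xs) (hc : ContDiff ℝ ∞ c)
    (hf : ContDiff ℝ ∞ f) : ContDiffAt ℝ ∞ (riemHess f c) xs :=
  (h.contDiffAt_tangentProj hc).clm_comp
    (((h.contDiffAt_riemGrad hc hf).fderiv_right (m := ∞) (by simp)).clm_comp
      (h.contDiffAt_tangentProj hc))

/-- Self-adjointness is read off from the orthonormal eigenbasis that the strict saddle condition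
provides, without a symmetry argument for second covariant derivatives. -/
theorem StrictSaddle.eventually_isTangentSymmetric {δ μ L : ℝ}
    (h : StrictSaddle f c k xs δ μ L) (hc : ContDiff ℝ ∞ c) (hL : SatisfiesLICQ c)
    (hxs : xs ∈ feasibleSet c) :
    ∀ᶠ x in 𝓝 xs, x ∈ feasibleSet c → IsTangentSymmetric c x (riemHess f c x) := by
  filter_upwards [eventually_geodesicDist_lt hc (hL.isRegularAt hxs) hxs h.1] with x hx hxM
  have hreg := hL.isRegularAt hxM
  obtain ⟨lam, b, ⟨-, hb⟩, -⟩ := h.2.2.2 x hxM (hx hxM)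
  have : riemHess f c x = diagOp b lam := by
    refine eq_diagOp b ?_ hb
    rw [← hreg.tangentProj_eq_diagOp b]
    ext1 u
    simp [riemHess, hreg.tangentProj_idem]
  rw [this]
  exact isTangentSymmetric_diagOp hreg b lam

/-- A retraction has a strictly differentiable extension from the tangent bundle to the ambient
space. -/
theorem IsRetraction.exists_extension
    {Ret : EuclideanSpace ℝ (Fin d) → EuclideanSpace ℝ (Fin d) → EuclideanSpace ℝ (Fin d)}
    (hRet : IsRetraction c Ret) (hc : ContDiff ℝ ∞ c) (hL : SatisfiesLICQ c)
    (hxs : xs ∈ feasibleSet c) :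
    ∃ ϱ : EuclideanSpace ℝ (Fin d) × EuclideanSpace ℝ (Fin d) → EuclideanSpace ℝ (Fin d),
      HasStrictFDerivAt ϱ (tangentProj c xs ∘L
        (ContinuousLinearMap.fst ℝ _ _ + ContinuousLinearMap.snd ℝ _ _)) (xs, 0) ∧
      ϱ (xs, 0) = xs ∧
      ∀ᶠ p in 𝓝 (xs, 0), p.1 ∈ feasibleSet c → p.2 ∈ tangentSpace c p.1 →
        Ret p.1 p.2 = ϱ p := by
  have hreg := hL.isRegularAt hxs
  obtain ⟨π, hπ, hπd, hπ0, hπM, hπid⟩ := exists_nearby_projection hc hreg hxs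
  -- `G` maps a neighbourhood of `(xs, 0)` into the tangent bundle and fixes nearby points of it, so
  -- `Ret ∘ G` extends `Ret`. Its derivative is that of `π` along the base and is given by the
  -- retraction property along the fibre.
  set G : EuclideanSpace ℝ (Fin d) × EuclideanSpace ℝ (Fin d) →
    EuclideanSpace ℝ (Fin d) × EuclideanSpace ℝ (Fin d) :=
      fun p => (π p.1, tangentProj c (π p.1) p.2) with hG
  set F : EuclideanSpace ℝ (Fin d) × EuclideanSpace ℝ (Fin d) → EuclideanSpace ℝ (Fin d) :=
    fun p => Ret p.1 p.2 with hF
  have hfst : Filter.Tendsto (Prod.fst : EuclideanSpace ℝ (Fin d) × EuclideanSpace ℝ (Fin d) → _)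
      (𝓝 (xs, 0)) (𝓝 xs) := continuous_fst.tendsto (xs, 0)
  have hG0 : G (xs, 0) = (xs, 0) := by simp [hG, hπ0]
  have hGd : ContDiffAt ℝ ∞ G (xs, 0) := by
    have h1 : ContDiffAt ℝ ∞ (fun p : EuclideanSpace ℝ (Fin d) × EuclideanSpace ℝ (Fin d) =>
        π p.1) (xs, 0) := ContDiffAt.comp (xs, 0) hπ contDiffAt_fst
    refine h1.prodMk (ContDiffAt.clm_apply ?_ contDiffAt_snd)
    exact ContDiffAt.comp (xs, 0) (g := tangentProj c)
      (by rw [hπ0]; exact hreg.contDiffAt_tangentProj hc) h1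
  have hcomp : ContDiffAt ℝ ∞ (F ∘ G) (xs, 0) := by
    have hmem : ∀ᶠ p in 𝓝 (xs, 0), G p ∈ {p : EuclideanSpace ℝ (Fin d) ×
        EuclideanSpace ℝ (Fin d) | p.1 ∈ feasibleSet c ∧ p.2 ∈ tangentSpace c p.1} := by
      filter_upwards [hfst.eventually hπM] with p hp
      exact ⟨hp, (hL.isRegularAt hp).tangentProj_mem _⟩
    have hFw := hRet.smooth (xs, 0) ⟨hxs, Submodule.zero_mem _⟩
    rw [← hG0] at hFw
    exact (hFw.comp (xs, 0) hGd.contDiffWithinAt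
      (Set.mapsTo_preimage _ _)).contDiffAt hmem
  refine ⟨F ∘ G, ?_, by simp [hF, hG0, hRet.zero xs hxs], ?_⟩
  · have hD := hcomp.hasStrictFDerivAt (by simp)
    set D := fderiv ℝ (F ∘ G) (xs, 0)
    have h1 : ∀ u, D (u, 0) = tangentProj c xs u := by
      intro u
      have h2 : HasFDerivAt (fun x => (F ∘ G) (x, 0)) (D ∘L ContinuousLinearMap.inl ℝ _ _) xs :=
        HasFDerivAt.comp (g := F ∘ G) (f := fun x => (x, (0 : EuclideanSpace ℝ (Fin d)))) xs
          hD.hasFDerivAt (hasFDerivAt_prodMk_left xs 0)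
      have h3 : (fun x => (F ∘ G) (x, 0)) =ᶠ[𝓝 xs] π := by
        filter_upwards [hπM] with x hx
        simp [hF, hG, hRet.zero _ hx]
      have := (h2.congr_of_eventuallyEq h3.symm).unique hπd
      rw [← this]
      rfl
    have h2 : ∀ u, D (0, u) = tangentProj c xs u := by
      intro u
      have h3 : HasDerivAt (fun t : ℝ => (xs, t • u)) ((0 : EuclideanSpace ℝ (Fin d)), u) 0 :=
        (hasDerivAt_const _ _).prodMk (by simpa using (hasDerivAt_id (0 : ℝ)).smul_const u)
      have h4 : HasFDerivAt (F ∘ G) D (xs, (0 : ℝ) • u) := by rw [zero_smul]; exact hD.hasFDerivAt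
      have h5 := h4.comp_hasDerivAt (0 : ℝ) h3
      have h6 := hRet.hasDeriv xs hxs _ (hreg.tangentProj_mem u)
      refine h5.unique (h6.congr_of_eventuallyEq (.of_forall fun t => ?_))
      simp [hF, hG, hπ0]
    have heq : tangentProj c xs ∘L
        (ContinuousLinearMap.fst ℝ _ _ + ContinuousLinearMap.snd ℝ _ _) = D := by
      refine ContinuousLinearMap.ext fun p => ?_
      have := map_add D (p.1, 0) (0, p.2)
      rw [Prod.mk_add_mk, add_zero, zero_add, h1, h2] at this
      simp [this]
    rw [heq]
    exact hD
  · filter_upwards [hfst.eventually hπid] with p hp hp1 hp2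
    simp [hF, hG, hp hp1, tangentProj_of_mem hp2]

end Regularity

/-! ### Linearization of the reflection update -/

section ReflectionUpdate

open scoped InnerProductSpace

/-- The compression `P B P` equals `M W P + P W M` with `M = P / 2 - t K`, so its norm is at most `κ
‖W‖`. The term with `S` compresses to `R (P B P) R`, which is no larger, and the half difference
obeys the same bound. No symmetry of `W` is used. -/
theorem norm_reflection_deriv_le {A : Type*} [NormedRing A] [NormedAlgebra ℝ A]
    {P R S K M : A} {t κ : ℝ} (hPS : P * S = R) (hSP : S * P = R) (hRP : R * P = R)
    (hPR : P * R = R) (hPK : P * K = K) (hKP : K * P = K) (hP : ‖P‖ ≤ 1) (hR : ‖R‖ ≤ 1)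
    (hM : M = (1 / 2 : ℝ) • P - t • K) (hMκ : ‖M‖ ≤ κ / 2) (W : A) :
    ‖P * ((1 / 2 : ℝ) • ((W - t • (W * K + K * W)) - S * (W - t • (W * K + K * W)) * S)) * P‖ ≤
      κ * ‖W‖ := by
  set B := W - t • (W * K + K * W) with hB
  have h1 : P * B * P = M * W * P + P * W * M := by
    rw [hB, hM]
    simp only [mul_sub, sub_mul, mul_add, add_mul, mul_smul_comm, smul_mul_assoc, smul_add]
    have e1 : P * (W * K) * P = P * W * K := by rw [mul_assoc, mul_assoc, hKP, mul_assoc]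
    have e2 : P * (K * W) * P = K * W * P := by rw [← mul_assoc, hPK]
    rw [e1, e2]
    module
  have h2 : P * (S * B * S) * P = R * (P * B * P) * R := by
    calc P * (S * B * S) * P = (P * S) * B * (S * P) := by noncomm_ring
      _ = (R * P) * B * (P * R) := by rw [hPS, hSP, hRP, hPR]
      _ = R * (P * B * P) * R := by noncomm_ring
  have hκ : 0 ≤ κ := by linarith [norm_nonneg M]
  have hPBP : ‖P * B * P‖ ≤ κ * ‖W‖ := by
    have e1 : ‖M * W * P‖ ≤ κ / 2 * ‖W‖ * 1 :=
      (norm_mul_le _ _).trans (by gcongr; exact (norm_mul_le _ _).trans (by gcongr))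
    have e2 : ‖P * W * M‖ ≤ 1 * ‖W‖ * (κ / 2) :=
      (norm_mul_le _ _).trans (by gcongr; exact (norm_mul_le _ _).trans (by gcongr))
    rw [h1]
    refine (norm_add_le _ _).trans ?_
    linarith
  have hRR : ‖R * (P * B * P) * R‖ ≤ 1 * (κ * ‖W‖) * 1 :=
    (norm_mul_le _ _).trans (by gcongr; exact (norm_mul_le _ _).trans (by gcongr))
  have h3 : P * ((1 / 2 : ℝ) • (B - S * B * S)) * P =
      (1 / 2 : ℝ) • (P * B * P - R * (P * B * P) * R) := by
    rw [← h2, mul_smul_comm, smul_mul_assoc, mul_sub, sub_mul]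
  rw [h3, norm_smul]
  have := norm_sub_le (P * B * P) (R * (P * B * P) * R)
  rw [Real.norm_eq_abs, abs_of_pos (by norm_num : (0 : ℝ) < 1 / 2)]
  linarith

variable {d m k : ℕ} {f : EuclideanSpace ℝ (Fin d) → ℝ}
  {c : EuclideanSpace ℝ (Fin d) → EuclideanSpace ℝ (Fin m)} {xs : EuclideanSpace ℝ (Fin d)}

theorem IsTangentSymmetric.euler {x : EuclideanSpace ℝ (Fin d)}
    {R H : EuclideanSpace ℝ (Fin d) →L[ℝ] EuclideanSpace ℝ (Fin d)} (hR : IsTangentSymmetric c x R)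
    (hH : IsTangentSymmetric c x H) (t : ℝ) :
    IsTangentSymmetric c x (R + t • (H - R ∘L H ∘L R)) := by
  refine ⟨?_, fun u => ?_, ?_⟩
  · have h1 : IsSelfAdjoint (R * (H * R)) := by
      simp [IsSelfAdjoint, hR.1.star_eq, hH.1.star_eq, mul_assoc]
    exact IsSelfAdjoint.add (R := EuclideanSpace ℝ (Fin d) →L[ℝ] EuclideanSpace ℝ (Fin d)) hR.1
      (IsSelfAdjoint.smul (A := EuclideanSpace ℝ (Fin d) →L[ℝ] EuclideanSpace ℝ (Fin d))
        (IsSelfAdjoint.all t)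
        (IsSelfAdjoint.sub (R := EuclideanSpace ℝ (Fin d) →L[ℝ] EuclideanSpace ℝ (Fin d)) hH.1 h1))
  · exact add_mem (hR.2.1 u) (Submodule.smul_mem _ _ (sub_mem (hH.2.1 u) (hR.2.1 _)))
  · rw [ContinuousLinearMap.add_comp, ContinuousLinearMap.smul_comp, ContinuousLinearMap.sub_comp,
      ContinuousLinearMap.comp_assoc, ContinuousLinearMap.comp_assoc, hR.2.2, hH.2.2]

theorem isTangentSymmetric_conj {y : EuclideanSpace ℝ (Fin d)}
    {S T T' : EuclideanSpace ℝ (Fin d) →L[ℝ] EuclideanSpace ℝ (Fin d)} (hS : IsSelfAdjoint S)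
    (hadj : ∀ u v, ⟪T u, v⟫_ℝ = ⟪u, T' v⟫_ℝ) (hmem : ∀ u, T u ∈ tangentSpace c y)
    (hproj : T' ∘L tangentProj c y = T') : IsTangentSymmetric c y (T * S * T') := by
  refine ⟨ContinuousLinearMap.isSelfAdjoint_iff_isSymmetric.2 fun u v => ?_, fun u => hmem _, ?_⟩
  · change ⟪T (S (T' u)), v⟫_ℝ = ⟪u, T (S (T' v))⟫_ℝ
    rw [hadj, real_inner_comm _ u, hadj]
    exact (ContinuousLinearMap.isSelfAdjoint_iff_isSymmetric.1 hS _ _).trans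
      (real_inner_comm _ _)
  · rw [ContinuousLinearMap.mul_def, ContinuousLinearMap.comp_assoc, hproj]

set_option maxHeartbeats 800000 in
/-- Near the saddle point, the update of the reflection is strictly differentiable and a
contraction in the reflection variable. -/
theorem exists_reflectionUpdate_eq (hc : ContDiff ℝ ∞ c) (hf : ContDiff ℝ ∞ f)
    (hL : SatisfiesLICQ c) (hxs : xs ∈ feasibleSet c) (hk : k ≤ d - m)
    {b : OrthonormalBasis (Fin (d - m)) ℝ (tangentSpace c xs)} {lam : Fin (d - m) → ℝ}
    (hH : riemHess f c xs = diagOp b lam)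
    (hneg : ∀ i : Fin (d - m), (i : ℕ) < k → lam i < 0)
    (hpos : ∀ i : Fin (d - m), k ≤ (i : ℕ) → 0 < lam i)
    (hsymm : ∀ᶠ x in 𝓝 xs, x ∈ feasibleSet c → IsTangentSymmetric c x (riemHess f c x))
    {R : EuclideanSpace ℝ (Fin d) →L[ℝ] EuclideanSpace ℝ (Fin d)}
    (hR : R = diagOp b fun i => if (i : ℕ) < k then -1 else 1) {t κ : ℝ} (hκ0 : 0 ≤ κ)
    (hκ : ∀ i, |1 - 2 * t * (|lam i|)| ≤ κ) :
    ∃ (𝓡 : EuclideanSpace ℝ (Fin d) × EuclideanSpace ℝ (Fin d) ×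
          (EuclideanSpace ℝ (Fin d) →L[ℝ] EuclideanSpace ℝ (Fin d)) →
        EuclideanSpace ℝ (Fin d) →L[ℝ] EuclideanSpace ℝ (Fin d))
      (J : EuclideanSpace ℝ (Fin d) × EuclideanSpace ℝ (Fin d) ×
          (EuclideanSpace ℝ (Fin d) →L[ℝ] EuclideanSpace ℝ (Fin d)) →L[ℝ]
        EuclideanSpace ℝ (Fin d) →L[ℝ] EuclideanSpace ℝ (Fin d)),
      HasStrictFDerivAt 𝓡 J (xs, xs, R) ∧ 𝓡 (xs, xs, R) = R ∧
      (∀ W, ‖J (0, 0, W)‖ ≤ κ * ‖W‖) ∧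
      ∀ᶠ p in 𝓝 (xs, xs, R), p.1 ∈ feasibleSet c → p.2.1 ∈ feasibleSet c →
        IsTangentSymmetric c p.1 p.2.2 →
          reflectionUpdate f c k t p.1 p.2.1 p.2.2 = 𝓡 p ∧
          IsTangentSymmetric c p.2.1 (reflectionUpdate f c k t p.1 p.2.1 p.2.2) := by
  have hreg := hL.isRegularAt hxs
  set P := tangentProj c xs with hP
  set H := riemHess f c xs with hHdef
  set K := diagOp b (fun i => |lam i|) with hK
  set S₀ := R + (1 - P) with hS₀
  have hPb : P = diagOp b 1 := hreg.tangentProj_eq_diagOp b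
  have hcomp : ∀ φ ψ : Fin (d - m) → ℝ, diagOp b φ * diagOp b ψ = diagOp b (φ * ψ) :=
    fun φ ψ => diagOp_comp b φ ψ
  have hRH : R * H = K := by
    rw [hR, hH, hcomp, hK]
    congr 1
    ext i
    simp only [Pi.mul_apply]
    split_ifs with hi
    · rw [abs_of_neg (hneg i hi)]; ring
    · rw [abs_of_pos (hpos i (not_lt.1 hi))]; ring
  have hHR : H * R = K := by rw [← hRH, hR, hH, hcomp, hcomp, mul_comm]
  have hRR : R * R = P := by rw [hR]; exact diagOp_sign_sq hreg b _
  -- Hence the Euler step fixes `R`.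
  have hRHR : R * H * R = H := by
    rw [mul_assoc, hHR, ← hRH, ← mul_assoc, hRR, hPb, hH, hcomp, one_mul]
  have hPP : P * P = P := tangentProj_mul_self hreg
  have hPR : P * R = R := by rw [hR, hPb, hcomp, one_mul]
  have hRP : R * P = R := by rw [hR, hPb, hcomp, mul_one]
  have hPK : P * K = K := by rw [hPb, hK, hcomp, one_mul]
  have hKP : K * P = K := by rw [hPb, hK, hcomp, mul_one]
  have hPS : P * S₀ = R := by rw [hS₀, mul_add, mul_sub, hPP, hPR]; simp
  have hSP : S₀ * P = R := by rw [hS₀, add_mul, sub_mul, hPP, hRP]; simp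
  obtain ⟨𝒯, DT, hT, hT0, hTev⟩ := exists_parallelTranslation_eq hc hL hxs
  obtain ⟨𝒮, DS, hS, hS0, hDS, hSev⟩ := exists_orth_eq hc hL hxs hk b hR hS₀
  set 𝓑 : EuclideanSpace ℝ (Fin d) ×
      (EuclideanSpace ℝ (Fin d) →L[ℝ] EuclideanSpace ℝ (Fin d)) →
      EuclideanSpace ℝ (Fin d) →L[ℝ] EuclideanSpace ℝ (Fin d) :=
    fun p => p.2 + t • (riemHess f c p.1 - p.2 * riemHess f c p.1 * p.2) with h𝓑
  have h𝓑0 : 𝓑 (xs, R) = R := by simp [h𝓑, ← hHdef, hRHR]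
  set 𝓡 : EuclideanSpace ℝ (Fin d) × EuclideanSpace ℝ (Fin d) ×
      (EuclideanSpace ℝ (Fin d) →L[ℝ] EuclideanSpace ℝ (Fin d)) →
      EuclideanSpace ℝ (Fin d) →L[ℝ] EuclideanSpace ℝ (Fin d) :=
    fun p => 𝒯 (p.1, p.2.1) *
      (𝒮 (𝓑 (p.1, p.2.2) + (1 - tangentProj c p.1)) - (1 - tangentProj c p.1)) *
      𝒯 (p.2.1, p.1) with h𝓡
  have hdiff : ∃ J : EuclideanSpace ℝ (Fin d) × EuclideanSpace ℝ (Fin d) ×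
          (EuclideanSpace ℝ (Fin d) →L[ℝ] EuclideanSpace ℝ (Fin d)) →L[ℝ]
        EuclideanSpace ℝ (Fin d) →L[ℝ] EuclideanSpace ℝ (Fin d),
      HasStrictFDerivAt 𝓡 J (xs, xs, R) := by
    have hx : HasStrictFDerivAt (fun p : EuclideanSpace ℝ (Fin d) × EuclideanSpace ℝ (Fin d) ×
        (EuclideanSpace ℝ (Fin d) →L[ℝ] EuclideanSpace ℝ (Fin d)) => p.1)
        (ContinuousLinearMap.fst ℝ _ _) (xs, xs, R) := hasStrictFDerivAt_fst
    have hy : HasStrictFDerivAt (fun p : EuclideanSpace ℝ (Fin d) × EuclideanSpace ℝ (Fin d) ×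
        (EuclideanSpace ℝ (Fin d) →L[ℝ] EuclideanSpace ℝ (Fin d)) => p.2.1)
        (ContinuousLinearMap.fst ℝ _ _ ∘L ContinuousLinearMap.snd ℝ _ _) (xs, xs, R) :=
      (hasStrictFDerivAt_fst (p := (xs, R))).comp (xs, xs, R) hasStrictFDerivAt_snd
    have hW : HasStrictFDerivAt (fun p : EuclideanSpace ℝ (Fin d) × EuclideanSpace ℝ (Fin d) ×
        (EuclideanSpace ℝ (Fin d) →L[ℝ] EuclideanSpace ℝ (Fin d)) => p.2.2)
        (ContinuousLinearMap.snd ℝ _ _ ∘L ContinuousLinearMap.snd ℝ _ _) (xs, xs, R) :=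
      (hasStrictFDerivAt_snd (p := (xs, R))).comp (xs, xs, R) hasStrictFDerivAt_snd
    have hHx := HasStrictFDerivAt.comp (g := riemHess f c) (xs, xs, R)
      ((hreg.contDiffAt_riemHess hc hf).hasStrictFDerivAt (by simp)) hx
    have hPx := (HasStrictFDerivAt.comp (g := tangentProj c) (xs, xs, R)
      ((hreg.contDiffAt_tangentProj hc).hasStrictFDerivAt (by simp)) hx).const_sub 1
    have hB := (hW.add ((hHx.sub ((hW.mul' hHx).mul' hW)).const_smul t)).add hPx
    have hSx := HasStrictFDerivAt.comp (g := 𝒮) (xs, xs, R) (by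
      change HasStrictFDerivAt 𝒮 DS (𝓑 (xs, R) + (1 - P))
      rw [h𝓑0]
      exact hS) hB
    have hT1 := HasStrictFDerivAt.comp (g := 𝒯) (xs, xs, R) hT (hx.prodMk hy)
    have hT2 := HasStrictFDerivAt.comp (g := 𝒯) (xs, xs, R) hT (hy.prodMk hx)
    exact ⟨_, (hT1.mul' (hSx.sub hPx)).mul' hT2⟩
  obtain ⟨J, hJ⟩ := hdiff
  refine ⟨𝓡, J, hJ, ?_, fun W => ?_, ?_⟩
  · simp only [h𝓡, h𝓑0, ← hP, hT0]
    rw [← hS₀, hS0, hS₀, add_sub_cancel_right, hPR, hRP]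
  -- `J (0, 0, W)` is the derivative along `R + s • W` with both positions at `xs`, where the two
  -- transports equal `P`. The Euler step contributes `W - t (W K + K W)`, because `R H = H R = K`.
  · have h1 : HasDerivAt (fun s : ℝ => (xs, xs, R + s • W))
        ((0 : EuclideanSpace ℝ (Fin d)), (0 : EuclideanSpace ℝ (Fin d)), W) 0 :=
      (hasDerivAt_const _ _).prodMk ((hasDerivAt_const _ _).prodMk
        (by simpa using ((hasDerivAt_id (0 : ℝ)).smul_const W).const_add R))
    have h0 : R + (0 : ℝ) • W = R := by ext; simp
    have h2 : HasFDerivAt 𝓡 J (xs, xs, R + (0 : ℝ) • W) := by rw [h0]; exact hJ.hasFDerivAt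
    have h3 := h2.comp_hasDerivAt (0 : ℝ) h1
    have h4 : HasDerivAt (fun s : ℝ => R + s • W) W 0 := by
      simpa using ((hasDerivAt_id (0 : ℝ)).smul_const W).const_add R
    have h5 : HasDerivAt (fun s : ℝ => 𝓑 (xs, R + s • W) + (1 - P))
        (W - t • (W * K + K * W)) 0 := by
      have h6 := ((h4.add ((((h4.mul_const H).mul h4).const_sub H).const_smul t)).add_const (1 - P))
      refine h6.congr_deriv ?_
      rw [h0, hRH, mul_assoc, hHR, smul_neg, sub_eq_add_neg]
    have h6 : HasFDerivAt 𝒮 DS (𝓑 (xs, R + (0 : ℝ) • W) + (1 - P)) := by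
      rw [h0, h𝓑0, ← hS₀]; exact hS.hasFDerivAt
    have h7 := (((h6.comp_hasDerivAt (0 : ℝ) h5).sub_const (1 - P)).const_mul P).mul_const P
    have h8 : J (0, 0, W) = P * DS (W - t • (W * K + K * W)) * P := by
      refine h3.unique (h7.congr_of_eventuallyEq (.of_forall fun s => ?_))
      simp [h𝓡, hT0, ← hP]
    rw [h8, hDS]
    refine norm_reflection_deriv_le hPS hSP hRP hPR hPK hKP ?_ ?_ rfl ?_ W
    · rw [hPb]; exact norm_diagOp_le b zero_le_one (by simp)
    · rw [hR]; exact norm_diagOp_le b zero_le_one fun i => by split_ifs <;> simp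
    · rw [hPb, hK, ← diagOp_smul, ← diagOp_smul, ← diagOp_sub]
      refine norm_diagOp_le b (by positivity) fun i => ?_
      have := hκ i
      rw [show ((1 / 2 : ℝ) • (1 : Fin (d - m) → ℝ) - t • fun i => |lam i|) i =
        (1 / 2 : ℝ) * (1 - 2 * t * |lam i|) by simp; ring, abs_mul]
      rw [abs_of_pos (by norm_num : (0 : ℝ) < 1 / 2)]
      linarith
  · have hx : Filter.Tendsto (fun p : EuclideanSpace ℝ (Fin d) × EuclideanSpace ℝ (Fin d) ×
        (EuclideanSpace ℝ (Fin d) →L[ℝ] EuclideanSpace ℝ (Fin d)) => p.1) (𝓝 (xs, xs, R)) (𝓝 xs) :=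
      continuous_fst.tendsto (xs, xs, R)
    have hxy : Filter.Tendsto (fun p : EuclideanSpace ℝ (Fin d) × EuclideanSpace ℝ (Fin d) ×
        (EuclideanSpace ℝ (Fin d) →L[ℝ] EuclideanSpace ℝ (Fin d)) => (p.1, p.2.1))
        (𝓝 (xs, xs, R)) (𝓝 (xs, xs)) :=
      (continuous_fst.prodMk (continuous_fst.comp continuous_snd)).tendsto (xs, xs, R)
    have hB : ContinuousAt (fun p : EuclideanSpace ℝ (Fin d) × EuclideanSpace ℝ (Fin d) ×
        (EuclideanSpace ℝ (Fin d) →L[ℝ] EuclideanSpace ℝ (Fin d)) => (p.1, 𝓑 (p.1, p.2.2)))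
        (xs, xs, R) := by
      have hHx : ContinuousAt (fun p : EuclideanSpace ℝ (Fin d) × EuclideanSpace ℝ (Fin d) ×
          (EuclideanSpace ℝ (Fin d) →L[ℝ] EuclideanSpace ℝ (Fin d)) => riemHess f c p.1)
          (xs, xs, R) :=
        (hreg.contDiffAt_riemHess hc hf).continuousAt.tendsto.comp hx
      have hW : ContinuousAt (fun p : EuclideanSpace ℝ (Fin d) × EuclideanSpace ℝ (Fin d) ×
          (EuclideanSpace ℝ (Fin d) →L[ℝ] EuclideanSpace ℝ (Fin d)) => p.2.2)
          (xs, xs, R) := by fun_prop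
      exact ContinuousAt.prodMk hx (hW.add (((hHx.sub ((hW.mul hHx).mul hW))).const_smul t))
    have hB' := hB.tendsto
    simp only [h𝓑0] at hB'
    filter_upwards [hxy.eventually hTev, hB'.eventually hSev, hx.eventually hsymm]
      with p hp1 hp2 hp3 hx hy hW
    obtain ⟨e1, e2, hadj, hmem, hproj⟩ := hp1 hx hy
    obtain ⟨e3, hO⟩ := hp2 hx (hW.euler (hp3 hx) t)
    have heq : reflectionUpdate f c k t p.1 p.2.1 p.2.2 =
        𝒯 (p.1, p.2.1) * orth c k p.1 (𝓑 (p.1, p.2.2)) * 𝒯 (p.2.1, p.1) := by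
      rw [reflectionUpdate, e1, e2]
      rfl
    refine ⟨by rw [heq, e3], ?_⟩
    rw [heq]
    exact isTangentSymmetric_conj hO.1 hadj hmem hproj

end ReflectionUpdate

/-! ### Block triangular linearizations -/

section BlockTriangular

/-- A map whose linearization is block triangular, with contractive diagonal blocks, is locally
contractive and asymptotically linearly stable. -/
theorem contractive_and_stable_of_blockTriangular {X F Y : Type*} [NormedAddCommGroup X]
    [NormedSpace ℝ X] [FiniteDimensional ℝ X] [NormedAddCommGroup F] [NormedSpace ℝ F]
    [NormedAddCommGroup Y] [NormedSpace ℝ Y] {S : Set X} {Φ Ψ : X → X} {p : X} {J : X →L[ℝ] X}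
    (hp : p ∈ S) (hΦp : Φ p = p) (hΨ : HasStrictFDerivAt Ψ J p)
    (heq : ∀ᶠ q in 𝓝[S] p, Φ q = Ψ q) (hmaps : ∀ᶠ q in 𝓝[S] p, Φ q ∈ S)
    (T : X →L[ℝ] F) (Q : X →L[ℝ] Y) (hTQ : ∀ v, T v = 0 → Q v = 0 → v = 0) {A ρ κ : ℝ}
    (hA : 0 ≤ A) (hρ : 0 ≤ ρ) (hρ1 : ρ < 1) (hκ1 : κ < 1)
    (hT : ∀ v, ‖T (J v)‖ ≤ ρ * ‖T v‖) (hQ : ∀ v, ‖Q (J v)‖ ≤ A * ‖T v‖ + κ * ‖Q v‖) :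
    IsLocallyContractiveAt S Φ p ∧ IsLinearlyStableAt S Φ p := by
  -- In the norm `C ‖T v‖ + ‖Q v‖`, a large weight absorbs the coupling: `A ≤ C (1 - ρ) / 2`, so the
  -- `T` part contracts at rate `(1 + ρ) / 2`.
  set C : ℝ := 2 * A / (1 - ρ) + 1 with hC
  have h1ρ : 0 < 1 - ρ := by linarith
  have hC1 : 1 ≤ C := le_add_of_nonneg_left (by positivity)
  have hCA : A + C * ρ ≤ C * ((1 + ρ) / 2) := by
    have : C * (1 - ρ) = 2 * A + (1 - ρ) := by rw [hC]; field_simp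
    nlinarith
  set N : Seminorm ℝ X := C.toNNReal • (normSeminorm ℝ F).comp T.toLinearMap +
    (normSeminorm ℝ Y).comp Q.toLinearMap with hN
  have hNv : ∀ v, N v = C * ‖T v‖ + ‖Q v‖ := by
    intro v
    simp [hN, NNReal.smul_def, Real.coe_toNNReal C (by linarith)]
  obtain ⟨M, hM0, hM⟩ := (T.prod Q).toLinearMap.exists_antilipschitzWith
    (LinearMap.ker_eq_bot'.2 fun v hv => hTQ v (congrArg Prod.fst hv) (congrArg Prod.snd hv))
  have hM0' : (0 : ℝ) < M := hM0
  have hlow : ∀ v, (M : ℝ)⁻¹ * ‖v‖ ≤ N v := by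
    intro v
    have h1 := hM.le_mul_dist v 0
    rw [map_zero, dist_zero_right, dist_zero_right] at h1
    have h2 : ‖(T.prod Q).toLinearMap v‖ ≤ N v := by
      rw [hNv]
      refine max_le ?_ ?_
      · change ‖T v‖ ≤ _
        nlinarith [norm_nonneg (T v), norm_nonneg (Q v)]
      · change ‖Q v‖ ≤ _
        nlinarith [norm_nonneg (T v), norm_nonneg (Q v)]
    rw [inv_mul_le_iff₀ hM0']
    exact h1.trans (by gcongr)
  have hup : ∀ v, N v ≤ (C * ‖T‖ + ‖Q‖) * ‖v‖ := by
    intro v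
    have e1 := mul_le_mul_of_nonneg_left (T.le_opNorm v) (by linarith : 0 ≤ C)
    have e2 := Q.le_opNorm v
    rw [hNv]
    linarith
  refine contractive_and_stable_of_strict (N := N) (ρ := max ((1 + ρ) / 2) κ) hp hΦp hΨ heq hmaps
    (inv_pos.2 hM0') (fun v => ⟨hlow v, hup v⟩) (le_max_of_le_left (by linarith))
    (max_lt (by linarith) hκ1) fun v => ?_
  rw [hNv, hNv]
  have e1 := mul_le_mul_of_nonneg_left (hT v) (by linarith : 0 ≤ C)
  have e2 := hQ v
  have e3 := mul_le_mul_of_nonneg_right (le_max_left ((1 + ρ) / 2) κ)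
    (mul_nonneg (by linarith : 0 ≤ C) (norm_nonneg (T v)))
  have e4 := mul_le_mul_of_nonneg_right (le_max_right ((1 + ρ) / 2) κ) (norm_nonneg (Q v))
  have e5 := mul_le_mul_of_nonneg_right hCA (norm_nonneg (T v))
  linarith

end BlockTriangular

/-! ### A Lyapunov norm for the heavy ball iteration -/

section HeavyBall

/-- The quadratic Lyapunov inequality for one step `r⁺ = γ r - (1 + γ) α x`, `x⁺ = x + r⁺` of the
heavy ball iteration. -/
theorem heavyBall_lyapunov_le {α γ : ℝ} (hγ : 0 ≤ γ) (hγ1 : γ ≤ 1) (x r : ℝ) :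
    α * (2 - α) * (x + (γ * r - (1 + γ) * α * x)) ^ 2 +
        γ * (γ * r - (1 + γ) * α * x - α * (x + (γ * r - (1 + γ) * α * x))) ^ 2 ≤
      (1 - α * (2 - α) * (1 - γ) ^ 2) * (α * (2 - α) * x ^ 2 + γ * (r - α * x) ^ 2) := by
  -- This expression is exactly the right-hand side minus the left-hand side.
  have h : 0 ≤ γ * (1 - γ) * ((α * (2 - α) * x - (1 - α) * (r - α * x)) ^ 2 +
      γ * (r - α * x) ^ 2) := by
    have := sub_nonneg.2 hγ1
    positivity
  linarith

open scoped InnerProductSpace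

variable {E ι : Type*} [NormedAddCommGroup E] [InnerProductSpace ℝ E] [Fintype ι]
  {T : Submodule ℝ E}

/-- An adapted norm for the heavy ball iteration `r⁺ = γ r - K x`, `x⁺ = x + r⁺` on a subspace,
where `K` is diagonal. -/
theorem exists_heavyBall_norm (b : OrthonormalBasis ι ℝ T) {a : ι → ℝ} {γ a₀ : ℝ} (ha₀ : 0 < a₀)
    (ha₀1 : a₀ ≤ 1) (ha : ∀ i, a₀ ≤ a i) (ha1 : ∀ i, a i ≤ 1) (hγ : 0 < γ) (hγ1 : γ < 1) :
    ∃ (Λ : E × E →L[ℝ] (ι → ℂ) × E × E) (ρ : ℝ), 0 ≤ ρ ∧ ρ < 1 ∧ (∀ v, Λ v = 0 → v = 0) ∧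
      ∀ x r s, s = γ • r - diagOp b a x →
        ‖Λ (diagOp b 1 (x + s), diagOp b 1 s)‖ ≤ ρ * ‖Λ (x, r)‖ := by
  set α : ι → ℝ := fun i => a i / (1 + γ) with hα
  have hαa : ∀ i, a i = (1 + γ) * α i := fun i => by simp only [hα]; field_simp
  set α₀ : ℝ := a₀ / (1 + γ) with hα₀
  have hα₀0 : 0 < α₀ := by positivity
  have hαlow : ∀ i, α₀ ≤ α i := fun i => by simp only [hα, hα₀]; gcongr; exact ha i
  have hα1 : ∀ i, α i ≤ 1 := fun i => by
    simp only [hα]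
    rw [div_le_one (by positivity)]
    linarith [ha1 i]
  have hβ : ∀ i, α₀ ≤ α i * (2 - α i) := fun i => by nlinarith [hαlow i, hα1 i]
  -- The squared modulus of this complex number is the Lyapunov function of the `i`-th mode, which
  -- turns the quadratic form into a norm.
  set Λ₁ : ι → E × E →L[ℝ] ℂ := fun i =>
    (((innerSL ℝ (b i : E)) ∘L ContinuousLinearMap.fst ℝ E E).smulRight
      (√(α i * (2 - α i)) : ℂ)) +
    (((innerSL ℝ (b i : E)) ∘L (ContinuousLinearMap.snd ℝ E E) -
      α i • (innerSL ℝ (b i : E)) ∘L ContinuousLinearMap.fst ℝ E E).smulRight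
        ((√γ : ℂ) * Complex.I)) with hΛ₁
  have hΛ₁v : ∀ i v, Λ₁ i v = ((√(α i * (2 - α i)) * ⟪(b i : E), v.1⟫_ℝ : ℝ) : ℂ) +
      ((√γ * (⟪(b i : E), v.2⟫_ℝ - α i * ⟪(b i : E), v.1⟫_ℝ) : ℝ) : ℂ) * Complex.I := by
    intro i v
    simp [hΛ₁]
    ring
  have hnorm : ∀ i v, ‖Λ₁ i v‖ ^ 2 = α i * (2 - α i) * ⟪(b i : E), v.1⟫_ℝ ^ 2 +
      γ * (⟪(b i : E), v.2⟫_ℝ - α i * ⟪(b i : E), v.1⟫_ℝ) ^ 2 := by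
    intro i v
    rw [hΛ₁v, ← Complex.normSq_eq_norm_sq, Complex.normSq_add_mul_I, mul_pow, mul_pow,
      Real.sq_sqrt (by linarith [hβ i]), Real.sq_sqrt hγ.le]
  -- The normal components are recorded as well, to make `Λ` injective; they vanish after one step.
  set Λ : E × E →L[ℝ] (ι → ℂ) × E × E := (ContinuousLinearMap.pi Λ₁).prod
    (((1 - diagOp b 1) ∘L ContinuousLinearMap.fst ℝ E E).prod
      ((1 - diagOp b 1) ∘L ContinuousLinearMap.snd ℝ E E)) with hΛ
  have hb1 : ∀ u, diagOp b 1 (diagOp b 1 u) = diagOp b 1 u := fun u =>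
    diagOp_one_of_mem b (diagOp_mem b 1 u)
  have he : α₀ * (1 - γ) ^ 2 ≤ 1 := by
    have h1 : α₀ ≤ 1 := by
      rw [hα₀, div_le_one (by positivity)]
      linarith
    nlinarith
  refine ⟨Λ, √(1 - α₀ * (1 - γ) ^ 2), Real.sqrt_nonneg _, ?_, fun v hv => ?_, ?_⟩
  · rw [Real.sqrt_lt' one_pos]
    have := sub_pos.2 hγ1
    have : 0 < α₀ * (1 - γ) ^ 2 := by positivity
    linarith
  · have h1 : ∀ i, Λ₁ i v = 0 := fun i => congrFun (congrArg Prod.fst hv) i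
    have h2 : v.1 - diagOp b 1 v.1 = 0 := congrArg (fun w => w.2.1) hv
    have h3 : v.2 - diagOp b 1 v.2 = 0 := congrArg (fun w => w.2.2) hv
    have h4 : ∀ i, ⟪(b i : E), v.1⟫_ℝ = 0 ∧ ⟪(b i : E), v.2⟫_ℝ = 0 := by
      intro i
      have h5 := hnorm i v
      rw [h1 i, norm_zero] at h5
      have hβi : 0 < α i * (2 - α i) := hα₀0.trans_le (hβ i)
      have h6 : ⟪(b i : E), v.1⟫_ℝ ^ 2 = 0 := by
        nlinarith [sq_nonneg (⟪(b i : E), v.1⟫_ℝ),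
          mul_nonneg hγ.le (sq_nonneg (⟪(b i : E), v.2⟫_ℝ - α i * ⟪(b i : E), v.1⟫_ℝ)),
          mul_nonneg hβi.le (sq_nonneg (⟪(b i : E), v.1⟫_ℝ))]
      have h7 : ⟪(b i : E), v.1⟫_ℝ = 0 := by simpa using h6
      rw [h7] at h5
      refine ⟨h7, ?_⟩
      have : γ * ⟪(b i : E), v.2⟫_ℝ ^ 2 = 0 := by linarith
      simpa [hγ.ne'] using this
    have h8 : diagOp b 1 v.1 = 0 := by simp [diagOp_apply, (h4 _).1]
    have h9 : diagOp b 1 v.2 = 0 := by simp [diagOp_apply, (h4 _).2]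
    rw [h8, sub_zero] at h2
    rw [h9, sub_zero] at h3
    exact Prod.ext h2 h3
  · intro x r s hs
    have hΛn : ∀ i v, ‖Λ₁ i v‖ ≤ ‖Λ v‖ := fun i v =>
      (norm_le_pi_norm (ContinuousLinearMap.pi Λ₁ v) i).trans (norm_fst_le (Λ v))
    have h0 : Λ (diagOp b 1 (x + s), diagOp b 1 s) =
        (fun i => Λ₁ i (diagOp b 1 (x + s), diagOp b 1 s), 0, 0) := by
      refine Prod.ext rfl (Prod.ext ?_ ?_)
      · change diagOp b 1 (x + s) - diagOp b 1 (diagOp b 1 (x + s)) = 0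
        rw [hb1, sub_self]
      · change diagOp b 1 s - diagOp b 1 (diagOp b 1 s) = 0
        rw [hb1, sub_self]
    have hnn : 0 ≤ √(1 - α₀ * (1 - γ) ^ 2) * ‖Λ (x, r)‖ := by positivity
    rw [h0, Prod.norm_mk, Prod.norm_mk, norm_zero, max_self]
    refine max_le ((pi_norm_le_iff_of_nonneg hnn).2 fun i => ?_) hnn
    refine le_trans ?_ (mul_le_mul_of_nonneg_left (hΛn i (x, r)) (Real.sqrt_nonneg _))
    refine le_of_sq_le_sq ?_ (by positivity)
    rw [mul_pow, Real.sq_sqrt (by linarith), hnorm, hnorm]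
    simp only [inner_diagOp, Pi.one_apply, one_mul, inner_add_right]
    have hsi : ⟪(b i : E), s⟫_ℝ = γ * ⟪(b i : E), r⟫_ℝ - (1 + γ) * α i * ⟪(b i : E), x⟫_ℝ := by
      rw [hs, inner_sub_right, inner_diagOp, inner_smul_right, ← hαa]
    rw [hsi]
    refine (heavyBall_lyapunov_le hγ.le hγ1.le _ _).trans ?_
    have hβi : 0 ≤ α i * (2 - α i) := hα₀0.le.trans (hβ i)
    have := hβ i
    gcongr

end HeavyBall

/-! ### The CSD scheme -/

section Schemes

variable {d m k : ℕ} {f : EuclideanSpace ℝ (Fin d) → ℝ}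
  {c : EuclideanSpace ℝ (Fin d) → EuclideanSpace ℝ (Fin m)} {xs : EuclideanSpace ℝ (Fin d)}
  {Ret : EuclideanSpace ℝ (Fin d) → EuclideanSpace ℝ (Fin d) → EuclideanSpace ℝ (Fin d)}
  {R : EuclideanSpace ℝ (Fin d) →L[ℝ] EuclideanSpace ℝ (Fin d)}

/-- The reflected gradient extends from the manifold to a strictly differentiable map whose
linearization at a critical point is the reflected Hessian. -/
theorem exists_reflectedGrad_eq (hc : ContDiff ℝ ∞ c) (hf : ContDiff ℝ ∞ f)
    (hL : SatisfiesLICQ c) (hxs : xs ∈ feasibleSet c) (hcrit : riemGrad f c xs = 0)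
    (hR : R ∘L tangentProj c xs = R) :
    ∃ G : EuclideanSpace ℝ (Fin d) × (EuclideanSpace ℝ (Fin d) →L[ℝ] EuclideanSpace ℝ (Fin d)) →
        EuclideanSpace ℝ (Fin d),
      HasStrictFDerivAt G ((R ∘L riemHess f c xs) ∘L ContinuousLinearMap.fst ℝ _ _) (xs, R) ∧
      G (xs, R) = 0 ∧
      ∀ᶠ p in 𝓝 (xs, R), p.1 ∈ feasibleSet c → G p = p.2 (riemGrad f c p.1) := by
  have hreg := hL.isRegularAt hxs
  obtain ⟨π, hπ, hπd, hπ0, -, hπid⟩ := exists_nearby_projection hc hreg hxs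
  have hfst : Filter.Tendsto (Prod.fst : EuclideanSpace ℝ (Fin d) ×
      (EuclideanSpace ℝ (Fin d) →L[ℝ] EuclideanSpace ℝ (Fin d)) → _) (𝓝 (xs, R)) (𝓝 xs) :=
    continuous_fst.tendsto (xs, R)
  -- Composition with `π` supplies the inner projector of the Hessian, and `R ∘ P = R` supplies the
  -- outer one. The derivative in `R` drops out since the gradient vanishes at `xs`.
  refine ⟨fun p => p.2 (riemGrad f c (π p.1)), ?_, by simp [hπ0, hcrit], ?_⟩
  · have h1 : HasStrictFDerivAt π (tangentProj c xs) xs := by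
      rw [← hπd.fderiv]
      exact hπ.hasStrictFDerivAt (by simp)
    have h2 := (hreg.contDiffAt_riemGrad hc hf).hasStrictFDerivAt (by simp)
    rw [← hπ0] at h2
    have h3 : HasStrictFDerivAt (fun p : EuclideanSpace ℝ (Fin d) ×
        (EuclideanSpace ℝ (Fin d) →L[ℝ] EuclideanSpace ℝ (Fin d)) => riemGrad f c (π p.1)) _
        (xs, R) :=
      HasStrictFDerivAt.comp (g := riemGrad f c ∘ π) (f := Prod.fst) (xs, R) (h2.comp xs h1)
        (hasStrictFDerivAt_fst (𝕜 := ℝ) (p := (xs, R)))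
    have h4 := (hasStrictFDerivAt_snd (𝕜 := ℝ) (p := (xs, R))).clm_apply h3
    refine h4.congr_fderiv (ContinuousLinearMap.ext fun p => ?_)
    have h5 : ∀ u, R (tangentProj c xs u) = R u := fun u => DFunLike.congr_fun hR u
    simp [hπ0, hcrit, riemHess, h5]
  · filter_upwards [hfst.eventually hπid] with p hp hpM
    rw [hp hpM]

theorem HasStrictFDerivAt.comp_prodMk {X V Y Z : Type*} [NormedAddCommGroup X] [NormedSpace ℝ X]
    [NormedAddCommGroup V] [NormedSpace ℝ V] [NormedAddCommGroup Y] [NormedSpace ℝ Y]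
    [NormedAddCommGroup Z] [NormedSpace ℝ Z] {g : V × Y → Z} {g' : V × Y →L[ℝ] Z} {z : V × Y}
    {u : X → V} {u' : X →L[ℝ] V} {v : X → Y} {v' : X →L[ℝ] Y} {p : X}
    (hg : HasStrictFDerivAt g g' z) (hu : HasStrictFDerivAt u u' p)
    (hv : HasStrictFDerivAt v v' p) (hz : (u p, v p) = z) :
    HasStrictFDerivAt (fun q => g (u q, v q)) (g' ∘L u'.prod v') p := by
  subst hz
  exact HasStrictFDerivAt.comp (g := g) (f := fun q => (u q, v q)) p hg (hu.prodMk hv)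

theorem norm_reflection_part_le {V Y Z : Type*} [NormedAddCommGroup V] [NormedSpace ℝ V]
    [NormedAddCommGroup Y] [NormedSpace ℝ Y] [NormedAddCommGroup Z] [NormedSpace ℝ Z]
    (J : V × V × Y →L[ℝ] Z) {κ : ℝ} (hJ : ∀ w, ‖J (0, 0, w)‖ ≤ κ * ‖w‖) (x y : V) (w : Y) :
    ‖J (x, y, w)‖ ≤ ‖J (x, y, 0)‖ + κ * ‖w‖ := by
  have h : J (x, y, w) = J (x, y, 0) + J (0, 0, w) := by rw [← map_add]; simp
  rw [h]
  exact (norm_add_le _ _).trans (by gcongr; exact hJ w)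

variable {b : OrthonormalBasis (Fin (d - m)) ℝ (tangentSpace c xs)} {lam : Fin (d - m) → ℝ}

/-- The position block is diagonal with entries `1 - t |lam i|` on the tangent space and zero on the
normal space, so its operator norm is at most `1 - t μ`. -/
theorem csdStep_contractive_and_stable (hc : ContDiff ℝ ∞ c) (hf : ContDiff ℝ ∞ f)
    (hL : SatisfiesLICQ c) (hRet : IsRetraction c Ret) (hxs : xs ∈ feasibleSet c)
    (hcrit : riemGrad f c xs = 0) {t μ κ : ℝ} (hRs : IsTangentSymmetric c xs R)
    (hκ1 : κ < 1) (hμ : 0 < t * μ) (hμ1 : t * μ < 1)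
    (hlam : ∀ i, t * μ ≤ t * |lam i| ∧ t * |lam i| ≤ 1)
    (hRH : R ∘L riemHess f c xs = diagOp b fun i => |lam i|)
    (h𝓡 : ∃ (𝓡 : EuclideanSpace ℝ (Fin d) × EuclideanSpace ℝ (Fin d) ×
          (EuclideanSpace ℝ (Fin d) →L[ℝ] EuclideanSpace ℝ (Fin d)) →
        EuclideanSpace ℝ (Fin d) →L[ℝ] EuclideanSpace ℝ (Fin d))
      (J : EuclideanSpace ℝ (Fin d) × EuclideanSpace ℝ (Fin d) ×
          (EuclideanSpace ℝ (Fin d) →L[ℝ] EuclideanSpace ℝ (Fin d)) →L[ℝ]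
        EuclideanSpace ℝ (Fin d) →L[ℝ] EuclideanSpace ℝ (Fin d)),
      HasStrictFDerivAt 𝓡 J (xs, xs, R) ∧ 𝓡 (xs, xs, R) = R ∧
      (∀ W, ‖J (0, 0, W)‖ ≤ κ * ‖W‖) ∧
      ∀ᶠ p in 𝓝 (xs, xs, R), p.1 ∈ feasibleSet c → p.2.1 ∈ feasibleSet c →
        IsTangentSymmetric c p.1 p.2.2 →
          reflectionUpdate f c k t p.1 p.2.1 p.2.2 = 𝓡 p ∧
          IsTangentSymmetric c p.2.1 (reflectionUpdate f c k t p.1 p.2.1 p.2.2)) :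
    IsLocallyContractiveAt (csdStates c) (csdStep f c Ret k t) (xs, R) ∧
      IsLinearlyStableAt (csdStates c) (csdStep f c Ret k t) (xs, R) := by
  have hreg := hL.isRegularAt hxs
  obtain ⟨𝓡, J𝓡, h𝓡d, h𝓡0, hJ𝓡, h𝓡ev⟩ := h𝓡
  obtain ⟨ϱ, hϱd, hϱ0, hϱev⟩ := hRet.exists_extension hc hL hxs
  obtain ⟨G, hGd, hG0, hGev⟩ := exists_reflectedGrad_eq hc hf hL hxs hcrit hRs.2.2
  rw [hRH] at hGd
  set K := diagOp b fun i => |lam i|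
  set y : EuclideanSpace ℝ (Fin d) × (EuclideanSpace ℝ (Fin d) →L[ℝ] EuclideanSpace ℝ (Fin d)) →
    EuclideanSpace ℝ (Fin d) := fun p => ϱ (p.1, -(t • G p)) with hy
  set Φ : EuclideanSpace ℝ (Fin d) × (EuclideanSpace ℝ (Fin d) →L[ℝ] EuclideanSpace ℝ (Fin d)) →
    EuclideanSpace ℝ (Fin d) × (EuclideanSpace ℝ (Fin d) →L[ℝ] EuclideanSpace ℝ (Fin d)) :=
    fun p => (y p, 𝓡 (p.1, y p, p.2)) with hΦ
  have hy0 : y (xs, R) = xs := by simp only [hy, hG0, smul_zero, neg_zero, hϱ0]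
  have hx : HasStrictFDerivAt (fun p : EuclideanSpace ℝ (Fin d) ×
      (EuclideanSpace ℝ (Fin d) →L[ℝ] EuclideanSpace ℝ (Fin d)) => p.1)
      (ContinuousLinearMap.fst ℝ _ _) (xs, R) := hasStrictFDerivAt_fst
  have hw : HasStrictFDerivAt (fun p : EuclideanSpace ℝ (Fin d) ×
      (EuclideanSpace ℝ (Fin d) →L[ℝ] EuclideanSpace ℝ (Fin d)) => p.2)
      (ContinuousLinearMap.snd ℝ _ _) (xs, R) := hasStrictFDerivAt_snd
  have hv := (hGd.fun_const_smul t).fun_neg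
  have hyd := HasStrictFDerivAt.comp_prodMk hϱd hx hv (by simp [hG0])
  have hWd := HasStrictFDerivAt.comp_prodMk h𝓡d hx (hyd.prodMk hw)
    (by simp only [hG0, smul_zero, neg_zero, hϱ0])
  have hΦd : HasStrictFDerivAt Φ _ (xs, R) := hyd.prodMk hWd
  have hΦ0 : Φ (xs, R) = (xs, R) := by simp only [hΦ, hy0, h𝓡0]
  have hev : ∀ᶠ q in 𝓝[csdStates c] (xs, R), csdStep f c Ret k t q = Φ q ∧
      csdStep f c Ret k t q ∈ csdStates c := by
    have hvt : Filter.Tendsto (fun p : EuclideanSpace ℝ (Fin d) ×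
        (EuclideanSpace ℝ (Fin d) →L[ℝ] EuclideanSpace ℝ (Fin d)) => (p.1, -(t • G p)))
        (𝓝 (xs, R)) (𝓝 (xs, 0)) := by
      have := (hx.prodMk hv).continuousAt.tendsto
      simpa only [hG0, smul_zero, neg_zero] using this
    have hzt : Filter.Tendsto (fun p : EuclideanSpace ℝ (Fin d) ×
        (EuclideanSpace ℝ (Fin d) →L[ℝ] EuclideanSpace ℝ (Fin d)) => (p.1, y p, p.2))
        (𝓝 (xs, R)) (𝓝 (xs, xs, R)) := by
      have := (hx.prodMk (hyd.prodMk hw)).continuousAt.tendsto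
      simpa only [hG0, smul_zero, neg_zero, hϱ0] using this
    filter_upwards [self_mem_nhdsWithin, nhdsWithin_le_nhds (hvt.eventually hϱev),
      nhdsWithin_le_nhds (hzt.eventually h𝓡ev), nhdsWithin_le_nhds hGev]
      with p ⟨hpM, hpS⟩ h1 h2 h3
    have hvT : -(t • G p) ∈ tangentSpace c p.1 := by
      rw [h3 hpM]
      exact neg_mem (Submodule.smul_mem _ _ (hpS.2.1 _))
    have h4 : Ret p.1 (-(t • p.2 (riemGrad f c p.1))) = y p := by
      rw [← h3 hpM]
      exact h1 hpM hvT
    have hyM : y p ∈ feasibleSet c := by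
      have h5 : Ret p.1 (-(t • G p)) = y p := h1 hpM hvT
      rw [← h5]
      exact hRet.mem _ hpM _ hvT
    obtain ⟨h5, h6⟩ := h2 hpM hyM hpS
    have h7 : csdStep f c Ret k t p = (y p, reflectionUpdate f c k t p.1 (y p) p.2) := by
      rw [← h4]
      rfl
    exact ⟨h7.trans (by rw [h5]), by rw [h7]; exact ⟨hyM, h6⟩⟩
  have hP := hreg.tangentProj_eq_diagOp b
  have hJ1 : ∀ u, ‖tangentProj c xs (u + -(t • K u))‖ ≤ (1 - t * μ) * ‖u‖ := by
    intro u
    have h1 : tangentProj c xs (u + -(t • K u)) = diagOp b (1 - t • fun i => |lam i|) u := by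
      have h2 : tangentProj c xs (K u) = K u := tangentProj_of_mem (diagOp_mem b _ u)
      rw [map_add, map_neg, map_smul, h2, diagOp_sub, diagOp_smul, hP]
      simp [sub_eq_add_neg, K]
    rw [h1]
    refine (ContinuousLinearMap.le_opNorm _ _).trans ?_
    gcongr
    refine norm_diagOp_le b (by linarith) fun i => ?_
    have h2 := hlam i
    simp only [Pi.sub_apply, Pi.one_apply, Pi.smul_apply, smul_eq_mul]
    rw [abs_of_nonneg (by linarith)]
    linarith
  refine contractive_and_stable_of_blockTriangular (T := ContinuousLinearMap.fst ℝ _ _)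
    (Q := ContinuousLinearMap.snd ℝ _ _) (A := ‖J𝓡‖) (ρ := 1 - t * μ) (κ := κ) ⟨hxs, hRs⟩
    ?_ hΦd (hev.mono fun _ h => h.1) (hev.mono fun _ h => h.2)
    (fun v h1 h2 => Prod.ext h1 h2) (norm_nonneg J𝓡) (by linarith) (by linarith) hκ1
    (fun v => hJ1 v.1) fun v => ?_
  · exact (hev.self_of_nhdsWithin ⟨hxs, hRs⟩).1.trans hΦ0
  · change ‖J𝓡 (v.1, tangentProj c xs (v.1 + -(t • K v.1)), v.2)‖ ≤ ‖J𝓡‖ * ‖v.1‖ + κ * ‖v.2‖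
    refine (norm_reflection_part_le J𝓡 hJ𝓡 _ _ _).trans ?_
    gcongr
    refine (J𝓡.le_opNorm _).trans ?_
    gcongr
    refine max_le le_rfl (max_le ((hJ1 v.1).trans ?_) (by simp))
    nlinarith [norm_nonneg v.1]

end Schemes

/-! ### The MCSD scheme -/

section Momentum

variable {d m k : ℕ} {f : EuclideanSpace ℝ (Fin d) → ℝ}
  {c : EuclideanSpace ℝ (Fin d) → EuclideanSpace ℝ (Fin m)} {xs : EuclideanSpace ℝ (Fin d)}
  {Ret : EuclideanSpace ℝ (Fin d) → EuclideanSpace ℝ (Fin d) → EuclideanSpace ℝ (Fin d)}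
  {R : EuclideanSpace ℝ (Fin d) →L[ℝ] EuclideanSpace ℝ (Fin d)}
  {b : OrthonormalBasis (Fin (d - m)) ℝ (tangentSpace c xs)} {lam : Fin (d - m) → ℝ}

set_option maxHeartbeats 1000000 in
theorem mcsdStep_contractive_and_stable (hc : ContDiff ℝ ∞ c) (hf : ContDiff ℝ ∞ f)
    (hL : SatisfiesLICQ c) (hRet : IsRetraction c Ret) (hxs : xs ∈ feasibleSet c)
    (hcrit : riemGrad f c xs = 0) {t μ κ γ : ℝ} (hRs : IsTangentSymmetric c xs R)
    (hκ1 : κ < 1) (hμ : 0 < t * μ) (hμ1 : t * μ < 1)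
    (hlam : ∀ i, t * μ ≤ t * |lam i| ∧ t * |lam i| ≤ 1) (hγ : 0 < γ) (hγ1 : γ < 1)
    (hRH : R ∘L riemHess f c xs = diagOp b fun i => |lam i|)
    (h𝓡 : ∃ (𝓡 : EuclideanSpace ℝ (Fin d) × EuclideanSpace ℝ (Fin d) ×
          (EuclideanSpace ℝ (Fin d) →L[ℝ] EuclideanSpace ℝ (Fin d)) →
        EuclideanSpace ℝ (Fin d) →L[ℝ] EuclideanSpace ℝ (Fin d))
      (J : EuclideanSpace ℝ (Fin d) × EuclideanSpace ℝ (Fin d) ×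
          (EuclideanSpace ℝ (Fin d) →L[ℝ] EuclideanSpace ℝ (Fin d)) →L[ℝ]
        EuclideanSpace ℝ (Fin d) →L[ℝ] EuclideanSpace ℝ (Fin d)),
      HasStrictFDerivAt 𝓡 J (xs, xs, R) ∧ 𝓡 (xs, xs, R) = R ∧
      (∀ W, ‖J (0, 0, W)‖ ≤ κ * ‖W‖) ∧
      ∀ᶠ p in 𝓝 (xs, xs, R), p.1 ∈ feasibleSet c → p.2.1 ∈ feasibleSet c →
        IsTangentSymmetric c p.1 p.2.2 →
          reflectionUpdate f c k t p.1 p.2.1 p.2.2 = 𝓡 p ∧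
          IsTangentSymmetric c p.2.1 (reflectionUpdate f c k t p.1 p.2.1 p.2.2)) :
    IsLocallyContractiveAt (mcsdStates c) (mcsdStep f c Ret k t γ) (xs, 0, R) ∧
      IsLinearlyStableAt (mcsdStates c) (mcsdStep f c Ret k t γ) (xs, 0, R) := by
  have hreg := hL.isRegularAt hxs
  have hP := hreg.tangentProj_eq_diagOp b
  obtain ⟨𝓡, J𝓡, h𝓡d, h𝓡0, hJ𝓡, h𝓡ev⟩ := h𝓡
  obtain ⟨ϱ, hϱd, hϱ0, hϱev⟩ := hRet.exists_extension hc hL hxs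
  obtain ⟨G, hGd, hG0, hGev⟩ := exists_reflectedGrad_eq hc hf hL hxs hcrit hRs.2.2
  obtain ⟨𝒯, DT, hTd, hT0, hTev⟩ := exists_parallelTranslation_eq hc hL hxs
  obtain ⟨Λ, ρ, hρ0, hρ1, hΛ0, hΛ⟩ := exists_heavyBall_norm b (a := fun i => t * |lam i|) hμ hμ1.le
    (fun i => (hlam i).1) (fun i => (hlam i).2) hγ hγ1
  rw [hRH] at hGd
  set K := diagOp b fun i => |lam i| with hK
  have hx : HasStrictFDerivAt (fun p : EuclideanSpace ℝ (Fin d) × EuclideanSpace ℝ (Fin d) ×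
      (EuclideanSpace ℝ (Fin d) →L[ℝ] EuclideanSpace ℝ (Fin d)) => p.1)
      (ContinuousLinearMap.fst ℝ _ _) (xs, 0, R) := hasStrictFDerivAt_fst
  have hr : HasStrictFDerivAt (fun p : EuclideanSpace ℝ (Fin d) × EuclideanSpace ℝ (Fin d) ×
      (EuclideanSpace ℝ (Fin d) →L[ℝ] EuclideanSpace ℝ (Fin d)) => p.2.1)
      (ContinuousLinearMap.fst ℝ _ _ ∘L ContinuousLinearMap.snd ℝ _ _) (xs, 0, R) :=
    (hasStrictFDerivAt_fst (p := (0, R))).comp (xs, 0, R) hasStrictFDerivAt_snd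
  have hw : HasStrictFDerivAt (fun p : EuclideanSpace ℝ (Fin d) × EuclideanSpace ℝ (Fin d) ×
      (EuclideanSpace ℝ (Fin d) →L[ℝ] EuclideanSpace ℝ (Fin d)) => p.2.2)
      (ContinuousLinearMap.snd ℝ _ _ ∘L ContinuousLinearMap.snd ℝ _ _) (xs, 0, R) :=
    (hasStrictFDerivAt_snd (p := (0, R))).comp (xs, 0, R) hasStrictFDerivAt_snd
  set s : EuclideanSpace ℝ (Fin d) × EuclideanSpace ℝ (Fin d) ×
      (EuclideanSpace ℝ (Fin d) →L[ℝ] EuclideanSpace ℝ (Fin d)) → EuclideanSpace ℝ (Fin d) :=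
    fun p => -(t • G (p.1, p.2.2)) + γ • p.2.1 with hs
  set y : EuclideanSpace ℝ (Fin d) × EuclideanSpace ℝ (Fin d) ×
      (EuclideanSpace ℝ (Fin d) →L[ℝ] EuclideanSpace ℝ (Fin d)) → EuclideanSpace ℝ (Fin d) :=
    fun p => ϱ (p.1, s p) with hy
  set Φ : EuclideanSpace ℝ (Fin d) × EuclideanSpace ℝ (Fin d) ×
      (EuclideanSpace ℝ (Fin d) →L[ℝ] EuclideanSpace ℝ (Fin d)) →
    EuclideanSpace ℝ (Fin d) × EuclideanSpace ℝ (Fin d) ×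
      (EuclideanSpace ℝ (Fin d) →L[ℝ] EuclideanSpace ℝ (Fin d)) :=
    fun p => (y p, 𝒯 (p.1, y p) (s p), 𝓡 (p.1, y p, p.2.2)) with hΦ
  have hs0 : s (xs, 0, R) = 0 := by simp [hs, hG0]
  have hy0 : y (xs, 0, R) = xs := by simp only [hy, hs0, hϱ0]
  have hsd : HasStrictFDerivAt s _ (xs, 0, R) :=
    ((HasStrictFDerivAt.comp_prodMk hGd hx hw rfl).fun_const_smul t).fun_neg.fun_add
      (hr.fun_const_smul γ)
  have hyd : HasStrictFDerivAt y _ (xs, 0, R) :=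
    HasStrictFDerivAt.comp_prodMk hϱd hx hsd (by rw [hs0])
  have hTd' := HasStrictFDerivAt.comp_prodMk hTd hx hyd (by rw [hy0])
  have hWd := HasStrictFDerivAt.comp_prodMk h𝓡d hx (hyd.prodMk hw) (by rw [hy0])
  set s' : EuclideanSpace ℝ (Fin d) → EuclideanSpace ℝ (Fin d) → EuclideanSpace ℝ (Fin d) :=
    fun u w => -(t • K u) + γ • w with hs'
  -- The transport acts on a vector `s` that vanishes at the fixed point, so its derivative does not
  -- enter, only its value `P`.
  obtain ⟨J, hΦd, hJ⟩ : ∃ J, HasStrictFDerivAt Φ J (xs, 0, R) ∧ ∀ v, J v =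
      (tangentProj c xs (v.1 + s' v.1 v.2.1), tangentProj c xs (s' v.1 v.2.1),
        J𝓡 (v.1, tangentProj c xs (v.1 + s' v.1 v.2.1), v.2.2)) := by
    refine ⟨_, hyd.prodMk ((hTd'.clm_apply hsd).prodMk hWd), fun v => ?_⟩
    refine Prod.ext rfl (Prod.ext ?_ rfl)
    change 𝒯 (xs, y (xs, 0, R)) (s' v.1 v.2.1) + _ = tangentProj c xs (s' v.1 v.2.1)
    rw [hy0, hT0, hs0, map_zero]
    exact add_zero _
  have hΦ0 : Φ (xs, 0, R) = (xs, 0, R) := by simp only [hΦ, hy0, hs0, map_zero, h𝓡0]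
  have hev : ∀ᶠ q in 𝓝[mcsdStates c] (xs, 0, R), mcsdStep f c Ret k t γ q = Φ q ∧
      mcsdStep f c Ret k t γ q ∈ mcsdStates c := by
    have hvt := (hx.prodMk hsd).continuousAt.tendsto
    have hxy := (hx.prodMk hyd).continuousAt.tendsto
    have hzt := (hx.prodMk (hyd.prodMk hw)).continuousAt.tendsto
    have hGt := (hx.prodMk hw).continuousAt.tendsto
    simp only [hs0] at hvt
    simp only [hy0] at hxy hzt
    filter_upwards [self_mem_nhdsWithin, nhdsWithin_le_nhds (hvt.eventually hϱev),
      nhdsWithin_le_nhds (hzt.eventually h𝓡ev), nhdsWithin_le_nhds (hGt.eventually hGev),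
      nhdsWithin_le_nhds (hxy.eventually hTev)]
      with p ⟨hpM, hpr, hpS⟩ h1 h2 h3 h8
    have hvT : s p ∈ tangentSpace c p.1 := by
      simp only [hs]
      rw [h3 hpM]
      exact add_mem (neg_mem (Submodule.smul_mem _ _ (hpS.2.1 _))) (Submodule.smul_mem _ _ hpr)
    have hsp : -(t • p.2.2 (riemGrad f c p.1)) + γ • p.2.1 = s p := by
      simp only [hs]
      rw [h3 hpM]
    have h4 : Ret p.1 (s p) = y p := h1 hpM hvT
    have hyM : y p ∈ feasibleSet c := by
      rw [← h4]
      exact hRet.mem _ hpM _ hvT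
    obtain ⟨h5, h6⟩ := h2 hpM hyM hpS
    obtain ⟨h9, -, -, h10, -⟩ := h8 hpM hyM
    have h7 : mcsdStep f c Ret k t γ p =
        (y p, parallelTranslation c p.1 (y p) (s p), reflectionUpdate f c k t p.1 (y p) p.2.2) := by
      rw [← h4, ← hsp]
      rfl
    rw [h9] at h7
    exact ⟨h7.trans (by rw [h5]), by rw [h7]; exact ⟨hyM, h10 _, h6⟩⟩
  have hs'v : ∀ u w, s' u w = γ • w - diagOp b (fun i => t * |lam i|) u := by
    intro u w
    have : diagOp b (fun i => t * |lam i|) = t • K := diagOp_smul b t fun i => |lam i|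
    rw [this, hs', sub_eq_add_neg, add_comm]
    rfl
  obtain ⟨M, -, hM⟩ := Λ.toLinearMap.exists_antilipschitzWith (LinearMap.ker_eq_bot'.2 hΛ0)
  -- `B` is the coupling of the reflection to `(x, r)`; the antilipschitz constant of `Λ` bounds it
  -- by `‖Λ (x, r)‖`.
  set B : EuclideanSpace ℝ (Fin d) × EuclideanSpace ℝ (Fin d) →L[ℝ]
      EuclideanSpace ℝ (Fin d) →L[ℝ] EuclideanSpace ℝ (Fin d) :=
    J𝓡 ∘L (ContinuousLinearMap.fst ℝ _ _).prod ((tangentProj c xs ∘L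
      (ContinuousLinearMap.fst ℝ _ _ + (-(t • (K ∘L ContinuousLinearMap.fst ℝ
        (EuclideanSpace ℝ (Fin d)) (EuclideanSpace ℝ (Fin d)))) + γ • ContinuousLinearMap.snd ℝ
          (EuclideanSpace ℝ (Fin d)) (EuclideanSpace ℝ (Fin d))))).prod 0) with hB
  refine contractive_and_stable_of_blockTriangular
    (T := Λ ∘L (ContinuousLinearMap.fst ℝ _ _).prod
      (ContinuousLinearMap.fst ℝ _ _ ∘L ContinuousLinearMap.snd ℝ _ _))
    (Q := ContinuousLinearMap.snd ℝ _ _ ∘L ContinuousLinearMap.snd ℝ _ _) (A := ‖B‖ * M) (ρ := ρ)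
    (κ := κ) ⟨hxs, Submodule.zero_mem _, hRs⟩
    ?_ hΦd (hev.mono fun _ h => h.1) (hev.mono fun _ h => h.2)
    (fun v h1 h2 => ?_) (mul_nonneg (norm_nonneg B) M.2) hρ0 hρ1 hκ1 (fun v => ?_) fun v => ?_
  · exact (hev.self_of_nhdsWithin ⟨hxs, Submodule.zero_mem _, hRs⟩).1.trans hΦ0
  · have h3 : (v.1, v.2.1) = 0 := hΛ0 _ h1
    have h4 : v.1 = 0 := congrArg Prod.fst h3
    have h5 : v.2.1 = 0 := congrArg Prod.snd h3
    exact Prod.ext h4 (Prod.ext h5 h2)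
  · rw [hJ]
    change ‖Λ (tangentProj c xs (v.1 + s' v.1 v.2.1), tangentProj c xs (s' v.1 v.2.1))‖ ≤
      ρ * ‖Λ (v.1, v.2.1)‖
    rw [hP]
    exact hΛ _ _ _ (hs'v _ _)
  · rw [hJ]
    change ‖J𝓡 (v.1, tangentProj c xs (v.1 + s' v.1 v.2.1), v.2.2)‖ ≤
      ‖B‖ * M * ‖Λ (v.1, v.2.1)‖ + κ * ‖v.2.2‖
    refine (norm_reflection_part_le J𝓡 hJ𝓡 _ _ _).trans ?_
    gcongr
    have hBv : J𝓡 (v.1, tangentProj c xs (v.1 + s' v.1 v.2.1), 0) = B (v.1, v.2.1) := by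
      simp [hB, hs']
    rw [hBv]
    refine (B.le_opNorm _).trans ?_
    rw [mul_assoc]
    gcongr
    have h1 := hM.le_mul_dist (v.1, v.2.1) 0
    rwa [map_zero, dist_zero_right, dist_zero_right] at h1

end Momentum

end SaddleDynamics

theorem mainTheorem6 {d m k : ℕ} (hk : k + m < d)
    (f : EuclideanSpace ℝ (Fin d) → ℝ) (hf : ContDiff ℝ ∞ f)
    (c : EuclideanSpace ℝ (Fin d) → EuclideanSpace ℝ (Fin m)) (hc : ContDiff ℝ ∞ c)
    (hLICQ : SaddleDynamics.SatisfiesLICQ c)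
    (Ret : EuclideanSpace ℝ (Fin d) → EuclideanSpace ℝ (Fin d) → EuclideanSpace ℝ (Fin d))
    (hRet : SaddleDynamics.IsRetraction c Ret)
    (xs : EuclideanSpace ℝ (Fin d)) (hxs : xs ∈ SaddleDynamics.feasibleSet c)
    (hcrit : SaddleDynamics.riemGrad f c xs = 0)
    (δ μ L : ℝ) (hsaddle : SaddleDynamics.StrictSaddle f c k xs δ μ L)
    (v : Fin k → EuclideanSpace ℝ (Fin d)) (hv : Orthonormal ℝ v)
    (hvT : ∀ i, v i ∈ SaddleDynamics.tangentSpace c xs)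
    (hvE : ∀ i, ∃ l : ℝ, l < 0 ∧ SaddleDynamics.riemHess f c xs (v i) = l • v i)
    (Δt : ℝ) (hΔt : 0 < Δt) (hΔtL : Δt < 1 / (2 * L)) :
    (SaddleDynamics.IsLocallyContractiveAt (SaddleDynamics.csdStates c)
        (SaddleDynamics.csdStep f c Ret k Δt)
        (xs, SaddleDynamics.householder c xs v) ∧
      SaddleDynamics.IsLinearlyStableAt (SaddleDynamics.csdStates c)
        (SaddleDynamics.csdStep f c Ret k Δt)
        (xs, SaddleDynamics.householder c xs v)) ∧
    ∀ γ : ℝ, 0 < γ → γ < 1 →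
      SaddleDynamics.IsLocallyContractiveAt (SaddleDynamics.mcsdStates c)
        (SaddleDynamics.mcsdStep f c Ret k Δt γ)
        (xs, 0, SaddleDynamics.householder c xs v) ∧
      SaddleDynamics.IsLinearlyStableAt (SaddleDynamics.mcsdStates c)
        (SaddleDynamics.mcsdStep f c Ret k Δt γ)
        (xs, 0, SaddleDynamics.householder c xs v) := by
  have hreg := hLICQ.isRegularAt hxs
  have hk' : k ≤ d - m := by omega
  obtain ⟨lam, b, hH, hneg, hpos⟩ := hsaddle.exists_eigenbasis hreg hxs
  obtain ⟨-, hμ, hμL, -⟩ := id hsaddle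
  have htL : Δt * L < 1 / 2 := by
    rw [lt_div_iff₀ (by linarith)] at hΔtL
    linarith
  have hneg' : ∀ i : Fin (d - m), (i : ℕ) < k → lam i < 0 := fun i hi => by
    linarith [(hneg i hi).2]
  have hpos' : ∀ i : Fin (d - m), k ≤ (i : ℕ) → 0 < lam i := fun i hi => by
    linarith [(hpos i hi).1]
  have habs : ∀ i, μ ≤ |lam i| ∧ |lam i| ≤ L := by
    intro i
    rcases lt_or_ge (i : ℕ) k with hi | hi
    · rw [abs_of_neg (hneg' i hi)]
      exact ⟨by linarith [(hneg i hi).2], by linarith [(hneg i hi).1]⟩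
    · rw [abs_of_pos (hpos' i hi)]
      exact hpos i hi
  have hR := SaddleDynamics.householder_eq_diagOp hk' hreg hH hpos' hv hvT hvE
  set R := SaddleDynamics.householder c xs v
  have hRs : SaddleDynamics.IsTangentSymmetric c xs R := by
    rw [hR]
    exact SaddleDynamics.isTangentSymmetric_diagOp hreg b _
  have hRH : R ∘L SaddleDynamics.riemHess f c xs = SaddleDynamics.diagOp b fun i => |lam i| := by
    rw [hR, hH, SaddleDynamics.diagOp_comp]
    congr 1
    ext i
    simp only [Pi.mul_apply]
    split_ifs with hi
    · rw [abs_of_neg (hneg' i hi)]; ring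
    · rw [abs_of_pos (hpos' i (not_lt.1 hi))]; ring
  have hμt : 0 < Δt * μ := mul_pos hΔt hμ
  have hμL' : Δt * μ < Δt * L := mul_lt_mul_of_pos_left hμL hΔt
  have hlam : ∀ i, Δt * μ ≤ Δt * |lam i| ∧ Δt * |lam i| ≤ Δt * L := fun i =>
    ⟨mul_le_mul_of_nonneg_left (habs i).1 hΔt.le, mul_le_mul_of_nonneg_left (habs i).2 hΔt.le⟩
  -- Since `2 Δt |lam i| ≤ 2 Δt L < 1`, the number `1 - 2 Δt |lam i|` is positive, and it is at most
  -- `κ = 1 - 2 Δt μ`.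
  have h𝓡 := SaddleDynamics.exists_reflectionUpdate_eq (t := Δt) (κ := 1 - 2 * (Δt * μ)) hc hf hLICQ
    hxs hk' hH hneg' hpos' (hsaddle.eventually_isTangentSymmetric hc hLICQ hxs) hR (by linarith)
    fun i => by
      have := hlam i
      rw [abs_of_nonneg (by linarith)]
      linarith
  have hlam1 : ∀ i, Δt * μ ≤ Δt * |lam i| ∧ Δt * |lam i| ≤ 1 := fun i =>
    ⟨(hlam i).1, by linarith [(hlam i).2]⟩
  exact ⟨SaddleDynamics.csdStep_contractive_and_stable hc hf hLICQ hRet hxs hcrit hRs (by linarith)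
      hμt (by linarith) hlam1 hRH h𝓡,
    fun γ hγ hγ1 => SaddleDynamics.mcsdStep_contractive_and_stable hc hf hLICQ hRet hxs hcrit hRs
      (by linarith) hμt (by linarith) hlam1 hγ hγ1 hRH h𝓡⟩
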